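/- Let $\mathbb F$ be an algebraically closed field with $\operatorname{char}\mathbb F\neq 2$, let $G$ be an abelian group, put $G^\#=G\times\mathbb Z_2$, and let $n\ge 1$. The superalgebra $M(n,n)$ is $M_{2n}(\mathbb F)=\operatorname{End}(\mathbb F^n\oplus\mathbb F^n)$ with block diagonal matrices even and block antidiagonal matrices odd. A $G$-grading on it is an algebra grading whose components are sub-superspaces; equivalently, it is a $G^\#$-grading whose coarsening by $G^\#\to\mathbb Z_2$ is the canonical one. The grading is called odd if, as a $G^\#$-graded algebra, $M(n,n)\cong\operatorname{End}_{\mathcal D}(\mathcal U)$ where $\mathcal D$ is a finite-dimensional $G^\#$-graded division algebra having a nonzero component of degree $(g,\bar1)$ for some $g\in G$ and $\mathcal U$ is a finite-dimensional graded right $\mathcal D$-module. Two $G$-gradings are isomorphic if there is a superalgebra isomorphism mapping each component onto the component of the same degree. For each $t_0\in G$ of order $2$ and each finite subgroup $\bar T\subseteq G/\langle t_0\rangle$, let $T^+\subseteq G$ be the inverse image of $\bar T$, and fix once and for all a character $\chi:T^+\to\mathbb F^\times$ with $\chi(t_0)=-1$. For a nondegenerate alternating bicharacter $\bar\beta$ on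 $\bar T$, there is a unique $a\in T^+$ with $\chi(a)=1$ and $\chi(t)^2=\bar\beta(\bar a,\bar t)$ for all $t\in T^+$. Let $u\in G$ satisfy $u^2=a$, and let $\gamma=(g_1,\dots,g_k)$ be a tuple of elements of $G$ with $k\sqrt{|\bar T|}=n$. Put $t_1=(u,\bar1)$ and $T_u=T^+\cup t_1T^+\subseteq G^\#$ (identifying $G$ with $G\times\{\bar0\}$), and let $\beta_u$ be the unique alternating bicharacter on $T_u$ that extends the bicharacter on $T^+$ induced by $\bar\beta$ and satisfies $\beta_u(t_1,t)=\chi(t)$ for $t\in T^+$; it is nondegenerate. Write $T_u=A\times B$ with $\beta_u$ trivial on $A$ and on $B$, and let $\mathcal D=\operatorname{End}(\mathbb FB)$ be graded so that, for $a\in A$ and $b\in B$, the component of degree $ab$ is spanned by the operator $X_{ab}:e_{b'}\mapsto\beta_u(a,bb')e_{bb'}$ (and components of degree outside $T_u$ are zero). Let $\mathcal U=\mathcal D^{[g_1]}\oplus\cdots\oplus\mathcal D^{[g_k]}$, where $\mathcal D^{[g]}$ is the right $\mathcal D$-module $\mathcal D$ with the component of degree $h$ relabeled by $hg$. The superalgebra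 $\operatorname{End}_{\mathcal D}(\mathcal U)$ (with its $G^\#$-grading) is isomorphic to $M(n,n)$, and $\Gamma(t_0,\bar T,\bar\beta,u,\gamma)$ denotes the corresponding $G$-grading on $M(n,n)$, defined up to isomorphism; it is odd. Theorem. Every odd $G$-grading on the superalgebra $M(n,n)$ is isomorphic to some $\Gamma(t_0,\bar T,\bar\beta,u,\gamma)$. Two such gradings $\Gamma(t_0,\bar T,\bar\beta,u,\gamma)$ and $\Gamma(t_0',\bar T',\bar\beta',u',\gamma')$ on $M(n,n)$ are isomorphic if and only if $t_0=t_0'$, $\bar T=\bar T'$, $\bar\beta=\bar\beta'$, $u\equiv u'\pmod{\langle t_0\rangle}$, and there is $g\in G$ such that $g\,\Xi(\gamma)=\Xi(\gamma')$, where $\Xi(\gamma)$ is the multiset of the cosets $g_1T^+,\dots,g_kT^+$ in $G/T^+$. -/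

import Mathlib

open Subgroup

noncomputable section

universe u v

namespace OddGradings

/-! ### Graded algebras and graded modules -/

/-- The group of order two, written multiplicatively; `1` is the even class and
`odd` is the odd class. -/
abbrev Z2 : Type := Multiplicative (ZMod 2)

/-- The odd class. -/
abbrev odd : Z2 := Multiplicative.ofAdd 1

/-- The group `G × ℤ₂`. -/
abbrev Sharp (G : Type v) : Type v := G × Z2

section Gradings

variable {F : Type*} [Field F] {H : Type*} [CommGroup H]

/-- `V` is the direct sum of the subspaces `V h`. -/
def IsVectorGrading {M : Type*} [AddCommMonoid M] [Module F M] (V : H → Submodule F M) : Prop :=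
  iSupIndep V ∧ (⨆ h, V h) = ⊤

/-- `A h` is an `H`-grading on the algebra `R`. -/
def IsAlgebraGrading {R : Type*} [Semiring R] [Algebra F R] (A : H → Submodule F R) : Prop :=
  IsVectorGrading A ∧ ∀ g h, ∀ x ∈ A g, ∀ y ∈ A h, x * y ∈ A (g * h)

/-- The graded algebra `D` is a graded division algebra. -/
def IsGradedDivision {D : Type*} [Semiring D] [Algebra F D] (A : H → Submodule F D) : Prop :=
  IsAlgebraGrading A ∧ Nontrivial D ∧ ∀ h, ∀ d ∈ A h, d ≠ 0 → IsUnit d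

/-- The coarsening of a grading induced by a group homomorphism. -/
def coarsening {K : Type*} [CommGroup K] {M : Type*} [AddCommMonoid M] [Module F M]
    (α : H →* K) (V : H → Submodule F M) (k : K) : Submodule F M :=
  ⨆ (h : H) (_ : α h = k), V h

/-- `U` is a graded right module over the graded algebra `D`
(right modules are modules over the opposite ring). -/
def IsGradedRightModule {D : Type*} [Semiring D] [Algebra F D] (A : H → Submodule F D)
    {U : Type*} [AddCommMonoid U] [Module F U] [Module Dᵐᵒᵖ U] (V : H → Submodule F U) : Prop :=
  IsVectorGrading V ∧ ∀ g h, ∀ v ∈ V g, ∀ d ∈ A h, MulOpposite.op d • v ∈ V (g * h)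

/-- The space of `D`-linear maps `U → U` that are homogeneous of degree `h`. -/
def endComponent (D : Type*) [Semiring D] [Algebra F D]
    {U : Type*} [AddCommMonoid U] [Module F U] [Module Dᵐᵒᵖ U] [IsScalarTower F Dᵐᵒᵖ U]
    (V : H → Submodule F U) (h : H) : Submodule F (Module.End Dᵐᵒᵖ U) where
  carrier := {f | ∀ g, ∀ v ∈ V g, f v ∈ V (h * g)}
  add_mem' := fun hf hf' g v hv => (V (h * g)).add_mem (hf g v hv) (hf' g v hv)
  zero_mem' := fun g _ _ => (V (h * g)).zero_mem
  smul_mem' := fun c _ hf g v hv => (V (h * g)).smul_mem c (hf g v hv)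

/-- The grading of the right `D`-module `D^[g₁] ⊕ ⋯ ⊕ D^[g_k]`, where `D^[g]` is `D` with the
component of degree `h` relabeled by `h * g`. -/
def shiftComponent {D : Type*} [Semiring D] [Algebra F D] (A : H → Submodule F D)
    {k : ℕ} (γ : Fin k → H) (h : H) : Submodule F (Fin k → D) :=
  Submodule.pi Set.univ (fun i => A (h * (γ i)⁻¹))

end Gradings

/-! ### Graded superalgebras and the superalgebra `M(n,n)` -/

section Super

variable {F : Type u} [Field F] {G : Type v} [CommGroup G]

/-- Isomorphism of `G`-graded superalgebras; `P`, `P'` are the canonical `ℤ₂`-gradings and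
`Γ`, `Γ'` the `G`-gradings. -/
def SuperIso {A B : Type*} [Semiring A] [Algebra F A] [Semiring B] [Algebra F B]
    (P : Z2 → Submodule F A) (Γ : G → Submodule F A)
    (P' : Z2 → Submodule F B) (Γ' : G → Submodule F B) : Prop :=
  ∃ φ : A ≃ₐ[F] B, (∀ i, (P i).map φ.toLinearMap = P' i) ∧
    ∀ g, (Γ g).map φ.toLinearMap = Γ' g

/-- The algebra underlying `M(n,n)`. -/
abbrev Mnn (F : Type u) (n : ℕ) : Type u := Matrix (Fin n ⊕ Fin n) (Fin n ⊕ Fin n) F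

/-- Parity of the basis vectors of `Fⁿ ⊕ Fⁿ`. -/
def basisParity {n : ℕ} : Fin n ⊕ Fin n → Z2 := Sum.elim (fun _ => 1) (fun _ => odd)

/-- The canonical `ℤ₂`-grading of `M(n,n)`: the even part consists of the block diagonal matrices
and the odd part of the block antidiagonal ones. -/
def mnnParity (F : Type u) [Field F] (n : ℕ) (i : Z2) : Submodule F (Mnn F n) where
  carrier := {X | ∀ r c, basisParity r ≠ i * basisParity c → X r c = 0}
  add_mem' := fun hX hY r c h => by simp [hX r c h, hY r c h]
  zero_mem' := fun _ _ _ => rfl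
  smul_mem' := fun a X hX r c h => by simp [hX r c h]

/-- `Γ` is a `G`-grading on the superalgebra `M(n,n)`. -/
def IsSuperGrading {n : ℕ} (Γ : G → Submodule F (Mnn F n)) : Prop :=
  IsAlgebraGrading Γ ∧ ∀ g, Γ g = ⨆ i, Γ g ⊓ mnnParity F n i

/-- The `G × ℤ₂`-grading on `M(n,n)` corresponding to a `G`-grading on the superalgebra. -/
def sharpGrading {n : ℕ} (Γ : G → Submodule F (Mnn F n)) (x : Sharp G) :
    Submodule F (Mnn F n) :=
  Γ x.1 ⊓ mnnParity F n x.2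

/-- A `G`-grading on the superalgebra `M(n,n)` is odd if, as a `G × ℤ₂`-graded algebra,
`M(n,n)` is isomorphic to `End_D(U)`, where `D` is a `G × ℤ₂`-graded division algebra with
nonzero odd part and `U` is a graded right `D`-module (everything finite-dimensional). -/
def IsOddGrading {n : ℕ} (Γ : G → Submodule F (Mnn F n)) : Prop :=
  IsSuperGrading Γ ∧
  ∃ (D : Type u) (_ : Ring D) (_ : Algebra F D) (_ : FiniteDimensional F D)
    (A : Sharp G → Submodule F D)
    (U : Type u) (_ : AddCommGroup U) (_ : Module F U) (_ : FiniteDimensional F U)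
    (_ : Module Dᵐᵒᵖ U) (_ : IsScalarTower F Dᵐᵒᵖ U) (V : Sharp G → Submodule F U),
    IsGradedDivision A ∧ (∃ g : G, A (g, odd) ≠ ⊥) ∧ IsGradedRightModule A V ∧
    ∃ φ : Mnn F n ≃ₐ[F] Module.End Dᵐᵒᵖ U,
      ∀ x, (sharpGrading Γ x).map φ.toLinearMap = endComponent D V x

end Super

/-! ### Standard realizations of graded division algebras -/

section Standard

variable {F : Type*} [Field F] {H : Type*} [CommGroup H] {T : Subgroup H}

/-- `T = A × B`, where `β` is trivial on `A` and on `B`. -/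
def IsStandardDecomposition (β : T →* T →* Fˣ) (A B : Subgroup T) : Prop :=
  IsCompl A B ∧ (∀ a ∈ A, ∀ a' ∈ A, β a a' = 1) ∧ (∀ b ∈ B, ∀ b' ∈ B, β b b' = 1)

/-- The underlying algebra `End(FB)` of a standard realization. -/
abbrev StdAlgebra (F : Type*) [Field F] (B : Subgroup T) : Type _ := Module.End F (B →₀ F)

/-- The operator `X_{ab}`, which sends `e_{b'}` to `β(a, bb') e_{bb'}`. -/
def stdX (β : T →* T →* Fˣ) {A B : Subgroup T} (a : A) (b : B) : StdAlgebra F B :=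
  Finsupp.linearCombination F
    (fun b' : B => Finsupp.single (b * b') (β a (b * b' : B) : F))

/-- The grading of the standard realization: the component of degree `ab` is spanned by `X_{ab}`,
and the components of degree outside `T` are zero. -/
def stdComponent (β : T →* T →* Fˣ) (A B : Subgroup T) (h : H) : Submodule F (StdAlgebra F B) :=
  Submodule.span F {x | ∃ (a : A) (b : B), ((a * b : T) : H) = h ∧ x = stdX β a b}

end Standard

/-! ### The parameters of an odd grading -/

section Parameters

variable {F : Type u} [Field F] {G : Type v} [CommGroup G]

/-- The inverse image `T⁺` in `G` of a subgroup of `G/⟨t₀⟩`. -/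
abbrev tPlus (t₀ : G) (Tbar : Subgroup (G ⧸ zpowers t₀)) : Subgroup G :=
  Tbar.comap (QuotientGroup.mk' (zpowers t₀))

/-- The triples `(t₀, T̄, β̄)`. -/
structure EvenData (F : Type u) [Field F] (G : Type v) [CommGroup G] where
  /-- an element of order two -/
  t₀ : G
  order_t₀ : orderOf t₀ = 2
  /-- a finite subgroup of `G/⟨t₀⟩` -/
  Tbar : Subgroup (G ⧸ zpowers t₀)
  finite_Tbar : Finite Tbar
  /-- a nondegenerate alternating bicharacter -/
  βbar : Tbar →* Tbar →* Fˣ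
  alternating : ∀ t, βbar t t = 1
  nondegenerate : ∀ s, (∀ t, βbar s t = 1) → s = 1

namespace EvenData

variable (c : EvenData F G)

/-- The inverse image of `T̄` in `G`. -/
abbrev Tplus : Subgroup G := tPlus c.t₀ c.Tbar

/-- The natural map `T⁺ → T̄`. -/
def proj : c.Tplus →* c.Tbar := (QuotientGroup.mk' (zpowers c.t₀)).subgroupComap c.Tbar

/-- The bicharacter on `T⁺` induced by `β̄`. -/
def βplus (s t : c.Tplus) : Fˣ := c.βbar (c.proj s) (c.proj t)

/-- The conditions `χ(a) = 1` and `χ²(t̄) = β̄(ā, t̄)` that determine the element `a` of `T⁺`. -/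
def IsDistinguished (χ : c.Tplus →* Fˣ) (a : c.Tplus) : Prop :=
  χ a = 1 ∧ ∀ t : c.Tplus, χ t ^ 2 = c.βbar (c.proj a) (c.proj t)

end EvenData

/-- A choice, for every `t₀` and `T̄`, of a character of `T⁺`. -/
abbrev CharFamily (F : Type u) [Field F] (G : Type v) [CommGroup G] : Type _ :=
  ∀ (t₀ : G) (Tbar : Subgroup (G ⧸ zpowers t₀)), tPlus t₀ Tbar →* Fˣ

/-- The parameters `(t₀, T̄, β̄, u, γ)` of an odd grading on `M(n,n)`, relative to a choice of
characters: `u` is a square root of the element `a`, and `γ` is a `k`-tuple, where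
`n = k √|T̄|`. -/
structure OddParams (χ : CharFamily F G) (n : ℕ) where
  /-- the triple `(t₀, T̄, β̄)` -/
  c : EvenData F G
  /-- a square root of `a` -/
  u : G
  root : ∃ a : c.Tplus, c.IsDistinguished (χ c.t₀ c.Tbar) a ∧ u ^ 2 = a
  /-- the length of `γ` -/
  k : ℕ
  /-- a tuple of elements of `G` -/
  γ : Fin k → G
  size : k ^ 2 * Nat.card c.Tbar = n ^ 2

/-- The multiset `Ξ(γ)` of the cosets `g₁N, …, g_kN`. -/
def Xi (N : Subgroup G) {k : ℕ} (γ : Fin k → G) : Multiset (G ⧸ N) :=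
  Finset.univ.val.map (fun i => (γ i : G ⧸ N))

namespace OddParams

variable {χ : CharFamily F G} {n : ℕ} (p : OddParams χ n)

/-- The fixed character of `T⁺`. -/
abbrev char : p.c.Tplus →* Fˣ := χ p.c.t₀ p.c.Tbar

/-- The exponent `0` or `1` of `t₁` in an element of `T = T⁺ ∪ t₁T⁺`. -/
def expo (x : Sharp G) : ℕ := (Multiplicative.toAdd x.2).val

lemma sq_mem : p.u ^ 2 ∈ p.c.Tplus := by
  obtain ⟨a, -, h⟩ := p.root
  rw [h]; exact a.2

/-- The subgroup `T_u = T⁺ ∪ t₁T⁺` of `G × ℤ₂`, where `t₁ = (u, 1̄)`. -/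
def Tu : Subgroup (Sharp G) where
  carrier := {x | ∃ s ∈ p.c.Tplus, x = (s, 1) ∨ x = (p.u, odd) * (s, 1)}
  one_mem' := ⟨1, one_mem _, Or.inl rfl⟩
  mul_mem' := by
    have hodd : odd * odd = 1 := by decide
    rintro _ _ ⟨s, hs, rfl | rfl⟩ ⟨t, ht, rfl | rfl⟩
    · exact ⟨s * t, mul_mem hs ht, Or.inl (by simp)⟩
    · exact ⟨s * t, mul_mem hs ht, Or.inr (by simp [mul_left_comm])⟩
    · exact ⟨s * t, mul_mem hs ht, Or.inr (by simp [mul_assoc])⟩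
    · refine ⟨p.u ^ 2 * (s * t), mul_mem p.sq_mem (mul_mem hs ht), Or.inl ?_⟩
      ext1
      · simp only [Prod.fst_mul, pow_two]; exact mul_mul_mul_comm _ _ _ _
      · simpa using hodd
  inv_mem' := by
    have hodd : (odd)⁻¹ = odd := by decide
    rintro _ ⟨s, hs, rfl | rfl⟩
    · exact ⟨s⁻¹, inv_mem hs, Or.inl (by simp)⟩
    · refine ⟨(p.u ^ 2)⁻¹ * s⁻¹, mul_mem (inv_mem p.sq_mem) (inv_mem hs), Or.inr ?_⟩
      ext1
      · simp only [Prod.fst_mul, Prod.fst_inv, mul_inv, pow_two]; group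
      · simpa using hodd

lemma plusPart_mem (x : p.Tu) : x.1.1 * (p.u ^ expo x.1)⁻¹ ∈ p.c.Tplus := by
  obtain ⟨_, s, hs, rfl | rfl⟩ := x
  · simpa [expo] using hs
  · have : (1 : ZMod 2).val = 1 := by decide
    simpa [expo, this] using hs

/-- The factor `s ∈ T⁺` of the element `s t₁^i` of `T_u`, `i = 0, 1`. -/
def plusPart (x : p.Tu) : p.c.Tplus := ⟨x.1.1 * (p.u ^ expo x.1)⁻¹, p.plusPart_mem x⟩

/-- The formula `β_u(s t₁^i, t t₁^j) = β⁺(s,t) χ(s)^{-j} χ(t)^i`. -/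
def βuFun (x y : p.Tu) : Fˣ :=
  p.c.βplus (p.plusPart x) (p.plusPart y) *
    ((p.char (p.plusPart x) ^ expo y.1)⁻¹ * p.char (p.plusPart y) ^ expo x.1)

lemma βuFun_swap (x y : p.Tu) : p.βuFun x y = (p.βuFun y x)⁻¹ := by
  have h := p.c.alternating (p.c.proj (p.plusPart x) * p.c.proj (p.plusPart y))
  simp only [map_mul, MonoidHom.mul_apply, p.c.alternating, one_mul, mul_one] at h
  simp only [βuFun, EvenData.βplus, mul_inv, inv_inv]
  rw [eq_inv_of_mul_eq_one_right h, mul_comm (_ ^ expo y.1)⁻¹]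

lemma expo_cases (x y : Sharp G) :
    expo (x * y) = expo x + expo y ∨ expo (x * y) + 2 = expo x + expo y := by
  have : ∀ i j : ZMod 2, (i + j).val = i.val + j.val ∨ (i + j).val + 2 = i.val + j.val := by
    decide
  exact this _ _

lemma regroup₁ {M : Type*} [CommMonoid M] (a b c d e f : M) :
    a * b * (c * d * (e * f)) = a * (c * e) * (b * (d * f)) := by
  rw [mul_mul_mul_comm c d e f, mul_mul_mul_comm a b]

lemma regroup₂ {M : Type*} [CommMonoid M] (a b c d e f g h : M) (H : e * f = g * h) :
    a * b * g * (c * d * h) = a * (c * e) * (b * (d * f)) := by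
  rw [← regroup₁, H, mul_assoc (a * b), mul_left_comm g]

lemma βuFun_mul_left (x x' y : p.Tu) : p.βuFun (x * x') y = p.βuFun x y * p.βuFun x' y := by
  obtain ⟨a, ⟨ha1, ha2⟩, hu⟩ := p.root
  rcases expo_cases x.1 x'.1 with h | h
  · have hp : p.plusPart (x * x') = p.plusPart x * p.plusPart x' := by
      apply Subtype.ext
      simp only [plusPart, Subgroup.coe_mul, Prod.fst_mul, h, pow_add, mul_inv]
      exact mul_mul_mul_comm _ _ _ _
    simp only [βuFun, EvenData.βplus, hp, Subgroup.coe_mul, h, map_mul, MonoidHom.mul_apply,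
      mul_pow, pow_add, mul_inv]
    exact regroup₁ _ _ _ _ _ _
  · have hp : p.plusPart (x * x') = p.plusPart x * p.plusPart x' * a := by
      apply Subtype.ext
      have h2 : p.u ^ expo x.1 * p.u ^ expo x'.1 = p.u ^ expo (x.1 * x'.1) * a := by
        rw [← pow_add, ← h, pow_add, hu]
      simp only [plusPart, Subgroup.coe_mul, Prod.fst_mul]
      rw [mul_mul_mul_comm, ← mul_inv, h2]
      simp [mul_assoc]
    have h3 : p.char (p.plusPart y) ^ expo x.1 * p.char (p.plusPart y) ^ expo x'.1 =
        p.c.βbar (p.c.proj a) (p.c.proj (p.plusPart y)) *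
          p.char (p.plusPart y) ^ expo (x.1 * x'.1) := by
      rw [← ha2, ← pow_add, ← pow_add, ← h, add_comm]
    simp only [βuFun, EvenData.βplus, hp, Subgroup.coe_mul, map_mul, MonoidHom.mul_apply, ha1,
      mul_one, mul_pow, mul_inv]
    exact regroup₂ _ _ _ _ _ _ _ _ h3

/-- The bicharacter `β_u` on `T_u`: the unique alternating bicharacter that extends `β⁺` and
satisfies `β_u(t₁, t) = χ(t)` for `t ∈ T⁺`. -/
def βu : p.Tu →* p.Tu →* Fˣ :=
  MonoidHom.mk'
    (fun x => MonoidHom.mk' (fun y => p.βuFun x y) (fun y y' => by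
      rw [p.βuFun_swap, p.βuFun_mul_left, mul_inv, ← p.βuFun_swap, ← p.βuFun_swap]))
    (fun x x' => MonoidHom.ext fun y => p.βuFun_mul_left x x' y)

lemma βu_self (x : p.Tu) : p.βu x x = 1 := by
  change p.βuFun x x = 1
  simp [βuFun, EvenData.βplus, p.c.alternating]

lemma βu_plus (s t : p.c.Tplus) :
    p.βu ⟨(s, 1), s, s.2, Or.inl rfl⟩ ⟨(t, 1), t, t.2, Or.inl rfl⟩ = p.c.βplus s t := by
  change p.βuFun _ _ = _
  simp [βuFun, plusPart, expo]

lemma βu_t₁ (t : p.c.Tplus) :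
    p.βu ⟨(p.u, odd), 1, one_mem _, Or.inr (by ext1 <;> simp)⟩
      ⟨(t, 1), t, t.2, Or.inl rfl⟩ = p.char t := by
  change p.βuFun _ _ = _
  have h1 : (1 : ZMod 2).val = 1 := by decide
  have : (⟨1, one_mem _⟩ : p.c.Tplus) = 1 := rfl
  simp [βuFun, EvenData.βplus, plusPart, expo, h1, this]

/-- The `G × ℤ₂`-grading on `End_D(U)`, where `D` is the standard realization of the graded
division algebra with parameters `(T_u, β_u)` associated to a decomposition `T_u = A × B`, and
`U = D^[g₁] ⊕ ⋯ ⊕ D^[g_k]`. -/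
def modelComponent (A B : Subgroup p.Tu) :
    Sharp G → Submodule F (Module.End (StdAlgebra F B)ᵐᵒᵖ (Fin p.k → StdAlgebra F B)) :=
  endComponent (StdAlgebra F B)
    (shiftComponent (stdComponent p.βu A B) (fun i => (p.γ i, (1 : Z2))))

/-- `Γ` is (a copy on `M(n,n)` of) the grading `Γ(t₀, T̄, β̄, u, γ)`: with its `G`-grading `Γ`,
the superalgebra `M(n,n)` is isomorphic to `End_D(U)`, where `D` is a standard realization of the
graded division algebra with parameters `(T_u, β_u)` and `U = D^[g₁] ⊕ ⋯ ⊕ D^[g_k]`. -/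
def Describes (Γ : G → Submodule F (Mnn F n)) : Prop :=
  ∃ A B : Subgroup p.Tu, IsStandardDecomposition p.βu A B ∧
    SuperIso (mnnParity F n) Γ
      (coarsening (MonoidHom.snd G Z2) (p.modelComponent A B))
      (coarsening (MonoidHom.fst G Z2) (p.modelComponent A B))

end OddParams

end Parameters

end OddGradings

end

noncomputable section

set_option linter.unusedSectionVars false

namespace OddGradings

open MulOpposite

universe u v

/-! ### Vector gradings -/

section VectorGradings

variable {F : Type*} [Field F] {H : Type*} [CommGroup H]
variable {M : Type*} [AddCommGroup M] [Module F M]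
variable {M' : Type*} [AddCommGroup M'] [Module F M']

/-! The superalgebra structure and the `G`-grading together are one grading by `G × ℤ₂`, so
everything is a statement about graded algebras `End_D(U)`, with `D` a graded division algebra.

Over an algebraically closed field the identity component of a finite-dimensional `D` is `F`. Hence
all nonzero components are lines, and `D` has a support `T` and an alternating commutation factor
`β` (`IsGradedDivision.exists_isTwisted`). Splitting `T` into two isotropic subgroups and choosing
homogeneous elements multiplicatively on each of them produces a basis whose multiplication table
involves only `β`; so `(T, β)` determines `D` (`IsTwisted.gradedIso`), and the standard realization
has these invariants (`isTwisted_std`). Centrality of the matrix algebra makes `β` nondegenerate.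

The heart of the matter is to translate `(T, β)` into `(t₀, T̄, β̄, u)` (`exists_params`). Parity is
a character of `T`, so it equals `β(z, ·)` for a unique `z`. This `z` is even because `β(z, z) = 1`;
it is `t₀`, and it spans the radical of `β` on the even part `T⁺`, so `β` descends to a
nondegenerate `β̄` on `T̄`. Every character of `T⁺` is the restriction of some `β(x, ·)`, with `x`
unique modulo `z`. For the prescribed `χ` this `x` is odd, as `χ(t₀) = -1`; it is `t₁ = (u, 1̄)`,
and its square is `a`. Read backwards, this recovers the parameters, with `u` modulo `⟨t₀⟩`
(`params_eq`, `factor_eq_of_params`).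

Graded modules over `D` are free with a homogeneous basis. Its degrees matter only modulo `T`, and
since `T` has odd elements they can all be taken even. Conversely, an isomorphism of graded
endomorphism algebras is induced by a semilinear isomorphism of modules up to a shift, so it
preserves `T`, `β` and, up to translation, the multiset of cosets (`invariants_of_gradedIso`,
`gradedIso_shift`).

Each model is `M(n,n)` because an element of degree `t₀`, scaled to an involution, implements the
parity by conjugation. It anticommutes with an invertible odd element, so its two eigenspaces have
equal dimension (`exists_algEquiv_of_isTwisted`). -/

/-- A vector grading has a family of projections onto its components. -/
theorem IsVectorGrading.exists_proj {V : H → Submodule F M} (hV : IsVectorGrading V) :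
    ∃ π : H → M →ₗ[F] M, (∀ h x, π h x ∈ V h) ∧ (∀ h, ∀ x ∈ V h, π h x = x) ∧
      (∀ h h', ∀ x ∈ V h', h' ≠ h → π h x = 0) ∧ (∀ x, (∀ h, π h x = 0) → x = 0) := by
  classical
  have hI := DirectSum.isInternal_submodule_of_iSupIndep_of_iSup_eq_top hV.1 hV.2
  let e := LinearEquiv.ofBijective (DirectSum.coeLinearMap V) hI
  have he : ∀ h (x : V h), e (DirectSum.lof F H (fun h => V h) h x) = x := by
    intro h x
    exact DirectSum.coeLinearMap_lof V h x
  have hes : ∀ h (x : V h), e.symm x = DirectSum.lof F H (fun h => V h) h x := by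
    intro h x
    rw [← he, LinearEquiv.symm_apply_apply]
  refine ⟨fun h => (V h).subtype ∘ₗ DirectSum.component F H (fun h => V h) h ∘ₗ e.symm.toLinearMap,
    fun h x => Submodule.coe_mem _, ?_, ?_, ?_⟩
  · intro h x hx
    have := hes h ⟨x, hx⟩
    simp only [LinearMap.comp_apply, LinearEquiv.coe_coe]
    rw [this, DirectSum.component.lof_self]; rfl
  · intro h h' x hx hne
    have := hes h' ⟨x, hx⟩
    simp only [LinearMap.comp_apply, LinearEquiv.coe_coe]
    rw [this, DirectSum.component.of, dif_neg hne]; rfl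
  · intro x hx
    have : e.symm x = 0 := by
      apply DirectSum.ext_component F
      intro h
      apply Subtype.ext
      simpa using hx h
    simpa using this

/-- A family with a family of projections onto its members, whose sum is everything,
is a vector grading. -/
theorem iSupIndep_of_proj {ι : Type*} {V : ι → Submodule F M} (π : ι → M →ₗ[F] M)
    (h1 : ∀ h, ∀ x ∈ V h, π h x = x) (h2 : ∀ h h', ∀ x ∈ V h', h' ≠ h → π h x = 0) :
    iSupIndep V := by
  rw [iSupIndep_def]
  intro i
  rw [Submodule.disjoint_def]
  intro x hx hx'
  rw [← h1 i x hx]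
  have : (⨆ j, ⨆ (_ : j ≠ i), V j) ≤ LinearMap.ker (π i) := by
    refine iSup_le fun j => iSup_le fun hj => fun y hy => ?_
    exact h2 i j y hy hj
  exact this hx'

theorem IsVectorGrading.eq_zero_of_mem {V : H → Submodule F M} (hV : IsVectorGrading V)
    {g h : H} (hne : g ≠ h) {x : M} (hg : x ∈ V g) (hh : x ∈ V h) : x = 0 := by
  obtain ⟨π, -, h1, h2, -⟩ := hV.exists_proj
  rw [← h1 h x hh, h2 h g x hg hne]

theorem IsVectorGrading.eq_of_mem {V : H → Submodule F M} (hV : IsVectorGrading V)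
    {g h : H} {x : M} (hx : x ≠ 0) (hg : x ∈ V g) (hh : x ∈ V h) : g = h :=
  of_not_not fun hne => hx (hV.eq_zero_of_mem hne hg hh)

theorem IsVectorGrading.induction {V : H → Submodule F M} (hV : IsVectorGrading V)
    {p : M → Prop} (hom : ∀ h, ∀ x ∈ V h, p x) (zero : p 0)
    (add : ∀ x y, p x → p y → p (x + y)) (x : M) : p x :=
  Submodule.iSup_induction V (motive := p) (hV.2 ▸ Submodule.mem_top : x ∈ ⨆ h, V h) hom zero add

theorem IsVectorGrading.exists_ne_zero {V : H → Submodule F M} (hV : IsVectorGrading V)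
    {N : Type*} [AddCommGroup N] [Module F N] {f : M →ₗ[F] N} (hf : f ≠ 0) :
    ∃ h, ∃ x ∈ V h, f x ≠ 0 := by
  by_contra! hc
  apply hf
  ext x
  exact hV.induction (p := fun x => f x = 0) hc (map_zero f)
    (fun x y hx hy => by rw [map_add, hx, hy, add_zero]) x

theorem IsVectorGrading.map {V : H → Submodule F M} (hV : IsVectorGrading V) (e : M ≃ₗ[F] M') :
    IsVectorGrading (fun h => (V h).map e.toLinearMap) := by
  refine ⟨?_, ?_⟩
  · exact hV.1.map_orderIso (Submodule.orderIsoMapComap e)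
  · rw [← Submodule.map_iSup, hV.2, Submodule.map_top]
    exact LinearEquiv.range e

theorem IsAlgebraGrading.map {R R' : Type*} [Ring R] [Algebra F R] [Ring R'] [Algebra F R']
    {Γ : H → Submodule F R} (hΓ : IsAlgebraGrading Γ) (φ : R ≃ₐ[F] R') :
    IsAlgebraGrading (fun h => (Γ h).map φ.toLinearMap) := by
  refine ⟨hΓ.1.map φ.toLinearEquiv, ?_⟩
  rintro g h _ ⟨x, hx, rfl⟩ _ ⟨y, hy, rfl⟩
  exact ⟨x * y, hΓ.2 g h x hx y hy, by simp⟩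

/-- Two gradings of which one refines the other componentwise coincide. -/
theorem IsVectorGrading.eq_of_le {P Q : H → Submodule F M} (hP : IsVectorGrading P)
    (hQ : (⨆ h, Q h) = ⊤) (hle : ∀ h, Q h ≤ P h) : Q = P := by
  funext h
  refine le_antisymm (hle h) fun x hx => ?_
  obtain ⟨π, h0, h1, h2, -⟩ := hP.exists_proj
  -- The projections belong to `P`, but on a sum of elements of the `Q h` they merely pick out
  -- summands.
  have : ∀ y ∈ (⨆ h, Q h), π h y ∈ Q h := by
    intro y hy
    refine Submodule.iSup_induction Q (motive := fun y => π h y ∈ Q h) hy ?_ (by simp) ?_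
    · intro i z hz
      by_cases hi : i = h
      · subst hi; rw [h1 _ z (hle _ hz)]; exact hz
      · rw [h2 h i z (hle _ hz) hi]; exact zero_mem _
    · intro y z hy hz
      rw [map_add]
      exact add_mem hy hz
  rw [← h1 h x hx]
  exact this x (hQ ▸ Submodule.mem_top)

end VectorGradings

/-! ### Coarsenings -/

section Coarsenings

variable {F : Type*} [Field F] {H K : Type*} [CommGroup H] [CommGroup K]
variable {M : Type*} [AddCommGroup M] [Module F M]
variable {M' : Type*} [AddCommGroup M'] [Module F M']

theorem le_coarsening (α : H →* K) (V : H → Submodule F M) (h : H) :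
    V h ≤ coarsening α V (α h) :=
  le_iSup₂_of_le (f := fun (h' : H) (_ : α h' = α h) => V h') h rfl le_rfl

theorem IsVectorGrading.coarsening {V : H → Submodule F M} (hV : IsVectorGrading V)
    (α : H →* K) : IsVectorGrading (coarsening α V) := by
  classical
  refine ⟨?_, ?_⟩
  · rw [iSupIndep_def]
    intro k
    have h1 : (⨆ j, ⨆ (_ : j ≠ k), OddGradings.coarsening α V j)
        ≤ ⨆ h ∈ {h | α h ≠ k}, V h := by
      refine iSup_le fun j => iSup_le fun hj => iSup_le fun h => iSup_le fun hh => ?_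
      exact le_iSup₂_of_le (f := fun (h' : H) (_ : h' ∈ {h | α h ≠ k}) => V h') h
        (by simpa [hh] using hj) le_rfl
    refine Disjoint.mono_right h1 ?_
    exact hV.1.disjoint_biSup_biSup (s := {h | α h = k}) (t := {h | α h ≠ k})
      (Set.disjoint_left.2 fun h h1 h2 => h2 h1)
  · rw [eq_top_iff, ← hV.2]
    exact iSup_le fun h => le_iSup_of_le (α h) (le_coarsening α V h)

theorem IsAlgebraGrading.coarsening {R : Type*} [Ring R] [Algebra F R]
    {Γ : H → Submodule F R} (hΓ : IsAlgebraGrading Γ) (α : H →* K) :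
    IsAlgebraGrading (coarsening α Γ) := by
  refine ⟨hΓ.1.coarsening α, fun g h x hx y hy => ?_⟩
  have key : ∀ a, α a = g → ∀ x ∈ Γ a, ∀ y ∈ OddGradings.coarsening α Γ h,
      x * y ∈ OddGradings.coarsening α Γ (g * h) := by
    intro a ha x hx y hy
    have : OddGradings.coarsening α Γ h ≤
        (OddGradings.coarsening α Γ (g * h)).comap (LinearMap.mulLeft F x) := by
      refine iSup_le fun b => iSup_le fun hb => fun z hz => ?_
      have := le_coarsening α Γ (a * b) (hΓ.2 a b x hx z hz)
      rwa [map_mul, ha, hb] at this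
    exact this hy
  have : OddGradings.coarsening α Γ g ≤
      (OddGradings.coarsening α Γ (g * h)).comap (LinearMap.mulRight F y) :=
    iSup_le fun a => iSup_le fun ha => fun z hz => key a ha z hz y hy
  exact this hx

theorem coarsening_map (α : H →* K) (V : H → Submodule F M) (f : M →ₗ[F] M') (k : K) :
    (coarsening α V k).map f = coarsening α (fun h => (V h).map f) k := by
  simp only [coarsening, Submodule.map_iSup]

/-- An element of both coarsenings has zero projection to every degree except `(h, k)`. Thus a
grading by a product is the same data as its two coarsenings. -/
theorem IsVectorGrading.coarsening_fst_inf_snd {V : H × K → Submodule F M}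
    (hV : IsVectorGrading V) (h : H) (k : K) :
    OddGradings.coarsening (MonoidHom.fst H K) V h ⊓ OddGradings.coarsening (MonoidHom.snd H K) V k
      = V (h, k) := by
  refine le_antisymm ?_ (le_inf (le_coarsening (MonoidHom.fst H K) V (h, k))
    (le_coarsening (MonoidHom.snd H K) V (h, k)))
  rintro x ⟨h1, h2⟩
  obtain ⟨π, p0, p1, p2, p3⟩ := hV.exists_proj
  have z1 : ∀ y : H × K, y.1 ≠ h → π y x = 0 := by
    intro y hy
    have : OddGradings.coarsening (MonoidHom.fst H K) V h ≤ LinearMap.ker (π y) :=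
      iSup_le fun z => iSup_le fun hz => fun v hv =>
        p2 y z v hv (by rintro rfl; exact hy hz)
    exact this h1
  have z2 : ∀ y : H × K, y.2 ≠ k → π y x = 0 := by
    intro y hy
    have : OddGradings.coarsening (MonoidHom.snd H K) V k ≤ LinearMap.ker (π y) :=
      iSup_le fun z => iSup_le fun hz => fun v hv =>
        p2 y z v hv (by rintro rfl; exact hy hz)
    exact this h2
  have : x - π (h, k) x = 0 := by
    apply p3
    intro y
    by_cases hy : y = (h, k)
    · subst hy
      rw [map_sub, p1 _ _ (p0 _ _), sub_self]
    · rw [map_sub, p2 y (h, k) _ (p0 _ _) (Ne.symm hy), sub_zero]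
      by_cases hy1 : y.1 = h
      · exact z2 y fun hy2 => hy (Prod.ext hy1 hy2)
      · exact z1 y hy1
  rw [sub_eq_zero.1 this]
  exact p0 _ _

theorem coarsening_fst_apply (V : H × K → Submodule F M) (h : H) :
    coarsening (MonoidHom.fst H K) V h = ⨆ k, V (h, k) := by
  refine le_antisymm ?_ (iSup_le fun k => le_coarsening (MonoidHom.fst H K) V (h, k))
  refine iSup_le fun z => iSup_le fun hz => ?_
  obtain ⟨a, b⟩ := z
  obtain rfl : a = h := hz
  exact le_iSup (fun k => V (a, k)) b

theorem coarsening_snd_apply (V : H × K → Submodule F M) (k : K) :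
    coarsening (MonoidHom.snd H K) V k = ⨆ h, V (h, k) := by
  refine le_antisymm ?_ (iSup_le fun h => le_coarsening (MonoidHom.snd H K) V (h, k))
  refine iSup_le fun z => iSup_le fun hz => ?_
  obtain ⟨a, b⟩ := z
  obtain rfl : b = k := hz
  exact le_iSup (fun h => V (h, b)) a

end Coarsenings

/-! ### Isomorphisms of graded algebras -/

section Isomorphisms

variable {F : Type*} [Field F] {H : Type*} [CommGroup H]
variable {R R' R'' : Type*} [Ring R] [Algebra F R] [Ring R'] [Algebra F R'] [Ring R'']
  [Algebra F R'']

/-- Isomorphism of graded algebras. -/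
def GradedIso (Γ : H → Submodule F R) (Γ' : H → Submodule F R') : Prop :=
  ∃ φ : R ≃ₐ[F] R', ∀ h, (Γ h).map φ.toLinearMap = Γ' h

theorem map_symm_of_map {P : Submodule F R} {P' : Submodule F R'} (φ : R ≃ₐ[F] R')
    (h : P.map φ.toLinearMap = P') : P'.map φ.symm.toLinearMap = P := by
  subst h
  ext x
  simp

theorem map_trans_of_map {P : Submodule F R} {P' : Submodule F R'} {P'' : Submodule F R''}
    (φ : R ≃ₐ[F] R') (ψ : R' ≃ₐ[F] R'') (h : P.map φ.toLinearMap = P')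
    (h' : P'.map ψ.toLinearMap = P'') : P.map (φ.trans ψ).toLinearMap = P'' := by
  subst h h'
  ext x
  simp

theorem GradedIso.symm {Γ : H → Submodule F R} {Γ' : H → Submodule F R'}
    (h : GradedIso Γ Γ') : GradedIso Γ' Γ := by
  obtain ⟨φ, hφ⟩ := h
  exact ⟨φ.symm, fun g => map_symm_of_map φ (hφ g)⟩

theorem GradedIso.trans {Γ : H → Submodule F R} {Γ' : H → Submodule F R'}
    {Γ'' : H → Submodule F R''} (h : GradedIso Γ Γ') (h' : GradedIso Γ' Γ'') :
    GradedIso Γ Γ'' := by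
  obtain ⟨φ, hφ⟩ := h
  obtain ⟨ψ, hψ⟩ := h'
  exact ⟨φ.trans ψ, fun g => map_trans_of_map φ ψ (hφ g) (hψ g)⟩

variable {G : Type*} [CommGroup G]

theorem SuperIso.symm {P : Z2 → Submodule F R} {Γ : G → Submodule F R}
    {P' : Z2 → Submodule F R'} {Γ' : G → Submodule F R'} (h : SuperIso P Γ P' Γ') :
    SuperIso P' Γ' P Γ := by
  obtain ⟨φ, hφ, hφ'⟩ := h
  exact ⟨φ.symm, fun i => map_symm_of_map φ (hφ i), fun g => map_symm_of_map φ (hφ' g)⟩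

theorem SuperIso.trans {P : Z2 → Submodule F R} {Γ : G → Submodule F R}
    {P' : Z2 → Submodule F R'} {Γ' : G → Submodule F R'}
    {P'' : Z2 → Submodule F R''} {Γ'' : G → Submodule F R''} (h : SuperIso P Γ P' Γ')
    (h' : SuperIso P' Γ' P'' Γ'') : SuperIso P Γ P'' Γ'' := by
  obtain ⟨φ, hφ, hφ'⟩ := h
  obtain ⟨ψ, hψ, hψ'⟩ := h'
  exact ⟨φ.trans ψ, fun g => map_trans_of_map φ ψ (hφ g) (hψ g),
    fun g => map_trans_of_map φ ψ (hφ' g) (hψ' g)⟩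

theorem GradedIso.superIso {W : Sharp G → Submodule F R} {W' : Sharp G → Submodule F R'}
    (h : GradedIso W W') :
    SuperIso (coarsening (MonoidHom.snd G Z2) W) (coarsening (MonoidHom.fst G Z2) W)
      (coarsening (MonoidHom.snd G Z2) W') (coarsening (MonoidHom.fst G Z2) W') := by
  obtain ⟨φ, hφ⟩ := h
  refine ⟨φ, fun i => ?_, fun g => ?_⟩ <;>
  · rw [coarsening_map]
    congr 1
    funext h
    exact hφ h

/-- Components are intersections of the two coarsenings, and an injective map preserves
intersections. This replaces superalgebra isomorphisms by isomorphisms of `G × ℤ₂`-graded algebras.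
-/
theorem SuperIso.gradedIso {W : Sharp G → Submodule F R} {W' : Sharp G → Submodule F R'}
    (hW : IsVectorGrading W) (hW' : IsVectorGrading W')
    (h : SuperIso (coarsening (MonoidHom.snd G Z2) W) (coarsening (MonoidHom.fst G Z2) W)
      (coarsening (MonoidHom.snd G Z2) W') (coarsening (MonoidHom.fst G Z2) W')) :
    GradedIso W W' := by
  obtain ⟨φ, hφ, hφ'⟩ := h
  refine ⟨φ, fun x => ?_⟩
  obtain ⟨g, i⟩ := x
  rw [← hW.coarsening_fst_inf_snd, ← hW'.coarsening_fst_inf_snd, ← hφ, ← hφ']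
  exact Submodule.map_inf _ φ.injective

end Isomorphisms

/-! ### Graded division algebras with one-dimensional components -/

section Twisted

variable {F : Type*} [Field F] {H : Type*} [CommGroup H] {D : Type*} [Ring D] [Algebra F D]

/-- Comparing the parts of degree `h` in `x * 1 = x` for `x` of degree `h` shows that the degree `1`
part of the unit is already a right identity. -/
theorem IsAlgebraGrading.one_mem {A : H → Submodule F D} (hA : IsAlgebraGrading A) :
    (1 : D) ∈ A 1 := by
  obtain ⟨π, h0, h1, h2, -⟩ := hA.1.exists_proj
  have key : ∀ h, ∀ x ∈ A h, ∀ y, π h (x * y) = x * π 1 y := by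
    intro h x hx y
    refine hA.1.induction (p := fun y => π h (x * y) = x * π 1 y) ?_ (by simp) ?_ y
    · intro g y hy
      have hxy := hA.2 h g x hx y hy
      by_cases hg : g = 1
      · subst hg
        rw [h1 1 y hy, h1 h _ (by simpa using hxy)]
      · rw [h2 1 g y hy hg, mul_zero, h2 h (h * g) _ hxy (by simpa using hg)]
    · intro y z hy hz
      simp only [mul_add, map_add, hy, hz]
  have hone : ∀ x, x = x * π 1 1 := by
    refine hA.1.induction ?_ (by simp) ?_
    · intro h x hx
      rw [← key h x hx 1, mul_one, h1 h x hx]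
    · intro x y hx hy
      rw [add_mul, ← hx, ← hy]
  have := hone 1
  rw [one_mul] at this
  rw [this]
  exact h0 _ _

/-- The degree `1` part of `x * x⁻¹ = 1` only involves the part of `x⁻¹` of degree `h⁻¹`, which is
therefore the whole inverse. -/
theorem IsAlgebraGrading.exists_inv {A : H → Submodule F D} (hA : IsAlgebraGrading A)
    {h : H} {x : D} (hx : x ∈ A h) (hu : IsUnit x) :
    ∃ y ∈ A h⁻¹, x * y = 1 ∧ y * x = 1 := by
  obtain ⟨π, h0, h1, h2, -⟩ := hA.1.exists_proj
  have key : ∀ y, π 1 (x * y) = x * π h⁻¹ y := by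
    refine hA.1.induction ?_ (by simp) ?_
    · intro g y hy
      have hxy := hA.2 h g x hx y hy
      by_cases hg : g = h⁻¹
      · subst hg
        rw [h1 _ y hy, h1 1 _ (by simpa using hxy)]
      · rw [h2 _ g y hy hg, mul_zero, h2 1 (h * g) _ hxy
          (by rw [Ne, mul_eq_one_iff_inv_eq]; exact fun h => hg h.symm)]
    · intro y z hy hz
      simp only [mul_add, map_add, hy, hz]
  obtain ⟨u, rfl⟩ := hu
  have h3 := key (↑u⁻¹)
  rw [Units.mul_inv, h1 1 1 hA.one_mem] at h3
  have h4 : (↑u⁻¹ : D) = π h⁻¹ ↑u⁻¹ := by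
    calc (↑u⁻¹ : D) = ↑u⁻¹ * 1 := (mul_one _).symm
      _ = ↑u⁻¹ * (↑u * π h⁻¹ ↑u⁻¹) := by rw [← h3]
      _ = _ := by rw [← mul_assoc, Units.inv_mul, one_mul]
  exact ⟨↑u⁻¹, h4 ▸ h0 _ _, Units.mul_inv u, Units.inv_mul u⟩

/-- `A` is a division grading on `D` with one-dimensional components, support `T` and
commutation factor `β`. -/
structure IsTwisted {T : Subgroup H} (β : T →* T →* Fˣ) (A : H → Submodule F D) : Prop where
  grading : IsAlgebraGrading A
  nontrivial : Nontrivial D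
  isUnit : ∀ h, ∀ d ∈ A h, d ≠ 0 → IsUnit d
  ne_bot : ∀ h, A h ≠ ⊥ ↔ h ∈ T
  comm : ∀ s t : T, ∀ x ∈ A s, ∀ y ∈ A t, x * y = (β s t : F) • (y * x)
  one_dim : ∀ h, ∀ x ∈ A h, x ≠ 0 → ∀ y ∈ A h, ∃ c : F, y = c • x

namespace IsTwisted

variable {T : Subgroup H} {β : T →* T →* Fˣ} {A : H → Submodule F D}

theorem exists_ne_zero (hA : IsTwisted β A) (t : T) : ∃ x ∈ A t, x ≠ 0 :=
  Submodule.exists_mem_ne_zero_of_ne_bot ((hA.ne_bot t).2 t.2)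

theorem mem_support (hA : IsTwisted β A) {h : H} {x : D} (hx : x ∈ A h) (h0 : x ≠ 0) : h ∈ T :=
  (hA.ne_bot h).1 fun hb => h0 (by simpa [hb] using hx)

theorem mul_ne (hA : IsTwisted β A) {g h : H} {x y : D} (hx : x ∈ A g) (hx0 : x ≠ 0)
    (hy : y ∈ A h) (hy0 : y ≠ 0) : x * y ≠ 0 := by
  have := hA.nontrivial
  exact ((hA.isUnit g x hx hx0).mul (hA.isUnit h y hy hy0)).ne_zero

/-- Nonzero homogeneous elements, one for each element of the support, form a basis. -/
theorem exists_basis (hA : IsTwisted β A) (X : T → D) (hX : ∀ t : T, X t ∈ A t)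
    (hX0 : ∀ t, X t ≠ 0) : ∃ b : Module.Basis T F D, ∀ t, b t = X t := by
  have hli : LinearIndependent F X :=
    (hA.grading.1.1.comp Subtype.val_injective).linearIndependent (fun t : T => A t) hX hX0
  have hsp : ⊤ ≤ Submodule.span F (Set.range X) := by
    rw [← hA.grading.1.2]
    refine iSup_le fun h x hx => ?_
    by_cases hx0 : x = 0
    · rw [hx0]; exact zero_mem _
    · have hh := hA.mem_support hx hx0
      obtain ⟨c, rfl⟩ := hA.one_dim h (X ⟨h, hh⟩) (hX ⟨h, hh⟩) (hX0 _) x hx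
      exact Submodule.smul_mem _ _ (Submodule.subset_span ⟨_, rfl⟩)
  exact ⟨Module.Basis.mk hli hsp, fun t => Module.Basis.mk_apply hli hsp t⟩

theorem finite_support [FiniteDimensional F D] (hA : IsTwisted β A) : Finite T := by
  choose X hX hX0 using hA.exists_ne_zero
  obtain ⟨b, -⟩ := hA.exists_basis X hX hX0
  exact Module.Finite.finite_basis b

theorem finrank_eq (hA : IsTwisted β A) : Module.finrank F D = Nat.card T := by
  choose X hX hX0 using hA.exists_ne_zero
  obtain ⟨b, -⟩ := hA.exists_basis X hX hX0
  exact Module.finrank_eq_nat_card_basis b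

end IsTwisted

/-- A nontrivial finite-dimensional commutative algebra over an algebraically closed field
has a character. -/
theorem exists_algHom_of_finiteDimensional [IsAlgClosed F] (S : Type*) [CommRing S] [Algebra F S]
    [FiniteDimensional F S] [Nontrivial S] : Nonempty (S →ₐ[F] F) := by
  obtain ⟨m, hm⟩ := Ideal.exists_maximal S
  have := hm
  -- The residue field is a finite extension of `F`, hence `F` itself.
  have hb : Function.Bijective (algebraMap F (S ⧸ m)) :=
    IsAlgClosed.algebraMap_bijective_of_isIntegral
  exact ⟨((AlgEquiv.ofBijective (Algebra.ofId F (S ⧸ m)) hb).symm.toAlgHom).comp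
    (Ideal.Quotient.mkₐ F m)⟩

namespace IsTwisted

variable {T : Subgroup H} {β : T →* T →* Fˣ} {A : H → Submodule F D}

/-- Over an isotropic subgroup of the support, homogeneous elements can be chosen
multiplicatively. -/
theorem exists_multiplicative [IsAlgClosed F] [FiniteDimensional F D] (hA : IsTwisted β A)
    (P : Subgroup T) (hP : ∀ a ∈ P, ∀ a' ∈ P, β a a' = 1) :
    ∃ Y : T → D, (∀ t : T, Y t ∈ A t) ∧ (∀ t, Y t ≠ 0) ∧
      ∀ a ∈ P, ∀ a' ∈ P, Y a * Y a' = Y (a * a') := by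
  choose X hX hX0 using hA.exists_ne_zero
  -- Elements with degrees in `P` commute, so they generate a commutative finite-dimensional
  -- algebra, which has a character `l`. Dividing each `X a` by `l (X a)` makes every structure
  -- constant equal to `1`.
  let s : Set D := X '' P
  have hcomm : ∀ x ∈ s, ∀ y ∈ s, x * y = y * x := by
    rintro _ ⟨a, ha, rfl⟩ _ ⟨b, hb, rfl⟩
    rw [hA.comm a b _ (hX a) _ (hX b), hP a ha b hb, Units.val_one, one_smul]
  have hS := Algebra.isMulCommutative_adjoin F hcomm
  let : CommRing (Algebra.adjoin F s) :=
    { (inferInstance : Ring (Algebra.adjoin F s)) with mul_comm := hS.is_comm.comm }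
  have := hA.nontrivial
  have : FiniteDimensional F (Algebra.adjoin F s) :=
    inferInstanceAs (FiniteDimensional F (Subalgebra.toSubmodule (Algebra.adjoin F s)))
  have : Nontrivial (Algebra.adjoin F s) :=
    ⟨⟨0, 1, fun h => zero_ne_one (congrArg Subtype.val h)⟩⟩
  obtain ⟨l⟩ := exists_algHom_of_finiteDimensional (F := F) (Algebra.adjoin F s)
  have hXs : ∀ a ∈ P, X a ∈ Algebra.adjoin F s := fun a ha =>
    Algebra.subset_adjoin ⟨a, ha, rfl⟩
  have hmul : ∀ a b : T, ∃ c : F, X a * X b = c • X (a * b) := fun a b =>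
    hA.one_dim _ _ (hX (a * b)) (hX0 _) _ (hA.grading.2 _ _ _ (hX a) _ (hX b))
  -- The product `X a * X a⁻¹` is a nonzero scalar, so no character can vanish on `X a`.
  have hl0 : ∀ a (ha : a ∈ P), l ⟨X a, hXs a ha⟩ ≠ 0 := by
    intro a ha h0
    obtain ⟨c, hc⟩ := hA.one_dim _ _ (hX 1) (hX0 1) 1 hA.grading.one_mem
    obtain ⟨d, hd⟩ := hmul a a⁻¹
    have hd0 : d ≠ 0 := by
      rintro rfl
      exact hA.mul_ne (hX a) (hX0 a) (hX a⁻¹) (hX0 _) (by rw [hd, zero_smul])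
    rw [mul_inv_cancel] at hd
    have h1 : (⟨X a, hXs a ha⟩ * ⟨X a⁻¹, hXs _ (inv_mem ha)⟩ : Algebra.adjoin F s) =
        (d * c⁻¹) • 1 := by
      apply Subtype.ext
      have hc0 : c ≠ 0 := by rintro rfl; simp at hc
      change X a * X a⁻¹ = (d * c⁻¹) • (1 : D)
      rw [hd, hc, smul_smul, mul_assoc, inv_mul_cancel₀ hc0, mul_one]
    have h2 := congrArg l h1
    rw [map_mul, h0, zero_mul, map_smul, map_one, smul_eq_mul, mul_one] at h2
    have hc0 : c ≠ 0 := by rintro rfl; simp at hc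
    exact mul_ne_zero hd0 (inv_ne_zero hc0) h2.symm
  classical
  refine ⟨fun t => if ht : t ∈ P then (l ⟨X t, hXs t ht⟩)⁻¹ • X t else X t, ?_, ?_, ?_⟩
  · intro t
    by_cases ht : t ∈ P
    · simp only [dif_pos ht]; exact Submodule.smul_mem _ _ (hX t)
    · simp only [dif_neg ht]; exact hX t
  · intro t
    by_cases ht : t ∈ P
    · simp only [dif_pos ht]; exact smul_ne_zero (inv_ne_zero (hl0 t ht)) (hX0 t)
    · simp only [dif_neg ht]; exact hX0 t
  · intro a ha b hb
    simp only [dif_pos ha, dif_pos hb, dif_pos (mul_mem ha hb)]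
    obtain ⟨c, hc⟩ := hmul a b
    have h1 : (⟨X a, hXs a ha⟩ * ⟨X b, hXs b hb⟩ : Algebra.adjoin F s) =
        c • ⟨X (a * b), hXs _ (mul_mem ha hb)⟩ := Subtype.ext hc
    have h2 := congrArg l h1
    rw [map_mul, map_smul, smul_eq_mul] at h2
    rw [smul_mul_smul_comm, hc, smul_smul, ← mul_inv, h2, mul_inv, mul_right_comm,
      inv_mul_cancel₀, one_mul]
    rintro rfl
    rw [zero_mul] at h2
    exact mul_ne_zero (hl0 a ha) (hl0 b hb) h2

end IsTwisted

theorem exists_mul_of_isCompl {T : Type*} [CommGroup T] {P Q : Subgroup T} (h : IsCompl P Q)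
    (t : T) : ∃ p ∈ P, ∃ q ∈ Q, p * q = t := by
  have : t ∈ P ⊔ Q := by rw [h.sup_eq_top]; trivial
  exact Subgroup.mem_sup.1 this

theorem mul_inj_of_isCompl {T : Type*} [CommGroup T] {P Q : Subgroup T} (h : IsCompl P Q)
    {p p' q q' : T} (hp : p ∈ P) (hp' : p' ∈ P) (hq : q ∈ Q) (hq' : q' ∈ Q)
    (he : p * q = p' * q') : p = p' ∧ q = q' := by
  have h1 : p'⁻¹ * p = q' * q⁻¹ := by
    rw [inv_mul_eq_iff_eq_mul, ← mul_assoc, ← he, mul_inv_cancel_right]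
  have h2 : p'⁻¹ * p = 1 := by
    have : p'⁻¹ * p ∈ P ⊓ Q :=
      Subgroup.mem_inf.2 ⟨mul_mem (inv_mem hp') hp, h1 ▸ mul_mem hq' (inv_mem hq)⟩
    rwa [h.inf_eq_bot, Subgroup.mem_bot] at this
  have h3 : p = p' := (inv_mul_eq_one.1 h2).symm
  exact ⟨h3, by subst h3; exact mul_left_cancel he⟩

namespace IsTwisted

variable {T : Subgroup H} {β : T →* T →* Fˣ} {A : H → Submodule F D}

/-- Homogeneous elements with the multiplication table of the standard realization. -/
theorem exists_normalized [IsAlgClosed F] [FiniteDimensional F D] (hA : IsTwisted β A)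
    {P Q : Subgroup T} (hd : IsStandardDecomposition β P Q) :
    ∃ X : T → D, (∀ t : T, X t ∈ A t) ∧ (∀ t, X t ≠ 0) ∧
      ∀ p ∈ P, ∀ q ∈ Q, ∀ p' ∈ P, ∀ q' ∈ Q,
        X (p * q) * X (p' * q') = (β q p' : F) • X ((p * p') * (q * q')) := by
  obtain ⟨Y, hY, hY0, hYm⟩ := hA.exists_multiplicative P hd.2.1
  obtain ⟨Z, hZ, hZ0, hZm⟩ := hA.exists_multiplicative Q hd.2.2
  choose f hf g hg hfg using exists_mul_of_isCompl hd.1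
  have hX : ∀ p ∈ P, ∀ q ∈ Q, Y (f (p * q)) * Z (g (p * q)) = Y p * Z q := by
    intro p hp q hq
    obtain ⟨h1, h2⟩ := mul_inj_of_isCompl hd.1 (hf _) hp (hg _) hq (hfg (p * q))
    rw [h1, h2]
  refine ⟨fun t => Y (f t) * Z (g t), ?_, ?_, ?_⟩
  · intro t
    have := hA.grading.2 _ _ _ (hY (f t)) _ (hZ (g t))
    rwa [← Subgroup.coe_mul, hfg] at this
  · exact fun t => hA.mul_ne (hY _) (hY0 _) (hZ _) (hZ0 _)
  -- The only reordering needed in `Y p * Z q * (Y p' * Z q')` moves `Z q` past `Y p'`, at the cost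
  -- of `β q p'`.
  · intro p hp q hq p' hp' q' hq'
    simp only [hX p hp q hq, hX p' hp' q' hq', hX _ (mul_mem hp hp') _ (mul_mem hq hq')]
    rw [← hYm p hp p' hp', ← hZm q hq q' hq', mul_assoc, ← mul_assoc (Z q),
      hA.comm q p' _ (hZ q) _ (hY p'), smul_mul_assoc, mul_smul_comm]
    simp only [mul_assoc]

/-- Graded division algebras with the same support and commutation factor are isomorphic. -/
theorem gradedIso [IsAlgClosed F] [FiniteDimensional F D] (hA : IsTwisted β A)
    {D' : Type*} [Ring D'] [Algebra F D'] [FiniteDimensional F D'] {A' : H → Submodule F D'}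
    (hA' : IsTwisted β A') {P Q : Subgroup T} (hd : IsStandardDecomposition β P Q) :
    GradedIso A A' := by
  obtain ⟨X, hX, hX0, hXm⟩ := hA.exists_normalized hd
  obtain ⟨X', hX', hX0', hXm'⟩ := hA'.exists_normalized hd
  obtain ⟨b, hb⟩ := hA.exists_basis X hX hX0
  obtain ⟨b', hb'⟩ := hA'.exists_basis X' hX' hX0'
  -- The two normalized bases have the same structure constants, so matching them is multiplicative.
  let e : D ≃ₗ[F] D' := b.equiv b' (Equiv.refl T)
  have he : ∀ t, e (X t) = X' t := by
    intro t
    rw [← hb, ← hb', Module.Basis.equiv_apply]; rfl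
  have hmul : ∀ x y, e (x * y) = e x * e y := by
    intro x y
    have h : (LinearMap.mul F D).compr₂ e.toLinearMap =
        (LinearMap.mul F D').compl₁₂ e.toLinearMap e.toLinearMap := by
      refine b.ext fun s => b.ext fun t => ?_
      obtain ⟨p, hp, q, hq, rfl⟩ := exists_mul_of_isCompl hd.1 s
      obtain ⟨p', hp', q', hq', rfl⟩ := exists_mul_of_isCompl hd.1 t
      simp only [LinearMap.compr₂_apply, LinearMap.compl₁₂_apply, LinearMap.mul_apply',
        LinearEquiv.coe_coe, hb, he, hXm p hp q hq p' hp' q' hq', hXm' p hp q hq p' hp' q' hq',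
        map_smul]
    exact LinearMap.congr_fun₂ h x y
  have hone : e 1 = 1 := by
    have h1 : ∀ z, e 1 * z = z := by
      intro z
      obtain ⟨w, rfl⟩ := e.surjective z
      rw [← hmul, one_mul]
    simpa using h1 1
  refine ⟨AlgEquiv.ofLinearEquiv e hone hmul, fun h => ?_⟩
  by_cases hh : h ∈ T
  · apply le_antisymm
    · rintro _ ⟨x, hx, rfl⟩
      obtain ⟨c, rfl⟩ := hA.one_dim _ _ (hX ⟨h, hh⟩) (hX0 _) x hx
      simp only [AlgEquiv.toLinearMap_apply, AlgEquiv.ofLinearEquiv_apply, map_smul, he]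
      exact Submodule.smul_mem _ _ (hX' ⟨h, hh⟩)
    · intro x hx
      obtain ⟨c, rfl⟩ := hA'.one_dim _ _ (hX' ⟨h, hh⟩) (hX0' _) x hx
      exact ⟨c • X ⟨h, hh⟩, Submodule.smul_mem _ _ (hX ⟨h, hh⟩), by simp [he]⟩
  · rw [not_not.1 (mt (hA.ne_bot h).1 hh), not_not.1 (mt (hA'.ne_bot h).1 hh), Submodule.map_bot]

end IsTwisted

/-- A finite-dimensional graded division algebra over an algebraically closed field has
one-dimensional components, and commutation is governed by an alternating bicharacter. -/
theorem IsGradedDivision.exists_isTwisted [IsAlgClosed F] [FiniteDimensional F D]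
    {A : H → Submodule F D} (hA : IsGradedDivision A) :
    ∃ (T : Subgroup H) (β : T →* T →* Fˣ), IsTwisted β A ∧ ∀ t, β t t = 1 := by
  obtain ⟨hgr, hnt, hunit⟩ := hA
  -- For an eigenvalue `c` of `d`, the element `c - d` has degree `1` and is not invertible, so it
  -- is zero.
  have hscalar : ∀ d ∈ A 1, ∃ c : F, d = c • (1 : D) := by
    intro d hd
    obtain ⟨c, hc⟩ := spectrum.nonempty_of_isAlgClosed_of_finiteDimensional F d
    refine ⟨c, ?_⟩
    by_contra hne
    refine hc (hunit 1 _ (sub_mem ?_ hd) ?_)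
    · rw [Algebra.algebraMap_eq_smul_one]
      exact Submodule.smul_mem _ _ hgr.one_mem
    · rw [Algebra.algebraMap_eq_smul_one]
      exact fun h => hne (sub_eq_zero.1 h).symm
  have hone : ∀ h, ∀ x ∈ A h, x ≠ 0 → ∀ y ∈ A h, ∃ c : F, y = c • x := by
    intro h x hx hx0 y hy
    obtain ⟨z, hz, hxz, hzx⟩ := hgr.exists_inv hx (hunit h x hx hx0)
    obtain ⟨c, hc⟩ := hscalar (z * y) (by simpa using hgr.2 _ _ z hz y hy)
    refine ⟨c, ?_⟩
    calc y = x * (z * y) := by rw [← mul_assoc, hxz, one_mul]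
      _ = _ := by rw [hc, mul_smul_comm, mul_one]
  let T : Subgroup H :=
    { carrier := {h | A h ≠ ⊥}
      one_mem' := fun h => one_ne_zero (α := D) (by simpa [h] using hgr.one_mem)
      mul_mem' := by
        intro g h hg hh
        obtain ⟨x, hx, hx0⟩ := Submodule.exists_mem_ne_zero_of_ne_bot hg
        obtain ⟨y, hy, hy0⟩ := Submodule.exists_mem_ne_zero_of_ne_bot hh
        exact (Submodule.ne_bot_iff _).2 ⟨x * y, hgr.2 _ _ x hx y hy,
          ((hunit g x hx hx0).mul (hunit h y hy hy0)).ne_zero⟩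
      inv_mem' := by
        intro g hg
        obtain ⟨x, hx, hx0⟩ := Submodule.exists_mem_ne_zero_of_ne_bot hg
        obtain ⟨z, hz, hxz, hzx⟩ := hgr.exists_inv hx (hunit g x hx hx0)
        exact (Submodule.ne_bot_iff _).2 ⟨z, hz, by rintro rfl; simp at hxz⟩ }
  have hX : ∀ t : T, ∃ x ∈ A t, x ≠ 0 := fun t => Submodule.exists_mem_ne_zero_of_ne_bot t.2
  choose X hX hX0 using hX
  have hu : ∀ t, IsUnit (X t) := fun t => hunit _ _ (hX t) (hX0 t)
  have hb : ∀ s t : T, ∃ c : Fˣ, X s * X t = (c : F) • (X t * X s) := by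
    intro s t
    obtain ⟨c, hc⟩ := hone (t * s) (X t * X s) (hgr.2 _ _ _ (hX t) _ (hX s))
      ((hu t).mul (hu s)).ne_zero (X s * X t)
      (mul_comm (t : H) s ▸ hgr.2 _ _ _ (hX s) _ (hX t))
    refine ⟨Units.mk0 c ?_, hc⟩
    rintro rfl
    rw [zero_smul] at hc
    exact ((hu s).mul (hu t)).ne_zero hc
  choose b hb using hb
  have hcomm : ∀ s t : T, ∀ x ∈ A s, ∀ y ∈ A t, x * y = (b s t : F) • (y * x) := by
    intro s t x hx y hy
    obtain ⟨c, rfl⟩ := hone _ _ (hX s) (hX0 s) x hx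
    obtain ⟨d, rfl⟩ := hone _ _ (hX t) (hX0 t) y hy
    rw [smul_mul_smul_comm, smul_mul_smul_comm, hb, smul_smul, smul_smul]
    congr 1
    ring
  -- The scalar `b s t` can be read off from any nonzero elements of degrees `s` and `t`. Taking
  -- products as representatives gives multiplicativity in each argument, and taking the same
  -- element twice gives `b t t = 1`.
  have huniq : ∀ s t : T, ∀ x ∈ A s, x ≠ 0 → ∀ y ∈ A t, y ≠ 0 → ∀ c : Fˣ,
      x * y = (c : F) • (y * x) → b s t = c := by
    intro s t x hx hx0 y hy hy0 c hc
    rw [hcomm s t x hx y hy] at hc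
    have : y * x ≠ 0 := ((hunit _ y hy hy0).mul (hunit _ x hx hx0)).ne_zero
    exact Units.ext (smul_left_injective F this hc)
  have hleft : ∀ s s' t, b (s * s') t = b s t * b s' t := by
    intro s s' t
    refine huniq (s * s') t (X s * X s') (hgr.2 _ _ _ (hX s) _ (hX s'))
      ((hu s).mul (hu s')).ne_zero (X t) (hX t) (hX0 t) _ ?_
    rw [mul_assoc, hb s' t, mul_smul_comm, ← mul_assoc, hb s t, smul_mul_assoc, smul_smul,
      Units.val_mul, mul_comm (b s t : F), mul_assoc]
  have hright : ∀ s t t', b s (t * t') = b s t * b s t' := by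
    intro s t t'
    refine huniq s (t * t') (X s) (hX s) (hX0 s) (X t * X t') (hgr.2 _ _ _ (hX t) _ (hX t'))
      ((hu t).mul (hu t')).ne_zero _ ?_
    rw [← mul_assoc, hb s t, smul_mul_assoc, mul_assoc, hb s t', mul_smul_comm, smul_smul,
      Units.val_mul, mul_assoc]
  refine ⟨T, MonoidHom.mk' (fun s => MonoidHom.mk' (b s) (hright s))
    (fun s s' => MonoidHom.ext fun t => hleft s s' t), ⟨hgr, hnt, hunit, fun _ => Iff.rfl,
      hcomm, hone⟩, fun t => ?_⟩
  exact huniq t t (X t) (hX t) (hX0 t) (X t) (hX t) (hX0 t) 1 (by simp)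

end Twisted

/-! ### Graded endomorphism algebras -/

section GradedModules

variable {F : Type*} [Field F] {H : Type*} [CommGroup H] {D : Type*} [Ring D] [Algebra F D]
variable {U : Type*} [AddCommGroup U] [Module F U] [Module Dᵐᵒᵖ U] [IsScalarTower F Dᵐᵒᵖ U]
variable {D' : Type*} [Ring D'] [Algebra F D']
variable {U' : Type*} [AddCommGroup U'] [Module F U'] [Module D'ᵐᵒᵖ U'] [IsScalarTower F D'ᵐᵒᵖ U']

/-- Conjugation by a semilinear equivalence. -/
def endCongr (f : U ≃ₗ[F] U')
    (h1 : ∀ d : D, ∃ d' : D', ∀ x, f (op d • x) = op d' • f x)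
    (h2 : ∀ d' : D', ∃ d : D, ∀ x, f (op d • x) = op d' • f x) :
    Module.End Dᵐᵒᵖ U ≃ₐ[F] Module.End D'ᵐᵒᵖ U' where
  toFun r :=
    { toFun := fun y => f (r (f.symm y))
      map_add' := fun x y => by simp only [map_add]
      map_smul' := by
        intro d y
        obtain ⟨d', hd'⟩ := h2 d.unop
        replace hd' : ∀ x, f (op d' • x) = d • f x := hd'
        obtain ⟨x, rfl⟩ := f.surjective y
        simp only [RingHom.id_apply, ← hd', LinearEquiv.symm_apply_apply, map_smul] }
  invFun r :=
    { toFun := fun x => f.symm (r (f x))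
      map_add' := fun x y => by simp only [map_add]
      map_smul' := by
        intro d x
        obtain ⟨d', hd'⟩ := h1 d.unop
        replace hd' : ∀ x, f (d • x) = op d' • f x := hd'
        simp only [RingHom.id_apply, hd', map_smul]
        rw [LinearEquiv.symm_apply_eq, hd', LinearEquiv.apply_symm_apply] }
  left_inv r := by ext x; simp
  right_inv r := by ext x; simp
  map_mul' r s := by ext x; simp
  map_add' r s := by ext x; simp
  commutes' c := by ext x; simp [Module.algebraMap_end_apply]

theorem endCongr_apply (f : U ≃ₗ[F] U')
    (h1 : ∀ d : D, ∃ d' : D', ∀ x, f (op d • x) = op d' • f x)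
    (h2 : ∀ d' : D', ∃ d : D, ∀ x, f (op d • x) = op d' • f x) (r : Module.End Dᵐᵒᵖ U) (x : U) :
    endCongr f h1 h2 r (f x) = f (r x) := by
  change f (r (f.symm (f x))) = _
  rw [LinearEquiv.symm_apply_apply]

/-- A semilinear equivalence that shifts degrees induces an isomorphism of graded
endomorphism algebras. -/
theorem gradedIso_endComponent {V : H → Submodule F U} {V' : H → Submodule F U'} (f : U ≃ₗ[F] U')
    (h1 : ∀ d : D, ∃ d' : D', ∀ x, f (op d • x) = op d' • f x)
    (h2 : ∀ d' : D', ∃ d : D, ∀ x, f (op d • x) = op d' • f x)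
    (c : H) (hV : ∀ h x, x ∈ V h ↔ f x ∈ V' (h * c)) :
    GradedIso (endComponent D V) (endComponent D' V') := by
  -- Argument and value are both shifted by `c`, so the degree of an endomorphism is unaffected.
  have key : ∀ h r, r ∈ endComponent D V h ↔ endCongr f h1 h2 r ∈ endComponent D' V' h := by
    intro h r
    constructor
    · intro hr g y hy
      obtain ⟨x, rfl⟩ := f.surjective y
      have hx : x ∈ V (g * c⁻¹) := by rw [hV]; simpa using hy
      rw [endCongr_apply]
      have := (hV _ _).1 (hr _ x hx)
      simpa [mul_assoc] using this
    · intro hr g x hx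
      have := hr _ _ ((hV _ _).1 hx)
      rw [endCongr_apply, ← mul_assoc] at this
      exact (hV _ _).2 this
  refine ⟨endCongr f h1 h2, fun h => le_antisymm ?_ fun r hr => ?_⟩
  · rintro _ ⟨r, hr, rfl⟩
    exact (key h r).1 hr
  · obtain ⟨s, rfl⟩ := (endCongr f h1 h2).surjective r
    exact ⟨s, (key h s).2 hr, rfl⟩

/-- Acting on a fixed vector. -/
def actOn (v : U) : D →ₗ[F] U where
  toFun d := op d • v
  map_add' d e := by rw [op_add, add_smul]
  map_smul' c d := by rw [op_smul, smul_assoc, RingHom.id_apply]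

/-- The linear combinations with coefficients on the right. -/
def rightCombination {k : ℕ} (v : Fin k → U) : (Fin k → D) →ₗ[F] U :=
  ∑ i, actOn (v i) ∘ₗ LinearMap.proj i

theorem rightCombination_apply {k : ℕ} (v : Fin k → U) (x : Fin k → D) :
    rightCombination (F := F) v x = ∑ i, op (x i) • v i := by
  simp [rightCombination, actOn]

theorem rightCombination_smul {k : ℕ} (v : Fin k → U) (x : Fin k → D) (d : D) :
    rightCombination (F := F) v (op d • x) = op d • rightCombination (F := F) v x := by
  simp only [rightCombination_apply, Finset.smul_sum, smul_smul, Pi.smul_apply, op_smul_eq_mul,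
    op_mul]

/-- A finite-dimensional graded module over a graded division algebra has a homogeneous basis. -/
theorem IsGradedRightModule.exists_basis [FiniteDimensional F U] [Nontrivial D]
    {A : H → Submodule F D} (hA : IsAlgebraGrading A) (hu : ∀ h, ∀ d ∈ A h, d ≠ 0 → IsUnit d)
    {V : H → Submodule F U} (hV : IsGradedRightModule A V) :
    ∃ (k : ℕ) (g : Fin k → H) (f : (Fin k → D) ≃ₗ[F] U),
      (∀ (d : D) x, f (op d • x) = op d • f x) ∧
        ∀ h x, x ∈ shiftComponent A g h ↔ f x ∈ V h := by
  obtain ⟨π, p0, p1, p2, p3⟩ := hA.1.exists_proj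
  obtain ⟨ρ, r0, r1, r2, r3⟩ := hV.1.exists_proj
  have hρ : ∀ g h, ∀ v ∈ V g, ∀ d : D, ρ h (op d • v) = op (π (g⁻¹ * h) d) • v := by
    intro g h v hv
    refine hA.1.induction ?_ (by simp) ?_
    · intro t d hd
      have hm := hV.2 g t v hv d hd
      by_cases ht : t = g⁻¹ * h
      · subst ht
        rw [p1 _ d hd, r1 _ _ (by simpa using hm)]
      · rw [p2 _ t d hd ht, r2 h (g * t) _ hm (by rwa [Ne, ← eq_inv_mul_iff_mul_eq])]
        simp
    · intro d e hd he
      simp only [op_add, add_smul, map_add, hd, he]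
  -- `P k` asserts that there are `k` homogeneous vectors independent over `D`. As `F` embeds in
  -- `D`, such a `k` cannot exceed `dim U`, so a largest one exists; its vectors will span.
  let P : ℕ → Prop := fun k => ∃ (g : Fin k → H) (v : Fin k → U), (∀ i, v i ∈ V (g i)) ∧
    ∀ x : Fin k → D, rightCombination (F := F) v x = 0 → x = 0
  have hmax : ∃ k, P k ∧ ¬ P (k + 1) := by
    by_contra! hc
    have hall : ∀ k, P k := fun k => Nat.rec
      ⟨Fin.elim0, Fin.elim0, fun i => i.elim0, fun x _ => Subsingleton.elim _ _⟩
      (fun k hk => hc k hk) k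
    obtain ⟨g, v, -, hv⟩ := hall (Module.finrank F U + 1)
    obtain ⟨c, hc⟩ : ∃ c : F →ₗ[F] D, Function.Injective c :=
      ⟨(Algebra.ofId F D).toLinearMap, (algebraMap F D).injective⟩
    let m : (Fin (Module.finrank F U + 1) → F) →ₗ[F] U :=
      rightCombination (F := F) v ∘ₗ (c.compLeft _)
    have hm : Function.Injective m := by
      refine ((injective_iff_map_eq_zero _).2 hv).comp fun x y hxy => ?_
      funext i
      exact hc (congrFun hxy i)
    have := LinearMap.finrank_le_finrank_of_injective hm
    simp at this
  obtain ⟨k, ⟨g, v, hv, hinj⟩, hk⟩ := hmax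
  have hproj : ∀ h x, ρ h (rightCombination (F := F) v x) =
      rightCombination (F := F) v (fun i => π ((g i)⁻¹ * h) (x i)) := by
    intro h x
    simp only [rightCombination_apply, map_sum]
    exact Finset.sum_congr rfl fun i _ => hρ _ _ _ (hv i) _
  have hsurj : ∀ h, V h ≤ LinearMap.range (rightCombination (F := F) (D := D) v) := by
    intro h w hw
    by_contra hnot
    refine hk ⟨Fin.cons h g, Fin.cons w v, fun i => ?_, fun x hx => ?_⟩
    · refine Fin.cases ?_ (fun j => ?_) i
      · exact hw
      · exact hv j
    · have hx' : op (x 0) • w + rightCombination (F := F) v (fun i => x i.succ) = 0 := by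
        rw [← hx, rightCombination_apply, rightCombination_apply, Fin.sum_univ_succ]
        simp
      -- If the component of degree `t` of the coefficient of `w` is nonzero, then it is invertible,
      -- and the part of degree `h * t` of the relation expresses `w` through the other vectors.
      have h0 : x 0 = 0 := by
        apply p3
        intro t
        by_contra ht
        apply hnot
        have h1 := congrArg (ρ (h * t)) hx'
        rw [map_add, hρ h _ w hw, hproj, map_zero, inv_mul_cancel_left] at h1
        obtain ⟨y, hy, hy1, hy2⟩ := hA.exists_inv (p0 t (x 0)) (hu _ _ (p0 t (x 0)) ht)
        refine ⟨-(op y • fun i => π ((g i)⁻¹ * (h * t)) (x i.succ)), ?_⟩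
        rw [map_neg, rightCombination_smul, eq_neg_of_add_eq_zero_right h1, smul_neg, neg_neg,
          smul_smul, ← op_mul, hy1, op_one, one_smul]
      rw [h0, op_zero, zero_smul, zero_add] at hx'
      have h1 := hinj _ hx'
      funext i
      refine Fin.cases h0 (fun j => ?_) i
      exact congrFun h1 j
  have hbij : Function.Bijective (rightCombination (F := F) (D := D) v) := by
    refine ⟨(injective_iff_map_eq_zero _).2 hinj, LinearMap.range_eq_top.1 ?_⟩
    rw [eq_top_iff, ← hV.1.2]
    exact iSup_le hsurj
  refine ⟨k, g, LinearEquiv.ofBijective _ hbij, fun d x => rightCombination_smul v x d,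
    fun h x => ⟨fun hx => ?_, fun hx => ?_⟩⟩
  · change rightCombination (F := F) v x ∈ V h
    rw [rightCombination_apply]
    refine Submodule.sum_mem _ fun i _ => ?_
    have := hV.2 _ _ _ (hv i) _ (hx i trivial)
    rwa [mul_comm h, mul_inv_cancel_left] at this
  · change rightCombination (F := F) v x ∈ V h at hx
    have h1 := hproj h x
    rw [r1 _ _ hx] at h1
    have h2 := hbij.1 h1
    intro i _
    rw [h2]
    change π ((g i)⁻¹ * h) (x i) ∈ A (h * (g i)⁻¹)
    rw [mul_comm h]
    exact p0 _ _

section Shift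

variable {k : ℕ}

theorem mem_shiftComponent {A : H → Submodule F D} {γ : Fin k → H} {h : H} {x : Fin k → D} :
    x ∈ shiftComponent A γ h ↔ ∀ i, x i ∈ A (h * (γ i)⁻¹) :=
  ⟨fun hx i => hx i trivial, fun hx i _ => hx i⟩

theorem single_mem_shiftComponent {A : H → Submodule F D} {γ : Fin k → H} {h : H} {i : Fin k}
    {d : D} (hd : d ∈ A (h * (γ i)⁻¹)) : Pi.single i d ∈ shiftComponent A γ h := by
  rw [mem_shiftComponent]
  intro j
  by_cases hj : j = i
  · subst hj; rwa [Pi.single_eq_same]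
  · rw [Pi.single_eq_of_ne hj]; exact zero_mem _

theorem isGradedRightModule_shift {A : H → Submodule F D} (hA : IsAlgebraGrading A)
    (γ : Fin k → H) : IsGradedRightModule A (shiftComponent A γ) := by
  obtain ⟨π, p0, p1, p2, p3⟩ := hA.1.exists_proj
  refine ⟨⟨?_, ?_⟩, ?_⟩
  · refine iSupIndep_of_proj
      (fun h => LinearMap.pi fun i => π (h * (γ i)⁻¹) ∘ₗ LinearMap.proj i) ?_ ?_
    · intro h x hx
      funext i
      exact p1 _ _ (hx i trivial)
    · intro h h' x hx hne
      funext i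
      exact p2 _ _ _ (hx i trivial) (by simpa using hne)
  · rw [eq_top_iff]
    rintro x -
    rw [← Finset.univ_sum_single x]
    refine Submodule.sum_mem _ fun i _ => ?_
    refine hA.1.induction (p := fun d => (Pi.single i d : Fin k → D) ∈ _) ?_ ?_ ?_ (x i)
    · intro t d hd
      refine Submodule.mem_iSup_of_mem (t * γ i) (single_mem_shiftComponent ?_)
      rwa [mul_inv_cancel_right]
    · rw [Pi.single_zero]; exact zero_mem _
    · intro d e hd he
      rw [Pi.single_add]; exact add_mem hd he
  · intro g h v hv d hd i _
    change v i * d ∈ _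
    have := hA.2 _ _ _ (hv i trivial) _ hd
    rwa [mul_right_comm] at this

/-- The endomorphism whose matrix has `d` in position `(i, j)` and zeros elsewhere. -/
def elementary (i j : Fin k) (d : D) : Module.End Dᵐᵒᵖ (Fin k → D) where
  toFun y := Pi.single i (d * y j)
  map_add' x y := by rw [← Pi.single_add, ← mul_add]; rfl
  map_smul' c y := by
    funext l
    by_cases hl : l = i
    · subst hl
      simp [mul_assoc]
    · simp [hl]

theorem elementary_apply (i j : Fin k) (d : D) (y : Fin k → D) :
    elementary i j d y = Pi.single i (d * y j) := rfl

theorem end_apply_eq_sum (f : Module.End Dᵐᵒᵖ (Fin k → D)) (y : Fin k → D) :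
    f y = ∑ j, op (y j) • f (Pi.single j 1) := by
  conv_lhs => rw [← Finset.univ_sum_single y]
  rw [map_sum]
  refine Finset.sum_congr rfl fun j _ => ?_
  rw [← map_smul]
  congr 1
  funext l
  by_cases hl : l = j
  · subst hl; simp
  · simp [hl]

theorem end_eq_sum_elementary (f : Module.End Dᵐᵒᵖ (Fin k → D)) :
    f = ∑ i, ∑ j, elementary i j (f (Pi.single j 1) i) := by
  refine LinearMap.ext fun y => ?_
  rw [end_apply_eq_sum]
  funext l
  simp [LinearMap.sum_apply, elementary_apply, Finset.sum_apply, Pi.single_apply]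

theorem elementary_mem {A : H → Submodule F D} (hA : IsAlgebraGrading A) (γ : Fin k → H)
    (i j : Fin k) {t : H} {d : D} (hd : d ∈ A t) :
    elementary i j d ∈ endComponent D (shiftComponent A γ) (t * γ i * (γ j)⁻¹) := by
  intro g y hy
  rw [elementary_apply]
  apply single_mem_shiftComponent
  have := hA.2 _ _ _ hd _ (hy j trivial)
  convert this using 2
  rw [mul_right_comm (t * γ i), mul_right_comm (t * γ i * g), mul_right_comm t,
    mul_inv_cancel_right, mul_assoc]

theorem endComponent_mul {V : H → Submodule F U} (g h : H) {r s : Module.End Dᵐᵒᵖ U}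
    (hr : r ∈ endComponent D V g) (hs : s ∈ endComponent D V h) :
    r * s ∈ endComponent D V (g * h) := by
  intro l v hv
  rw [mul_assoc]
  exact hr _ _ (hs _ _ hv)

/-- On a vector of degree `g`, maps of degree other than `h` take values with no part of degree `h *
g`. -/
theorem iSupIndep_endComponent {V : H → Submodule F U} (hV : IsVectorGrading V) :
    iSupIndep (endComponent D V) := by
  obtain ⟨π, p0, p1, p2, p3⟩ := hV.exists_proj
  rw [iSupIndep_def]
  intro h
  rw [Submodule.disjoint_def]
  intro f hf hf'
  refine LinearMap.ext fun x => ?_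
  refine hV.induction (p := fun x => f x = (0 : Module.End Dᵐᵒᵖ U) x) ?_ (by simp) ?_ x
  · intro g v hv
    have hz : ∀ f' ∈ (⨆ j, ⨆ (_ : j ≠ h), endComponent D V j), π (h * g) (f' v) = 0 := by
      intro f' hf'
      refine Submodule.iSup_induction _ (motive := fun f' => π (h * g) (f' v) = 0) hf'
        ?_ (by simp) ?_
      · intro j r hr
        refine Submodule.iSup_induction _ (motive := fun f' => π (h * g) (f' v) = 0) hr
          ?_ (by simp) ?_
        · intro hj r hr
          exact p2 _ _ _ (hr _ _ hv) (by simpa using hj)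
        · intro r s hr hs
          rw [LinearMap.add_apply, map_add, hr, hs, add_zero]
      · intro r s hr hs
        rw [LinearMap.add_apply, map_add, hr, hs, add_zero]
    rw [← p1 _ _ (hf g v hv), hz f hf', LinearMap.zero_apply]
  · intro x y hx hy
    rw [map_add, hx, hy, ← map_add]

/-- Independence holds over any graded module; spanning uses the finite basis, since matrix units
with homogeneous entries are homogeneous. -/
theorem isAlgebraGrading_endComponent {A : H → Submodule F D} (hA : IsAlgebraGrading A)
    (γ : Fin k → H) : IsAlgebraGrading (endComponent D (shiftComponent A γ)) := by
  refine ⟨⟨iSupIndep_endComponent (isGradedRightModule_shift hA γ).1, ?_⟩,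
    fun g h x hx y hy => endComponent_mul g h hx hy⟩
  rw [eq_top_iff]
  rintro f -
  rw [end_eq_sum_elementary f]
  refine Submodule.sum_mem _ fun i _ => Submodule.sum_mem _ fun j _ => ?_
  refine hA.1.induction (p := fun d => elementary i j d ∈ _) ?_ ?_ ?_ (f (Pi.single j 1) i)
  · intro t d hd
    exact Submodule.mem_iSup_of_mem _ (elementary_mem hA γ i j hd)
  · have : elementary i j (0 : D) = 0 := by ext; simp [elementary_apply]
    rw [this]; exact zero_mem _
  · intro d e hd he
    have : elementary i j (d + e) = elementary i j d + elementary i j e := by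
      refine LinearMap.ext fun y => ?_
      simp [elementary_apply, add_mul, Pi.single_add]
    rw [this]; exact add_mem hd he

/-- Endomorphisms of a free right module are matrices. -/
def endAlgEquivMatrix (F D : Type*) [Field F] [Ring D] [Algebra F D] (k : ℕ) :
    Module.End Dᵐᵒᵖ (Fin k → D) ≃ₐ[F] Matrix (Fin k) (Fin k) D where
  toFun f := Matrix.of fun i j => f (Pi.single j 1) i
  invFun m :=
    { toFun := fun y i => ∑ j, m i j * y j
      map_add' := fun x y => by funext i; simp [mul_add, Finset.sum_add_distrib]
      map_smul' := fun c y => by funext i; simp [Finset.sum_mul, mul_assoc] }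
  left_inv f := by
    refine LinearMap.ext fun y => ?_
    rw [end_apply_eq_sum f y]
    funext i
    simp
  right_inv m := by
    ext i j
    simp [Pi.single_apply]
  map_mul' f g := by
    ext i j
    simp only [Matrix.of_apply, Matrix.mul_apply, Module.End.mul_apply]
    rw [end_apply_eq_sum f]
    simp
  map_add' f g := by ext i j; simp
  commutes' c := by
    ext i j
    simp [Matrix.algebraMap_matrix_apply, Pi.single_apply,
      Algebra.algebraMap_eq_smul_one]

theorem finrank_end (F D : Type*) [Field F] [Ring D] [Algebra F D] (k : ℕ) :
    Module.finrank F (Module.End Dᵐᵒᵖ (Fin k → D)) = k ^ 2 * Module.finrank F D := by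
  rw [(endAlgEquivMatrix F D k).toLinearEquiv.finrank_eq, Module.finrank_matrix]
  simp [pow_two]

end Shift

end GradedModules

/-! ### Bicharacters on finite abelian groups -/

section Bicharacters

variable {F : Type*} [Field F] {T : Type*} [CommGroup T]

theorem linearIndependent_character {ι : Type*} (f : ι → T →* Fˣ) (hf : Function.Injective f) :
    LinearIndependent F (fun i (t : T) => ((f i t : Fˣ) : F)) := by
  refine (linearIndependent_monoidHom T F).comp (fun i => (Units.coeHom F).comp (f i)) ?_
  intro i j hij
  apply hf
  ext t
  exact DFunLike.congr_fun hij t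

theorem finite_character [Finite T] : Finite (T →* Fˣ) :=
  have := Fintype.ofFinite T
  (linearIndependent_character (F := F) (T := T) id Function.injective_id).finite

/-- Characters are linearly independent in the space of functions on `T`, whose dimension is the
order of `T`. Nothing is required of the characteristic. -/
theorem card_character_le [Finite T] : Nat.card (T →* Fˣ) ≤ Nat.card T := by
  have := Fintype.ofFinite T
  have := finite_character (F := F) (T := T)
  have := Fintype.ofFinite (T →* Fˣ)
  have h := (linearIndependent_character (F := F) (T := T) id
    Function.injective_id).fintype_card_le_finrank
  rwa [Module.finrank_fintype_fun_eq_card, ← Nat.card_eq_fintype_card,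
    ← Nat.card_eq_fintype_card] at h

/-- A nondegenerate bicharacter on a finite abelian group identifies it with its character
group. -/
theorem bijective_of_nondegenerate [Finite T] (β : T →* T →* Fˣ)
    (hβ : ∀ s, (∀ t, β s t = 1) → s = 1) : Function.Bijective β := by
  have := finite_character (F := F) (T := T)
  exact Function.Injective.bijective_of_nat_card_le ((injective_iff_map_eq_one _).2 fun s hs =>
    hβ s fun t => by rw [hs]; rfl) card_character_le

theorem alternating_swap {β : T →* T →* Fˣ} (hβ : ∀ t, β t t = 1) (s t : T) :
    β s t = (β t s)⁻¹ := by
  have h := hβ (s * t)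
  simp only [map_mul, MonoidHom.mul_apply, hβ, one_mul, mul_one] at h
  exact eq_inv_of_mul_eq_one_right h

/-- A subgroup on which an alternating bicharacter is nondegenerate is the direct product of two
isotropic subgroups. -/
theorem exists_isotropic_decomposition [Finite T] {β : T →* T →* Fˣ} (hβ : ∀ t, β t t = 1)
    (K : Subgroup T) (hK : ∀ s ∈ K, (∀ t ∈ K, β s t = 1) → s = 1) :
    ∃ A B : Subgroup T, A ⊓ B = ⊥ ∧ A ⊔ B = K ∧ (∀ a ∈ A, ∀ a' ∈ A, β a a' = 1) ∧
      (∀ b ∈ B, ∀ b' ∈ B, β b b' = 1) := by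
  induction K using WellFoundedLT.induction with
  | ind K ih =>
  by_cases hbot : K = ⊥
  · subst hbot
    refine ⟨⊥, ⊥, by simp, by simp, ?_, ?_⟩ <;>
    · intro a ha a' ha'
      rw [Subgroup.mem_bot.1 ha, map_one]; rfl
  have hsw := alternating_swap hβ
  -- A hyperbolic pair is split off: `a` has maximal order `m`, and `b` is chosen so that `β a b`
  -- generates the group of values of `β a` on `K`. Nondegeneracy makes `β a b` a primitive root of
  -- unity of order `m`, and the induction continues in the orthogonal complement `K'` of `a` and
  -- `b`.
  obtain ⟨a, ha⟩ := Monoid.exists_orderOf_eq_exponent (G := K)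
    (Monoid.ExponentExists.of_finite)
  set m := Monoid.exponent K with hm
  have hpow : ∀ x ∈ K, x ^ m = 1 := fun x hx => by
    have := Monoid.pow_exponent_eq_one (⟨x, hx⟩ : K)
    exact congrArg Subtype.val this
  have hm0 : m ≠ 0 := Monoid.exponent_ne_zero_of_finite
  have hm1 : m ≠ 1 := by
    intro h1
    apply hbot
    rw [eq_bot_iff]
    intro x hx
    have := hpow x hx
    rw [h1, pow_one] at this
    exact Subgroup.mem_bot.2 this
  obtain ⟨a, haK⟩ := a
  rw [Subgroup.orderOf_mk] at ha
  let ψ : K →* Fˣ := (β a).comp K.subtype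
  have : Finite ψ.range := Set.finite_range ψ
  obtain ⟨⟨ζ, hζ⟩, hgen⟩ := IsCyclic.exists_generator (α := ψ.range)
  obtain ⟨⟨b, hbK⟩, hb⟩ := hζ
  change β a b = ζ at hb
  have hax : ∀ x ∈ K, β a x ∈ zpowers ζ := by
    intro x hx
    obtain ⟨i, hi⟩ := hgen ⟨ψ ⟨x, hx⟩, ⟨x, hx⟩, rfl⟩
    exact ⟨i, congrArg Subtype.val hi⟩
  have hζz : ∀ j : ℤ, ζ ^ j = 1 → a ^ j = 1 := by
    intro j hj
    refine hK _ (zpow_mem haK j) fun t ht => ?_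
    obtain ⟨i, hi⟩ := hax t ht
    simp only at hi
    rw [map_zpow, MonoidHom.zpow_apply, ← hi, ← zpow_mul, mul_comm, zpow_mul, hj, one_zpow]
  have hζm : ζ ^ m = 1 := by rw [← hb, ← map_pow, hpow b hbK, map_one]
  have hord : orderOf ζ = m := by
    refine Nat.dvd_antisymm (orderOf_dvd_of_pow_eq_one hζm) ?_
    rw [← ha]
    refine orderOf_dvd_of_pow_eq_one ?_
    have := hζz (orderOf ζ) (by rw [zpow_natCast, pow_orderOf_eq_one])
    rwa [zpow_natCast] at this
  have hprim : IsPrimitiveRoot ζ m := hord ▸ IsPrimitiveRoot.orderOf ζ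
  have : NeZero m := ⟨hm0⟩
  -- Values on `K` are roots of unity of order dividing `m`, and all of these are powers of `ζ`.
  have hroots : ∀ x ∈ K, ∀ y, β y x ∈ zpowers ζ := by
    intro x hx y
    have : β y x ∈ rootsOfUnity m F := by
      rw [mem_rootsOfUnity, ← map_pow, hpow x hx, map_one]
    rw [← hprim.zpowers_eq] at this
    exact this
  have hba : β b a = ζ⁻¹ := by rw [hsw, hb]
  let K' : Subgroup T := K ⊓ (β a).ker ⊓ (β b).ker
  have hK'a : ∀ x ∈ K', β a x = 1 := fun x hx => (Subgroup.mem_inf.1 (Subgroup.mem_inf.1 hx).1).2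
  have hK'b : ∀ x ∈ K', β b x = 1 := fun x hx => (Subgroup.mem_inf.1 hx).2
  have hK'K : ∀ x ∈ K', x ∈ K := fun x hx => (Subgroup.mem_inf.1 (Subgroup.mem_inf.1 hx).1).1
  -- Orthogonal projection: `x` is corrected by the element of `⟨a⟩⟨b⟩` that has the same pairings
  -- with `a` and `b`. The sign of the exponent of `a` reflects `β b a = ζ⁻¹`.
  have hdec : ∀ x ∈ K, ∃ i j : ℤ, ∃ x' ∈ K', a ^ i * b ^ j * x' = x := by
    intro x hx
    obtain ⟨j, hj⟩ := hroots x hx a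
    obtain ⟨i, hi⟩ := hroots x hx b
    simp only at hi hj
    refine ⟨-i, j, (a ^ (-i) * b ^ j)⁻¹ * x, ?_, mul_inv_cancel_left _ _⟩
    refine Subgroup.mem_inf.2 ⟨Subgroup.mem_inf.2 ⟨mul_mem (inv_mem
      (mul_mem (zpow_mem haK _) (zpow_mem hbK _))) hx, ?_⟩, ?_⟩
    · rw [MonoidHom.mem_ker, map_mul, map_inv, map_mul, map_zpow, map_zpow, hβ, hb, ← hj]
      simp
    · rw [MonoidHom.mem_ker, map_mul, map_inv, map_mul, map_zpow, map_zpow, hβ, hba, ← hi]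
      simp
  have haK' : a ∉ K' := fun h => hm1 (by
    have := hK'b a h
    rw [hba, inv_eq_one] at this
    rw [← hord, this, orderOf_one])
  obtain ⟨A', B', hAB, hABs, hA', hB'⟩ := ih K'
    (lt_of_le_of_ne (fun x hx => hK'K x hx) fun h => haK' (h ▸ haK)) (by
      intro s hs h
      refine hK s (hK'K s hs) fun t ht => ?_
      obtain ⟨i, j, x', hx', rfl⟩ := hdec t ht
      rw [map_mul, map_mul, map_zpow, map_zpow, hsw s a, hsw s b, hK'a s hs, hK'b s hs, h x' hx']
      simp)
  have hA'K : ∀ x ∈ A', x ∈ K' := fun x hx => hABs ▸ Subgroup.mem_sup_left hx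
  have hB'K : ∀ x ∈ B', x ∈ K' := fun x hx => hABs ▸ Subgroup.mem_sup_right hx
  refine ⟨zpowers a ⊔ A', zpowers b ⊔ B', ?_, ?_, ?_, ?_⟩
  · rw [eq_bot_iff]
    intro x hx
    obtain ⟨h1, h2⟩ := Subgroup.mem_inf.1 hx
    obtain ⟨_, ⟨i, rfl⟩, a', ha', rfl⟩ := Subgroup.mem_sup.1 h1
    obtain ⟨_, ⟨j, rfl⟩, b', hb', he⟩ := Subgroup.mem_sup.1 h2
    simp only at he
    -- Pairing with `b` isolates the power of `a`, and pairing with `a` isolates that of `b`; both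
    -- powers turn out trivial, which leaves an element of `A' ⊓ B'`.
    have e1 := congrArg (β b) he
    rw [map_mul, map_mul, map_zpow, map_zpow, hβ, hba, hK'b _ (hA'K _ ha'), hK'b _ (hB'K _ hb')]
      at e1
    have e2 := congrArg (β a) he
    rw [map_mul, map_mul, map_zpow, map_zpow, hβ, hb, hK'a _ (hA'K _ ha'), hK'a _ (hB'K _ hb')]
      at e2
    simp only [one_zpow, mul_one, inv_zpow] at e1 e2
    have hai : a ^ i = 1 := hζz i (inv_eq_one.1 e1.symm)
    have hbj : b ^ j = 1 := by
      obtain ⟨l, hl⟩ := (hprim.zpow_eq_one_iff_dvd j).1 e2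
      rw [hl, zpow_mul, zpow_natCast, hpow b hbK, one_zpow]
    rw [hai, hbj, one_mul, one_mul] at he
    subst he
    have : b' ∈ A' ⊓ B' := Subgroup.mem_inf.2 ⟨ha', hb'⟩
    rw [hAB] at this
    simp only [hai, one_mul]
    exact this
  · apply le_antisymm
    · refine sup_le (sup_le ?_ fun x hx => hK'K x (hA'K x hx))
        (sup_le ?_ fun x hx => hK'K x (hB'K x hx))
      · rwa [Subgroup.zpowers_le]
      · rwa [Subgroup.zpowers_le]
    · intro x hx
      obtain ⟨i, j, x', hx', rfl⟩ := hdec x hx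
      refine mul_mem (mul_mem ?_ ?_) ?_
      · exact Subgroup.mem_sup_left (Subgroup.mem_sup_left ⟨i, rfl⟩)
      · exact Subgroup.mem_sup_right (Subgroup.mem_sup_left ⟨j, rfl⟩)
      · rw [← hABs] at hx'
        exact (sup_le_sup (le_sup_right : A' ≤ zpowers a ⊔ A')
          (le_sup_right : B' ≤ zpowers b ⊔ B')) hx'
  · intro x hx y hy
    obtain ⟨_, ⟨i, rfl⟩, a', ha', rfl⟩ := Subgroup.mem_sup.1 hx
    obtain ⟨_, ⟨j, rfl⟩, a'', ha'', rfl⟩ := Subgroup.mem_sup.1 hy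
    simp only [map_mul, map_zpow, MonoidHom.mul_apply, MonoidHom.zpow_apply, hβ,
      hK'a _ (hA'K _ ha''), hA' _ ha' _ ha'', hsw a' a, hK'a _ (hA'K _ ha')]
    simp
  · intro x hx y hy
    obtain ⟨_, ⟨i, rfl⟩, a', ha', rfl⟩ := Subgroup.mem_sup.1 hx
    obtain ⟨_, ⟨j, rfl⟩, a'', ha'', rfl⟩ := Subgroup.mem_sup.1 hy
    simp only [map_mul, map_zpow, MonoidHom.mul_apply, MonoidHom.zpow_apply, hβ,
      hK'b _ (hB'K _ ha''), hB' _ ha' _ ha'', hsw a' b, hK'b _ (hB'K _ ha')]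
    simp

theorem exists_isStandardDecomposition {H : Type*} [CommGroup H] {T : Subgroup H} [Finite T]
    {β : T →* T →* Fˣ} (hβ : ∀ t, β t t = 1) (hnd : ∀ s, (∀ t, β s t = 1) → s = 1) :
    ∃ A B : Subgroup T, IsStandardDecomposition β A B := by
  obtain ⟨A, B, h1, h2, h3, h4⟩ := exists_isotropic_decomposition hβ ⊤
    (fun s _ h => hnd s fun t => h t trivial)
  exact ⟨A, B, ⟨disjoint_iff.2 h1, codisjoint_iff.2 h2⟩, h3, h4⟩

end Bicharacters

/-! ### Standard realizations -/

section StandardRealization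

variable {F : Type*} [Field F] {H : Type*} [CommGroup H]

/-- A basis indexed by the support, with the appropriate multiplication table, gives a division
grading with one-dimensional components. -/
theorem isTwisted_of_basis {D : Type*} [Ring D] [Algebra F D] {T : Subgroup H}
    {β : T →* T →* Fˣ} {A : H → Submodule F D} (b : Module.Basis T F D)
    (hA : ∀ t : T, A t = Submodule.span F {b t}) (hA' : ∀ h, h ∉ T → A h = ⊥) (h1 : b 1 = 1)
    (hb : ∀ s t, ∃ c : Fˣ, b s * b t = (c : F) • b (s * t))
    (hc : ∀ s t, b s * b t = (β s t : F) • (b t * b s)) : IsTwisted β A := by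
  classical
  have hmem : ∀ h, ∀ x ∈ A h, x ≠ 0 → ∃ t : T, (t : H) = h ∧ ∃ c : F, c ≠ 0 ∧ x = c • b t := by
    intro h x hx hx0
    by_cases hh : h ∈ T
    · refine ⟨⟨h, hh⟩, rfl, ?_⟩
      rw [hA ⟨h, hh⟩] at hx
      obtain ⟨c, rfl⟩ := Submodule.mem_span_singleton.1 hx
      exact ⟨c, fun h => hx0 (by rw [h, zero_smul]), rfl⟩
    · rw [hA' h hh] at hx
      exact absurd ((Submodule.mem_bot F).1 hx) hx0
  have hbA : ∀ t : T, b t ∈ A t := fun t => hA t ▸ Submodule.mem_span_singleton_self _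
  have hu : ∀ t, IsUnit (b t) := by
    intro t
    refine isUnit_iff_exists_and_exists.2 ⟨?_, ?_⟩
    · obtain ⟨c, hc⟩ := hb t t⁻¹
      exact ⟨((c⁻¹ : Fˣ) : F) • b t⁻¹, by
        rw [mul_smul_comm, hc, smul_smul, Units.inv_mul, one_smul, mul_inv_cancel, h1]⟩
    · obtain ⟨c, hc⟩ := hb t⁻¹ t
      exact ⟨((c⁻¹ : Fˣ) : F) • b t⁻¹, by
        rw [smul_mul_assoc, hc, smul_smul, Units.inv_mul, one_smul, inv_mul_cancel, h1]⟩
  refine ⟨⟨⟨?_, ?_⟩, ?_⟩, ⟨⟨b 1, 0, b.ne_zero 1⟩⟩, ?_, ?_, ?_, ?_⟩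
  · refine iSupIndep_of_proj
      (fun h => if hh : h ∈ T then (b.coord ⟨h, hh⟩).smulRight (b ⟨h, hh⟩) else 0) ?_ ?_
    · intro h x hx
      by_cases hx0 : x = 0
      · rw [hx0, map_zero]
      obtain ⟨t, rfl, c, -, rfl⟩ := hmem h x hx hx0
      simp
    · intro h h' x hx hne
      by_cases hx0 : x = 0
      · rw [hx0, map_zero]
      obtain ⟨t, rfl, c, -, rfl⟩ := hmem h' x hx hx0
      by_cases hh : h ∈ T
      · have : t ≠ ⟨h, hh⟩ := fun h => hne (congrArg Subtype.val h)
        simp [hh, this]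
      · simp [hh]
  · rw [eq_top_iff, ← b.span_eq, Submodule.span_le]
    rintro _ ⟨t, rfl⟩
    exact Submodule.mem_iSup_of_mem (t : H) (hbA t)
  · intro g h x hx y hy
    by_cases hx0 : x = 0
    · rw [hx0, zero_mul]; exact zero_mem _
    by_cases hy0 : y = 0
    · rw [hy0, mul_zero]; exact zero_mem _
    obtain ⟨s, rfl, c, -, rfl⟩ := hmem g x hx hx0
    obtain ⟨t, rfl, d, -, rfl⟩ := hmem h y hy hy0
    obtain ⟨e, he⟩ := hb s t
    rw [smul_mul_smul_comm, he]
    exact Submodule.smul_mem _ _ (Submodule.smul_mem _ _ (hbA (s * t)))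
  · intro h d hd hd0
    obtain ⟨t, rfl, c, hc, rfl⟩ := hmem h d hd hd0
    exact (hu t).smul (Units.mk0 c hc)
  · intro h
    constructor
    · intro hne
      by_contra hh
      exact hne (hA' h hh)
    · intro hh hne
      have := hbA ⟨h, hh⟩
      rw [hne] at this
      exact b.ne_zero _ ((Submodule.mem_bot F).1 this)
  · intro s t x hx y hy
    rw [hA, Submodule.mem_span_singleton] at hx hy
    obtain ⟨c, rfl⟩ := hx
    obtain ⟨d, rfl⟩ := hy
    rw [smul_mul_smul_comm, smul_mul_smul_comm, hc, smul_smul, smul_smul]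
    congr 1
    ring
  · intro h x hx hx0 y hy
    by_cases hy0 : y = 0
    · exact ⟨0, by rw [hy0, zero_smul]⟩
    obtain ⟨s, rfl, c, hc, rfl⟩ := hmem h x hx hx0
    obtain ⟨t, ht, d, -, rfl⟩ := hmem _ y hy hy0
    obtain rfl : t = s := Subtype.ext ht
    exact ⟨d * c⁻¹, by rw [smul_smul, mul_assoc, inv_mul_cancel₀ hc, mul_one]⟩

variable {T : Subgroup H} {β : T →* T →* Fˣ} {A B : Subgroup T}

theorem stdX_single (a : A) (b c : B) :
    stdX β a b (Finsupp.single c (1 : F)) =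
      Finsupp.single (b * c) (β a (b * c : B) : F) := by
  simp [stdX]

/-- On `e_c` the left side uses `β(a', b'c)` where the product operator has `β(a', bb'c)`; the
quotient `β(a', b)⁻¹` does not depend on `c`. -/
theorem stdX_mul (a a' : A) (b b' : B) :
    stdX β a b * stdX β a' b' = (((β a' b)⁻¹ : Fˣ) : F) • stdX β (a * a') (b * b') := by
  refine Finsupp.lhom_ext' fun c => LinearMap.ext_ring ?_
  simp only [LinearMap.comp_apply, Finsupp.lsingle_apply, Module.End.mul_apply,
    LinearMap.smul_apply, stdX_single]
  rw [← mul_one ((β a' ((b' * c : B) : T) : Fˣ) : F), ← smul_eq_mul (α := F),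
    ← Finsupp.smul_single, map_smul, stdX_single, Finsupp.smul_single, Finsupp.smul_single,
    mul_assoc]
  congr 1
  simp only [smul_eq_mul, ← Units.val_mul]
  congr 1
  simp only [Subgroup.coe_mul, map_mul, MonoidHom.mul_apply]
  generalize β a b = x1; generalize β a b' = x2; generalize β a c = x3
  generalize β a' b = x4; generalize β a' b' = x5; generalize β a' c = x6
  rw [mul_comm x1 x4, mul_assoc x4, inv_mul_cancel_left, mul_mul_mul_comm x2, mul_comm (x5 * x6)]
  simp only [mul_assoc]

theorem stdX_one : stdX β (1 : A) (1 : B) = (1 : StdAlgebra F B) := by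
  refine Finsupp.lhom_ext' fun c => LinearMap.ext_ring ?_
  simp [stdX_single]

/-- Operators with different `b` send a basis vector to different basis vectors. For a fixed `b`,
independence is that of the characters `β(a, ·)` of `B`, which are distinct because `A` is isotropic
and `β` is nondegenerate. -/
theorem linearIndependent_of_single [Finite T] (hd : IsStandardDecomposition β A B)
    (hnd : ∀ s, (∀ t, β s t = 1) → s = 1) (v : A × B → StdAlgebra F B)
    (hv : ∀ ab (c : B), v ab (Finsupp.single c (1 : F)) =
      Finsupp.single (ab.2 * c) (β ab.1 (ab.2 * c : B) : F)) : LinearIndependent F v := by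
  classical
  have := Fintype.ofFinite A
  have := Fintype.ofFinite B
  let f : A → B →* Fˣ := fun a => (β a).comp B.subtype
  have hf : Function.Injective f := by
    intro a a' h
    have h1 : (a : T) * (a' : T)⁻¹ = 1 := by
      apply hnd
      intro t
      obtain ⟨p, hp, q, hq, rfl⟩ := exists_mul_of_isCompl hd.1 t
      have h2 : β a q = β a' q := DFunLike.congr_fun h ⟨q, hq⟩
      simp only [map_mul, map_inv, MonoidHom.mul_apply, MonoidHom.inv_apply, h2,
        hd.2.1 _ a.2 p hp, hd.2.1 _ a'.2 p hp]
      simp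
    exact Subtype.ext (mul_inv_eq_one.1 h1)
  have hli := Fintype.linearIndependent_iff.1 (linearIndependent_character f hf)
  refine (Fintype.linearIndependent_iff (M := StdAlgebra F B)).2 ?_
  rintro g hg ⟨a, b⟩
  refine hli (fun a => g (a, b)) ?_ a
  funext c
  -- The coefficient at `e_c` of the image of `e_{b⁻¹c}` only sees the operators with this `b`.
  have h1 := congrArg (fun x : B →₀ F => x c) (LinearMap.congr_fun hg (Finsupp.single (b⁻¹ * c) 1))
  simp only [LinearMap.sum_apply, LinearMap.smul_apply, hv, Fintype.sum_prod_type,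
    Finsupp.finsetSum_apply, Finsupp.smul_apply, Finsupp.single_apply, LinearMap.zero_apply,
    Finsupp.zero_apply, Finset.sum_apply, Pi.smul_apply, Pi.zero_apply] at h1 ⊢
  rw [← h1]
  refine Finset.sum_congr rfl fun a' _ => ?_
  rw [Finset.sum_eq_single b]
  · simp [f]
  · intro b' _ hb'
    rw [if_neg, smul_zero]
    intro he
    apply hb'
    rwa [← mul_assoc, mul_eq_right, mul_inv_eq_one] at he
  · simp

/-- Nondegeneracy and isotropy of `B` embed `B` in the character group of `A`. -/
theorem card_le_of_decomposition [Finite T] (hd : IsStandardDecomposition β A B)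
    (hnd : ∀ s, (∀ t, β t s = 1) → s = 1) : Nat.card B ≤ Nat.card A := by
  have := finite_character (F := F) (T := A)
  refine le_trans ?_ (card_character_le (F := F) (T := A))
  refine Nat.card_le_card_of_injective
    (fun b : B => ((MonoidHom.flip β) b).comp A.subtype) ?_
  intro b b' h
  have h1 : (b : T) * (b' : T)⁻¹ = 1 := by
    apply hnd
    intro t
    obtain ⟨p, hp, q, hq, rfl⟩ := exists_mul_of_isCompl hd.1 t
    have h2 : β p b = β p b' := DFunLike.congr_fun h ⟨p, hp⟩
    simp only [map_mul, map_inv, MonoidHom.mul_apply, h2,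
      hd.2.2 q hq _ b.2, hd.2.2 q hq _ b'.2]
    simp
  exact Subtype.ext (mul_inv_eq_one.1 h1)

theorem finrank_stdAlgebra [Finite T] :
    Module.finrank F (StdAlgebra F B) = Nat.card B * Nat.card B := by
  have := Fintype.ofFinite B
  rw [Nat.card_eq_fintype_card]
  exact (Module.finrank_linearMap F F (B →₀ F) (B →₀ F)).trans
    (by rw [Module.finrank_finsupp_self])

theorem exists_basis_of_isCompl [Finite T] {D : Type*} [Ring D] [Algebra F D]
    (h : IsCompl A B) {v : A × B → D} (hli : LinearIndependent F v)
    (hc : Nat.card (A × B) = Module.finrank F D) :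
    ∃ b : Module.Basis T F D, ∀ (p : A) (q : B), b ((p : T) * q) = v (p, q) := by
  have := Fintype.ofFinite A
  have := Fintype.ofFinite B
  rw [Nat.card_eq_fintype_card] at hc
  let e : A × B ≃ T := Equiv.ofBijective (fun ab => (ab.1 : T) * ab.2) ⟨by
    rintro ⟨a, b⟩ ⟨a', b'⟩ he
    obtain ⟨h1, h2⟩ := mul_inj_of_isCompl h a.2 a'.2 b.2 b'.2 he
    exact Prod.ext (Subtype.ext h1) (Subtype.ext h2), fun t => by
    obtain ⟨p, hp, q, hq, he⟩ := exists_mul_of_isCompl h t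
    exact ⟨(⟨p, hp⟩, ⟨q, hq⟩), he⟩⟩
  have he : ∀ a b, e (a, b) = (a : T) * b := fun _ _ => rfl
  refine ⟨(basisOfLinearIndependentOfCardEqFinrank hli hc).reindex e, fun p q => ?_⟩
  rw [← he, Module.Basis.reindex_apply, Equiv.symm_apply_apply,
    coe_basisOfLinearIndependentOfCardEqFinrank]

/-- Independence of the operators gives `|A||B| ≤ |B|²`, and `|B| ≤ |A|` gives the reverse
inequality. -/
theorem card_prod_eq_finrank [Finite T] (hβ : ∀ t, β t t = 1)
    (hd : IsStandardDecomposition β A B) (hnd : ∀ s, (∀ t, β s t = 1) → s = 1) :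
    Nat.card (A × B) = Module.finrank F (StdAlgebra F B) := by
  have := Fintype.ofFinite A
  have := Fintype.ofFinite B
  have hli := linearIndependent_of_single hd hnd (fun ab => stdX β ab.1 ab.2)
    (fun ab c => stdX_single ab.1 ab.2 c)
  refine le_antisymm ?_ ?_
  · rw [Nat.card_eq_fintype_card]
    exact LinearIndependent.fintype_card_le_finrank (M := StdAlgebra F B) hli
  · rw [Nat.card_prod, finrank_stdAlgebra]
    exact Nat.mul_le_mul_right _ (card_le_of_decomposition hd fun s h => hnd s fun t => by
      rw [alternating_swap hβ, h, inv_one])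

theorem exists_stdX_basis [Finite T] (hβ : ∀ t, β t t = 1)
    (hnd : ∀ s, (∀ t, β s t = 1) → s = 1) (hd : IsStandardDecomposition β A B) :
    ∃ b : Module.Basis T F (StdAlgebra F B), ∀ (p : A) (q : B), b ((p : T) * q) = stdX β p q := by
  have hli := linearIndependent_of_single (F := F) hd hnd (fun ab => stdX β ab.1 ab.2)
    (fun ab c => stdX_single ab.1 ab.2 c)
  exact exists_basis_of_isCompl (D := StdAlgebra F B)
    (v := fun ab => stdX β ab.1 ab.2) hd.1 hli (card_prod_eq_finrank hβ hd hnd)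

/-- The standard realization of the graded division algebra with support `T` and commutation
factor `β`. -/
theorem isTwisted_std [Finite T] (hβ : ∀ t, β t t = 1) (hnd : ∀ s, (∀ t, β s t = 1) → s = 1)
    (hd : IsStandardDecomposition β A B) :
    IsTwisted (D := StdAlgebra F B) β (stdComponent β A B) := by
  have hsw := alternating_swap hβ
  obtain ⟨b₁, hb⟩ := exists_stdX_basis (F := F) hβ hnd hd
  have hx : ∀ t : T, ∃ (a : A) (b : B), (a : T) * b = t := fun t => by
    obtain ⟨p, hp, q, hq, h⟩ := exists_mul_of_isCompl hd.1 t
    exact ⟨⟨p, hp⟩, ⟨q, hq⟩, h⟩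
  refine isTwisted_of_basis b₁ ?_ ?_ ?_ ?_ ?_
  · intro t
    obtain ⟨a, b, rfl⟩ := hx t
    rw [hb, stdComponent]
    congr 1
    ext x
    simp only [Set.mem_ofPred_eq, Set.mem_singleton_iff]
    constructor
    · rintro ⟨a', b', h, rfl⟩
      obtain ⟨h1, h2⟩ := mul_inj_of_isCompl hd.1 a'.2 a.2 b'.2 b.2 (Subtype.ext h)
      rw [Subtype.ext h1, Subtype.ext h2]
    · rintro rfl
      exact ⟨a, b, rfl, rfl⟩
  · intro h hh
    rw [stdComponent, Submodule.span_eq_bot]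
    rintro x ⟨a, b, rfl, -⟩
    exact absurd (Subtype.coe_prop _) hh
  · rw [← stdX_one (β := β) (A := A), ← hb 1 1]; simp
  · intro s t
    obtain ⟨a, b, rfl⟩ := hx s
    obtain ⟨a', b', rfl⟩ := hx t
    refine ⟨(β a' b)⁻¹, ?_⟩
    rw [mul_mul_mul_comm, ← Subgroup.coe_mul, ← Subgroup.coe_mul, hb, hb, hb, stdX_mul]
  · intro s t
    obtain ⟨a, b, rfl⟩ := hx s
    obtain ⟨a', b', rfl⟩ := hx t
    rw [hb, hb, stdX_mul, stdX_mul, smul_smul, mul_comm a', mul_comm b']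
    congr 1
    rw [← Units.val_mul]
    congr 1
    simp only [map_mul, MonoidHom.mul_apply, hd.2.1 _ a.2 _ a'.2, hd.2.2 _ b.2 _ b'.2, one_mul,
      mul_one, hsw (b : T) a']
    rw [mul_assoc, mul_inv_cancel, mul_one]

end StandardRealization

/-! ### The isomorphism problem for graded endomorphism algebras -/

section Classification

variable {F : Type*} [Field F] {H : Type*} [CommGroup H]
variable {D : Type*} [Ring D] [Algebra F D] {D' : Type*} [Ring D'] [Algebra F D']
variable {T T' : Subgroup H} {β : T →* T →* Fˣ} {β' : T' →* T' →* Fˣ}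
variable {A : H → Submodule F D} {A' : H → Submodule F D'} {k k' : ℕ}

/-- Changing the shifts modulo the support and permuting them, up to a common factor, does not
change the isomorphism class. -/
theorem gradedIso_shift (hA : IsTwisted β A) (γ : Fin k → H) (γ' : Fin k' → H)
    (σ : Fin k' ≃ Fin k) (c : H) (hσ : ∀ j, c * (γ' j)⁻¹ * γ (σ j) ∈ T) :
    GradedIso (endComponent D (shiftComponent A γ)) (endComponent D (shiftComponent A γ')) := by
  -- Left multiplication by an invertible homogeneous element is right linear and absorbs the
  -- difference of shifts lying in `T`.
  choose X hX hX0 using fun j => hA.exists_ne_zero ⟨_, hσ j⟩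
  choose Y hY hXY hYX using fun j =>
    hA.grading.exists_inv (hX j) (hA.isUnit _ _ (hX j) (hX0 j))
  let f₀ : (Fin k → D) →ₗ[F] (Fin k' → D) :=
    LinearMap.pi fun j => LinearMap.mulLeft F (X j) ∘ₗ LinearMap.proj (σ j)
  have hf₀ : ∀ x j, f₀ x j = X j * x (σ j) := fun _ _ => rfl
  have hbij : Function.Bijective f₀ := by
    refine ⟨fun x y hxy => ?_, fun y => ⟨fun i => Y (σ.symm i) * y (σ.symm i), ?_⟩⟩
    · funext i
      obtain ⟨j, rfl⟩ := σ.surjective i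
      have h1 := congrFun hxy j
      rw [hf₀, hf₀] at h1
      have h2 := congrArg (Y j * ·) h1
      simpa only [← mul_assoc, hYX, one_mul] using h2
    · funext j
      rw [hf₀, Equiv.symm_apply_apply, ← mul_assoc, hXY, one_mul]
  have hsmul : ∀ (d : D) x, f₀ (op d • x) = op d • f₀ x := by
    intro d x
    funext j
    simp [hf₀, mul_assoc]
  refine gradedIso_endComponent (LinearEquiv.ofBijective f₀ hbij) (fun d => ⟨d, hsmul d⟩)
    (fun d => ⟨d, hsmul d⟩) c fun h x => ?_
  change _ ↔ f₀ x ∈ _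
  rw [mem_shiftComponent, mem_shiftComponent]
  constructor
  · intro hx j
    rw [hf₀]
    have := hA.grading.2 _ _ _ (hX j) _ (hx (σ j))
    have he : c * (γ' j)⁻¹ * γ (σ j) * (h * (γ (σ j))⁻¹) = h * c * (γ' j)⁻¹ := by
      rw [mul_comm h (γ (σ j))⁻¹, mul_assoc, mul_inv_cancel_left, mul_comm, mul_assoc]
    exact he ▸ this
  · intro hx i
    obtain ⟨j, rfl⟩ := σ.surjective i
    have h1 := hx j
    rw [hf₀] at h1
    have := hA.grading.2 _ _ _ (hY j) _ h1
    rw [← mul_assoc (Y j), hYX, one_mul] at this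
    have he : (c * (γ' j)⁻¹ * γ (σ j))⁻¹ * (h * c * (γ' j)⁻¹) = h * (γ (σ j))⁻¹ := by
      rw [inv_mul_eq_iff_eq_mul, mul_comm h (γ (σ j))⁻¹, mul_assoc (c * (γ' j)⁻¹),
        mul_inv_cancel_left, mul_comm _ h, mul_assoc]
    exact he ▸ this

theorem gradedIso_endComponent_of_gradedIso (h : GradedIso A A') (γ : Fin k → H) :
    GradedIso (endComponent D (shiftComponent A γ)) (endComponent D' (shiftComponent A' γ)) := by
  obtain ⟨θ, hθ⟩ := h
  have hmem : ∀ h d, d ∈ A h ↔ θ d ∈ A' h := by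
    intro h d
    rw [← hθ h]
    constructor
    · exact fun hd => ⟨d, hd, rfl⟩
    · rintro ⟨e, he, h⟩
      rwa [← θ.injective h]
  have hs : ∀ (d : D) (x : Fin k → D), LinearEquiv.piCongrRight (fun _ => θ.toLinearEquiv)
      (op d • x) = op (θ d) • LinearEquiv.piCongrRight (fun _ => θ.toLinearEquiv) x := by
    intro d x
    funext i
    simp
  refine gradedIso_endComponent (LinearEquiv.piCongrRight fun _ => θ.toLinearEquiv)
    (fun d => ⟨θ d, hs d⟩) (fun d' => ⟨θ.symm d', fun x => by
      rw [hs, AlgEquiv.apply_symm_apply]⟩) 1 fun h x => ?_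
  rw [mem_shiftComponent, mem_shiftComponent, mul_one]
  exact forall_congr' fun i => hmem _ _

/-- Sending the `i`-th basis vector to `x` and the other ones to zero. -/
def sendTo (i : Fin k) (x : Fin k → D) : Module.End Dᵐᵒᵖ (Fin k → D) where
  toFun y := op (y i) • x
  map_add' y z := by rw [Pi.add_apply, op_add, add_smul]
  map_smul' d y := by
    funext l
    simp [mul_assoc]

theorem sendTo_apply (i : Fin k) (x y : Fin k → D) : sendTo i x y = op (y i) • x := rfl

theorem sendTo_single (i : Fin k) (x : Fin k → D) : sendTo i x (Pi.single i 1) = x := by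
  rw [sendTo_apply, Pi.single_eq_same, op_one, one_smul]

theorem mul_sendTo (i : Fin k) (x : Fin k → D) (r : Module.End Dᵐᵒᵖ (Fin k → D)) :
    r * sendTo i x = sendTo i (r x) := by
  refine LinearMap.ext fun y => ?_
  rw [Module.End.mul_apply, sendTo_apply, sendTo_apply, map_smul]

theorem sendTo_mem (hA : IsAlgebraGrading A) (γ : Fin k → H) (i : Fin k) {h : H} {x : Fin k → D}
    (hx : x ∈ shiftComponent A γ h) :
    sendTo i x ∈ endComponent D (shiftComponent A γ) (h * (γ i)⁻¹) := by
  intro g y hy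
  rw [sendTo_apply]
  have := (isGradedRightModule_shift hA γ).2 _ _ _ hx _ (mem_shiftComponent.1 hy i)
  have he : h * (g * (γ i)⁻¹) = h * (γ i)⁻¹ * g := by rw [mul_comm g, mul_assoc]
  exact he ▸ this

/-- A map that shifts degrees commutes with the projections; hence its kernel is graded and, if it
is injective, preimages of homogeneous vectors are homogeneous. -/
theorem proj_comm {M M' : Type*} [AddCommGroup M] [Module F M] [AddCommGroup M'] [Module F M']
    {V : H → Submodule F M} {V' : H → Submodule F M'} (hV : IsVectorGrading V)
    {π : H → M →ₗ[F] M} (p1 : ∀ h, ∀ x ∈ V h, π h x = x)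
    (p2 : ∀ h h', ∀ x ∈ V h', h' ≠ h → π h x = 0)
    {π' : H → M' →ₗ[F] M'} (p1' : ∀ h, ∀ x ∈ V' h, π' h x = x)
    (p2' : ∀ h h', ∀ x ∈ V' h', h' ≠ h → π' h x = 0)
    {f : M →ₗ[F] M'} {c : H} (hf : ∀ h, ∀ x ∈ V h, f x ∈ V' (h * c)) (h : H) (x : M) :
    π' (h * c) (f x) = f (π h x) := by
  refine hV.induction (p := fun x => π' (h * c) (f x) = f (π h x)) ?_ (by simp) ?_ x
  · intro g x hx
    by_cases hg : g = h
    · subst hg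
      rw [p1 _ _ hx, p1' _ _ (hf _ _ hx)]
    · rw [p2 _ _ _ hx hg, p2' _ _ _ (hf _ _ hx) (by simpa using hg), map_zero]
  · intro x y hx hy
    simp only [map_add, hx, hy]

/-- An isomorphism of graded endomorphism algebras yields an embedding of the modules. -/
theorem exists_injective_of_gradedIso (hA : IsTwisted β A) (hA' : IsTwisted β' A') (hk : 0 < k)
    (γ : Fin k → H) (γ' : Fin k' → H)
    (ψ : Module.End Dᵐᵒᵖ (Fin k → D) ≃ₐ[F] Module.End D'ᵐᵒᵖ (Fin k' → D'))
    (hψ : ∀ h, ∀ r ∈ endComponent D (shiftComponent A γ) h,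
      ψ r ∈ endComponent D' (shiftComponent A' γ') h) :
    ∃ (c : H) (f : (Fin k → D) →ₗ[F] (Fin k' → D')), Function.Injective f ∧
      (∀ r x, f (r x) = ψ r (f x)) ∧
      ∀ h, ∀ x ∈ shiftComponent A γ h, f x ∈ shiftComponent A' γ' (h * c) := by
  have hV := isGradedRightModule_shift hA.grading γ
  have hV' := isGradedRightModule_shift hA'.grading γ'
  obtain ⟨π, p0, p1, p2, p3⟩ := hV.1.exists_proj
  obtain ⟨π', p0', p1', p2', p3'⟩ := hV'.1.exists_proj
  have := hA.nontrivial
  let i₀ : Fin k := ⟨0, hk⟩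
  let e₁ : Fin k → D := Pi.single i₀ 1
  have he₁ : e₁ ≠ 0 := by
    intro h
    have := congrFun h i₀
    simp [e₁] at this
  have hψe : (ψ (sendTo i₀ e₁)).restrictScalars F ≠ 0 := by
    intro h
    have h1 : ψ (sendTo i₀ e₁) = 0 := by
      refine LinearMap.ext fun y => ?_
      exact LinearMap.congr_fun h y
    rw [map_eq_zero_iff ψ ψ.injective] at h1
    apply he₁
    rw [← sendTo_single i₀ e₁, h1, LinearMap.zero_apply]
  -- The maps `sendTo i₀ x` form a left ideal that is a copy of the module. Transporting it by `ψ`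
  -- and evaluating at a homogeneous `w` not killed by the idempotent `sendTo i₀ e₁` gives an
  -- intertwining map.
  obtain ⟨g', w, hw, hw0⟩ := hV'.1.exists_ne_zero hψe
  change ψ (sendTo i₀ e₁) w ≠ 0 at hw0
  let f : (Fin k → D) →ₗ[F] (Fin k' → D') :=
    { toFun := fun x => ψ (sendTo i₀ x) w
      map_add' := fun x y => by
        have : sendTo i₀ (x + y) = sendTo i₀ x + sendTo i₀ y := by
          refine LinearMap.ext fun z => ?_
          simp only [sendTo_apply, smul_add, LinearMap.add_apply]
        rw [this, map_add, LinearMap.add_apply]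
      map_smul' := fun c x => by
        have : sendTo i₀ (c • x) = c • sendTo i₀ x := by
          refine LinearMap.ext fun z => ?_
          simp only [sendTo_apply, LinearMap.smul_apply, smul_comm c]
        rw [this, map_smul, LinearMap.smul_apply, RingHom.id_apply] }
  have hf : ∀ x, f x = ψ (sendTo i₀ x) w := fun _ => rfl
  have hfr : ∀ r x, f (r x) = ψ r (f x) := by
    intro r x
    rw [hf, hf, ← mul_sendTo, map_mul, Module.End.mul_apply]
  have hfd : ∀ h, ∀ x ∈ shiftComponent A γ h,
      f x ∈ shiftComponent A' γ' (h * ((γ i₀)⁻¹ * g')) := by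
    intro h x hx
    have := hψ _ _ (sendTo_mem hA.grading γ i₀ hx) _ _ hw
    rwa [mul_assoc] at this
  refine ⟨(γ i₀)⁻¹ * g', f, (injective_iff_map_eq_zero f).2 fun x hx => p3 x fun h => ?_, hfr,
    hfd⟩
  -- A nonzero homogeneous vector in the kernel has an invertible coordinate, so an elementary
  -- endomorphism carries it to `e₁`. Then `f e₁ = 0`, contrary to the choice of `w`.
  have h1 := proj_comm hV.1 p1 p2 p1' p2' hfd h x
  rw [hx, map_zero] at h1
  by_contra hne
  obtain ⟨i, hi⟩ := Function.ne_iff.1 hne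
  have hmem := mem_shiftComponent.1 (p0 h x) i
  obtain ⟨y, -, -, hy⟩ := hA.grading.exists_inv hmem (hA.isUnit _ _ hmem hi)
  have h2 := hfr (elementary i₀ i y) (π h x)
  rw [← h1, map_zero, elementary_apply, hy] at h2
  exact hw0 h2

/-- Isomorphic graded endomorphism algebras come from modules that are isomorphic up to a shift,
compatibly with the algebra isomorphism. -/
theorem exists_equiv_of_gradedIso [FiniteDimensional F D] [FiniteDimensional F D']
    (hA : IsTwisted β A) (hA' : IsTwisted β' A') (hk : 0 < k) (hk' : 0 < k')
    (γ : Fin k → H) (γ' : Fin k' → H)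
    (ψ : Module.End Dᵐᵒᵖ (Fin k → D) ≃ₐ[F] Module.End D'ᵐᵒᵖ (Fin k' → D'))
    (hψ : ∀ h, (endComponent D (shiftComponent A γ) h).map ψ.toLinearMap =
      endComponent D' (shiftComponent A' γ') h) :
    ∃ (c : H) (f : (Fin k → D) ≃ₗ[F] (Fin k' → D')),
      (∀ r x, f (r x) = ψ r (f x)) ∧
      ∀ h x, x ∈ shiftComponent A γ h ↔ f x ∈ shiftComponent A' γ' (h * c) := by
  have hV := isGradedRightModule_shift hA.grading γ
  have hV' := isGradedRightModule_shift hA'.grading γ'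
  obtain ⟨π, p0, p1, p2, p3⟩ := hV.1.exists_proj
  obtain ⟨π', p0', p1', p2', p3'⟩ := hV'.1.exists_proj
  obtain ⟨c, f, hf, hfr, hfd⟩ := exists_injective_of_gradedIso hA hA' hk γ γ' ψ
    (fun h r hr => hψ h ▸ ⟨r, hr, rfl⟩)
  -- The map built from the inverse isomorphism serves only to compare dimensions.
  obtain ⟨-, f', hf', -, -⟩ := exists_injective_of_gradedIso hA' hA hk' γ' γ ψ.symm
    (fun h r hr => map_symm_of_map ψ (hψ h) ▸ ⟨r, hr, rfl⟩)
  have hdim := le_antisymm (LinearMap.finrank_le_finrank_of_injective hf)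
    (LinearMap.finrank_le_finrank_of_injective hf')
  refine ⟨c, f.linearEquivOfInjective hf hdim, hfr, fun h x => ⟨hfd h x, fun hx => ?_⟩⟩
  change f x ∈ _ at hx
  have h1 := proj_comm hV.1 p1 p2 p1' p2' hfd h x
  rw [p1' _ _ hx] at h1
  rw [hf h1]
  exact p0 _ _

/-- A semilinear relation between the actions of homogeneous elements. -/
theorem exists_action_of_equiv (hA : IsTwisted β A) (hk : 0 < k) (hk' : 0 < k')
    (hA' : IsTwisted β' A') (γ : Fin k → H) (γ' : Fin k' → H)
    (ψ : Module.End Dᵐᵒᵖ (Fin k → D) ≃ₐ[F] Module.End D'ᵐᵒᵖ (Fin k' → D'))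
    {c : H} (f : (Fin k → D) ≃ₗ[F] (Fin k' → D')) (hfr : ∀ r x, f (r x) = ψ r (f x))
    (hfd : ∀ h x, x ∈ shiftComponent A γ h ↔ f x ∈ shiftComponent A' γ' (h * c))
    {t : H} {d : D} (hd : d ∈ A t) (hd0 : d ≠ 0) :
    ∃ d' ∈ A' t, d' ≠ 0 ∧ ∀ x, f (op d • x) = op d' • f x := by
  let j₀ : Fin k' := ⟨0, hk'⟩
  let e₁ : Fin k' → D' := Pi.single j₀ 1
  -- The transported action of `d` commutes with all endomorphisms of the target. Since `sendTo j₀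
  -- (f x)` takes `e₁` to `f x`, this action is determined at `e₁` and is right multiplication by
  -- the coordinate `j₀` of its value there.
  have hact : ∀ x, f (op d • x) = op (f (op d • f.symm e₁) j₀) • f x := by
    intro x
    have h1 : ψ (ψ.symm (sendTo j₀ (f x))) e₁ = f x := by
      rw [AlgEquiv.apply_symm_apply, sendTo_single]
    have h2 : ψ.symm (sendTo j₀ (f x)) (f.symm e₁) = x := by
      apply f.injective
      rw [hfr, LinearEquiv.apply_symm_apply, h1]
    conv_lhs => rw [← h2]
    rw [← map_smul, hfr, AlgEquiv.apply_symm_apply, sendTo_apply]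
  refine ⟨f (op d • f.symm e₁) j₀, ?_, ?_, hact⟩
  · have h1 : e₁ ∈ shiftComponent A' γ' (γ' j₀) :=
      single_mem_shiftComponent (by rw [mul_inv_cancel]; exact hA'.grading.one_mem)
    have h2 : f.symm e₁ ∈ shiftComponent A γ (γ' j₀ * c⁻¹) := by
      rw [hfd, LinearEquiv.apply_symm_apply, inv_mul_cancel_right]
      exact h1
    have h3 := (hfd _ _).1 ((isGradedRightModule_shift hA.grading γ).2 _ _ _ h2 _ hd)
    have h4 := mem_shiftComponent.1 h3 j₀
    have he : γ' j₀ * c⁻¹ * t * c * (γ' j₀)⁻¹ = t := by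
      rw [mul_right_comm (γ' j₀ * c⁻¹), inv_mul_cancel_right, mul_comm (γ' j₀),
        mul_inv_cancel_right]
    rwa [he] at h4
  · intro h0
    have h1 := hact (Pi.single ⟨0, hk⟩ 1)
    rw [h0, op_zero, zero_smul, map_eq_zero_iff f f.injective] at h1
    have h2 := congrFun h1 ⟨0, hk⟩
    simp at h2
    exact hd0 h2

theorem finrank_component (hA : IsTwisted β A) (h : H) [Decidable (h ∈ T)] :
    Module.finrank F (A h) = if h ∈ T then 1 else 0 := by
  split_ifs with hh
  · obtain ⟨x, hx, hx0⟩ := hA.exists_ne_zero ⟨h, hh⟩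
    refine finrank_eq_one (⟨x, hx⟩ : A h) (fun h => hx0 (congrArg Subtype.val h)) fun y => ?_
    obtain ⟨c, hc⟩ := hA.one_dim h x hx hx0 y y.2
    exact ⟨c, Subtype.ext hc.symm⟩
  · rw [not_not.1 (mt (hA.ne_bot h).1 hh), finrank_bot]

open Classical in
theorem finrank_shiftComponent [FiniteDimensional F D] (hA : IsTwisted β A) (γ : Fin k → H)
    (h : H) : Module.finrank F (shiftComponent A γ h) =
      (Finset.univ.filter fun i => h * (γ i)⁻¹ ∈ T).card := by
  let e : shiftComponent A γ h ≃ₗ[F] (∀ i, A (h * (γ i)⁻¹)) :=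
    { toFun := fun x i => ⟨x.1 i, mem_shiftComponent.1 x.2 i⟩
      invFun := fun x => ⟨fun i => x i, mem_shiftComponent.2 fun i => (x i).2⟩
      map_add' := fun x y => rfl
      map_smul' := fun c x => rfl
      left_inv := fun x => rfl
      right_inv := fun x => rfl }
  rw [e.finrank_eq, Module.finrank_pi_fintype, Finset.card_filter]
  exact Finset.sum_congr rfl fun i _ => finrank_component hA _

open Classical in
/-- The invariants of a graded endomorphism algebra: the support, the commutation factor and, up
to a shift, the multiplicities of the cosets. -/
theorem invariants_of_gradedIso [FiniteDimensional F D] [FiniteDimensional F D']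
    (hA : IsTwisted β A) (hA' : IsTwisted β' A') (hk : 0 < k) (hk' : 0 < k')
    (γ : Fin k → H) (γ' : Fin k' → H)
    (hiso : GradedIso (endComponent D (shiftComponent A γ))
      (endComponent D' (shiftComponent A' γ'))) :
    (∀ t, t ∈ T ↔ t ∈ T') ∧
      (∀ s t (hs : s ∈ T) (ht : t ∈ T) (hs' : s ∈ T') (ht' : t ∈ T'),
        β ⟨s, hs⟩ ⟨t, ht⟩ = β' ⟨s, hs'⟩ ⟨t, ht'⟩) ∧
      ∃ c : H, ∀ h, (Finset.univ.filter fun i => h * (γ i)⁻¹ ∈ T).card =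
        (Finset.univ.filter fun j => h * c * (γ' j)⁻¹ ∈ T').card := by
  obtain ⟨ψ, hψ⟩ := hiso
  obtain ⟨c, f, hfr, hfd⟩ := exists_equiv_of_gradedIso hA hA' hk hk' γ γ' ψ hψ
  have hact := fun (t : H) (d : D) (hd : d ∈ A t) (hd0 : d ≠ 0) =>
    exists_action_of_equiv hA hk hk' hA' γ γ' ψ f hfr hfd hd hd0
  refine ⟨fun t => ⟨fun ht => ?_, fun ht => ?_⟩, fun s t hs ht hs' ht' => ?_, c, fun h => ?_⟩
  · obtain ⟨d, hd, hd0⟩ := hA.exists_ne_zero ⟨t, ht⟩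
    obtain ⟨d', hd', hd0', -⟩ := hact t d hd hd0
    exact hA'.mem_support hd' hd0'
  · obtain ⟨d, hd, hd0⟩ := hA'.exists_ne_zero ⟨t, ht⟩
    obtain ⟨d', hd', hd0', -⟩ := exists_action_of_equiv hA' hk' hk hA γ' γ ψ.symm (c := c⁻¹) f.symm
      (fun r x => by
        apply f.injective
        rw [hfr, LinearEquiv.apply_symm_apply, LinearEquiv.apply_symm_apply,
          AlgEquiv.apply_symm_apply])
      (fun h x => by rw [hfd, LinearEquiv.apply_symm_apply, inv_mul_cancel_right]) hd hd0
    exact hA.mem_support hd' hd0'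
  · obtain ⟨x, hx, hx0⟩ := hA.exists_ne_zero ⟨s, hs⟩
    obtain ⟨y, hy, hy0⟩ := hA.exists_ne_zero ⟨t, ht⟩
    obtain ⟨x', hx', hx0', hxx⟩ := hact s x hx hx0
    obtain ⟨y', hy', hy0', hyy⟩ := hact t y hy hy0
    -- Right actions compose in the same order on both sides, so `f` carries the commutation
    -- relation of `x` and `y` to that of `x'` and `y'`.
    have h1 : x' * y' = (β ⟨s, hs⟩ ⟨t, ht⟩ : F) • (y' * x') := by
      obtain ⟨z, hz⟩ := f.surjective (Pi.single ⟨0, hk'⟩ 1)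
      have h2 : f (op (x * y) • z) = op (x' * y') • f z := by
        rw [op_mul, mul_smul, hyy, hxx, ← mul_smul, ← op_mul]
      have h3 : f (op (y * x) • z) = op (y' * x') • f z := by
        rw [op_mul, mul_smul, hxx, hyy, ← mul_smul, ← op_mul]
      rw [hA.comm ⟨s, hs⟩ ⟨t, ht⟩ x hx y hy, op_smul, smul_assoc, map_smul, h3, hz] at h2
      have h4 := congrFun h2 ⟨0, hk'⟩
      simp at h4
      exact h4.symm
    rw [hA'.comm ⟨s, hs'⟩ ⟨t, ht'⟩ x' hx' y' hy'] at h1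
    exact (Units.ext (smul_left_injective F (hA'.mul_ne hy' hy0' hx' hx0') h1)).symm
  · rw [← finrank_shiftComponent hA, ← finrank_shiftComponent hA']
    have : shiftComponent A' γ' (h * c) = (shiftComponent A γ h).map f.toLinearMap := by
      ext y
      obtain ⟨x, rfl⟩ := f.surjective y
      rw [← hfd]
      simp
    rw [this]
    exact (LinearEquiv.finrank_map_eq f _).symm

end Classification

/-! ### The parameters -/

section Descent

variable {N Q M : Type*} [CommGroup N] [CommGroup Q] [CommGroup M]

theorem exists_descend {pr : N →* Q} (hpr : Function.Surjective pr) (f : N →* M)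
    (hf : ∀ s, pr s = 1 → f s = 1) : ∃ g : Q →* M, ∀ s, g (pr s) = f s := by
  have key : ∀ s s', pr s = pr s' → f s = f s' := by
    intro s s' h
    have h1 := hf (s * s'⁻¹) (by rw [map_mul, map_inv, h, mul_inv_cancel])
    rw [map_mul, map_inv] at h1
    exact mul_inv_eq_one.1 h1
  choose σ hσ using hpr
  refine ⟨MonoidHom.mk' (fun q => f (σ q)) fun q q' => ?_, fun s => key _ _ (hσ _)⟩
  rw [← map_mul]
  exact key _ _ (by rw [map_mul, hσ, hσ, hσ])

theorem exists_descend₂ {pr : N →* Q} (hpr : Function.Surjective pr) (f : N →* N →* M)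
    (hl : ∀ s, pr s = 1 → ∀ t, f s t = 1) (hr : ∀ t, pr t = 1 → ∀ s, f s t = 1) :
    ∃ g : Q →* Q →* M, ∀ s t, g (pr s) (pr t) = f s t := by
  choose g hg using fun s => exists_descend hpr (f s) fun t ht => hr t ht s
  have hgm : ∀ s s', g (s * s') = g s * g s' := by
    intro s s'
    refine MonoidHom.ext fun q => ?_
    obtain ⟨t, rfl⟩ := hpr q
    rw [MonoidHom.mul_apply, hg, hg, hg, map_mul, MonoidHom.mul_apply]
  obtain ⟨k, hk⟩ := exists_descend hpr (MonoidHom.mk' g hgm) fun s hs => by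
    refine MonoidHom.ext fun q => ?_
    obtain ⟨t, rfl⟩ := hpr q
    exact (hg s t).trans (hl s hs t)
  exact ⟨k, fun s t => by rw [hk]; exact hg s t⟩

end Descent

theorem mem_zpowers_of_orderOf_eq_two {G : Type*} [Group G] {t x : G} (ht : orderOf t = 2) :
    x ∈ zpowers t ↔ x = 1 ∨ x = t := by
  constructor
  · intro hx
    have hfin : IsOfFinOrder t := by
      rw [← orderOf_pos_iff, ht]; exact two_pos
    obtain ⟨n, hn⟩ := hfin.mem_powers_iff_mem_zpowers.2 hx
    simp only at hn
    rw [← pow_mod_orderOf, ht] at hn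
    rcases Nat.mod_two_eq_zero_or_one n with h | h
    · left; rw [← hn, h, pow_zero]
    · right; rw [← hn, h, pow_one]
  · rintro (rfl | rfl)
    · exact one_mem _
    · exact mem_zpowers _

section Parameters

variable {F : Type u} [Field F] {G : Type v} [CommGroup G]

theorem neg_one_ne_one_of_ringChar (hF : ringChar F ≠ 2) : (-1 : Fˣ) ≠ 1 := by
  intro h
  have h1 : (-1 : F) = 1 := by simpa using congrArg Units.val h
  exact Ring.neg_one_ne_one_of_char_ne_two hF h1

theorem units_sq_eq_one {x : Fˣ} (h : x ^ 2 = 1) : x = 1 ∨ x = -1 := by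
  have h1 : (x : F) ^ 2 = 1 := by rw [← Units.val_pow_eq_pow_val, h, Units.val_one]
  rcases mul_self_eq_one_iff.1 (pow_two (x : F) ▸ h1) with h | h
  · exact Or.inl (Units.ext h)
  · exact Or.inr (Units.ext (by simpa using h))

namespace EvenData

variable (c : EvenData F G)

/-- The element `t₀` of `T⁺`. -/
def τ : c.Tplus := ⟨c.t₀, by
  change QuotientGroup.mk' _ c.t₀ ∈ c.Tbar
  rw [(QuotientGroup.eq_one_iff c.t₀).2 (mem_zpowers _) |> fun h => (h : QuotientGroup.mk' _ c.t₀ = 1)]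
  exact one_mem _⟩

theorem proj_surjective : Function.Surjective c.proj :=
  MonoidHom.subgroupComap_surjective_of_surjective _ _ (QuotientGroup.mk'_surjective _)

theorem proj_eq_one {s : c.Tplus} : c.proj s = 1 ↔ s = 1 ∨ s = c.τ := by
  have h1 : c.proj s = 1 ↔ (s : G) ∈ zpowers c.t₀ := by
    rw [← QuotientGroup.eq_one_iff]
    exact Subtype.ext_iff
  rw [h1, mem_zpowers_of_orderOf_eq_two c.order_t₀, Subtype.ext_iff, Subtype.ext_iff]
  rfl

theorem τ_ne_one : c.τ ≠ 1 := by
  intro h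
  have h1 : c.t₀ = 1 := congrArg Subtype.val h
  have := c.order_t₀
  rw [h1, orderOf_one] at this
  exact absurd this (by decide)

/-- Nondegeneracy of `β̄` makes the radical equal to the kernel of `T⁺ → T̄`. This characterizes
`t₀` through the bicharacter on `T⁺` alone. -/
theorem βplus_radical {s : c.Tplus} : (∀ t, c.βplus s t = 1) ↔ s = 1 ∨ s = c.τ := by
  rw [← c.proj_eq_one]
  constructor
  · intro h
    refine c.nondegenerate _ fun t => ?_
    obtain ⟨t, rfl⟩ := c.proj_surjective t
    exact h t
  · intro h t
    rw [βplus, h, map_one]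
    rfl

theorem finite_Tplus : Finite c.Tplus := by
  have := c.finite_Tbar
  refine Set.finite_univ_iff.1 (Set.Finite.of_finite_fibers c.proj (Set.toFinite _) fun q _ => ?_)
  obtain ⟨s, rfl⟩ := c.proj_surjective q
  refine Set.Finite.subset (Set.toFinite {s, s * c.τ}) fun s' hs' => ?_
  have h1 : c.proj (s⁻¹ * s') = 1 := by
    rw [map_mul, map_inv, show c.proj s' = c.proj s from hs'.2, inv_mul_cancel]
  rcases c.proj_eq_one.1 h1 with h | h
  · left; exact (inv_mul_eq_one.1 h).symm
  · right; exact (inv_mul_eq_iff_eq_mul.1 h)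

theorem card_Tplus : Nat.card c.Tplus = 2 * Nat.card c.Tbar := by
  have h1 := Subgroup.card_mul_index c.proj.ker
  rw [Subgroup.index_ker, MonoidHom.range_eq_top.2 c.proj_surjective,
    Subgroup.card_top] at h1
  rw [← h1]
  congr 1
  have h2 : c.proj.ker = zpowers c.τ := by
    ext s
    rw [MonoidHom.mem_ker, c.proj_eq_one, mem_zpowers_of_orderOf_eq_two]
    rw [← c.order_t₀, ← Subgroup.orderOf_coe]; rfl
  rw [h2, Nat.card_zpowers, ← c.order_t₀, ← Subgroup.orderOf_coe]; rfl

/-- The distinguished element exists and is unique. -/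
theorem existsUnique_isDistinguished (hF : ringChar F ≠ 2) (χ : c.Tplus →* Fˣ)
    (hχ : χ c.τ = -1) : ∃! a : c.Tplus, c.IsDistinguished χ a := by
  have := c.finite_Tbar
  -- The square of `χ` is trivial at `t₀`, so it descends to `T̄` and is represented there by some
  -- `ā`. A lift has `χ(a)² = β̄(ā, ā) = 1`, and multiplication by `t₀` switches between the two
  -- signs of `χ(a)`.
  obtain ⟨l, hl⟩ := exists_descend c.proj_surjective (χ ^ 2) (fun s hs => by
    rcases c.proj_eq_one.1 hs with rfl | rfl
    · exact map_one _
    · rw [MonoidHom.pow_apply, hχ, neg_one_sq])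
  obtain ⟨b, hb⟩ := (bijective_of_nondegenerate c.βbar c.nondegenerate).2 l
  obtain ⟨a, rfl⟩ := c.proj_surjective b
  have ha : ∀ t, χ t ^ 2 = c.βbar (c.proj a) (c.proj t) := fun t => by
    rw [hb, hl]; rfl
  have hτ : c.proj c.τ = 1 := c.proj_eq_one.2 (Or.inr rfl)
  have hex : ∃ a', c.IsDistinguished χ a' := by
    rcases units_sq_eq_one ((ha a).trans (c.alternating _)) with h | h
    · exact ⟨a, h, ha⟩
    · refine ⟨a * c.τ, ?_, fun t => ?_⟩
      · rw [map_mul, h, hχ, neg_mul_neg, one_mul]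
      · rw [map_mul, hτ, mul_one, ha]
  obtain ⟨a₁, h1, h2⟩ := hex
  refine ⟨a₁, ⟨h1, h2⟩, fun a₂ ⟨h3, h4⟩ => ?_⟩
  have h5 : c.proj (a₁⁻¹ * a₂) = 1 := by
    refine c.nondegenerate _ fun t => ?_
    obtain ⟨t, rfl⟩ := c.proj_surjective t
    rw [map_mul, map_inv, map_mul, map_inv, MonoidHom.mul_apply, MonoidHom.inv_apply, ← h2, ← h4,
      inv_mul_cancel]
  rcases c.proj_eq_one.1 h5 with h | h
  · exact (inv_mul_eq_one.1 h).symm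
  · have h6 := congrArg χ h
    rw [map_mul, map_inv, h1, h3, hχ, inv_one, one_mul] at h6
    exact absurd h6.symm (neg_one_ne_one_of_ringChar hF)

end EvenData

theorem z2_cases (i : Z2) : i = 1 ∨ i = odd := by
  revert i; decide

theorem odd_ne_one : (odd : Z2) ≠ 1 := by decide

theorem odd_mul_odd : (odd * odd : Z2) = 1 := by decide

namespace OddParams

variable {χ : CharFamily F G} {n : ℕ} (p : OddParams χ n)

/-- The inclusion of `T⁺` in `T_u`. -/
def ι (s : p.c.Tplus) : p.Tu := ⟨(s, 1), s, s.2, Or.inl rfl⟩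

/-- The element `t₁` of `T_u`. -/
def t₁ : p.Tu := ⟨(p.u, odd), 1, one_mem _, Or.inr (by ext1 <;> simp)⟩

theorem Tu_cases (x : p.Tu) : ∃ s, x = p.ι s ∨ x = p.t₁ * p.ι s := by
  obtain ⟨_, s, hs, rfl | rfl⟩ := x
  · exact ⟨⟨s, hs⟩, Or.inl rfl⟩
  · exact ⟨⟨s, hs⟩, Or.inr rfl⟩

theorem βu_ι (s t : p.c.Tplus) : p.βu (p.ι s) (p.ι t) = p.c.βplus s t := p.βu_plus s t

theorem βu_t₁_ι (t : p.c.Tplus) : p.βu p.t₁ (p.ι t) = p.char t := p.βu_t₁ t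

theorem βu_ι_t₁ (t : p.c.Tplus) : p.βu (p.ι t) p.t₁ = (p.char t)⁻¹ := by
  rw [alternating_swap p.βu_self, βu_t₁_ι]

theorem mem_Tu_even {s : G} : (s, (1 : Z2)) ∈ p.Tu ↔ s ∈ p.c.Tplus := by
  constructor
  · rintro ⟨s', hs', h | h⟩
    · obtain rfl : s = s' := congrArg Prod.fst h
      exact hs'
    · have := congrArg Prod.snd h
      simp only [Prod.mk_mul_mk, mul_one] at this
      exact absurd this.symm odd_ne_one
  · intro hs
    exact (p.ι ⟨s, hs⟩).2

/-- An odd element pairs to `-1` with `t₀`. An even element of the radical is `1` or `t₀`, and `t₀`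
is detected by `t₁`. -/
theorem βu_nondegenerate (hF : ringChar F ≠ 2) (hχ : p.char p.c.τ = -1) (x : p.Tu)
    (hx : ∀ y, p.βu x y = 1) : x = 1 := by
  have hτ : ∀ s, p.c.βplus s p.c.τ = 1 := fun s => by
    rw [EvenData.βplus, p.c.proj_eq_one.2 (Or.inr rfl), map_one]
  obtain ⟨s, rfl | rfl⟩ := p.Tu_cases x
  · rcases p.c.βplus_radical.1 (fun t => by rw [← βu_ι]; exact hx _) with rfl | rfl
    · rfl
    · have := hx p.t₁
      rw [βu_ι_t₁, hχ, inv_eq_one] at this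
      exact absurd this (neg_one_ne_one_of_ringChar hF)
  · have := hx (p.ι p.c.τ)
    rw [map_mul, MonoidHom.mul_apply, βu_t₁_ι, βu_ι, hτ, mul_one, hχ] at this
    exact absurd this (neg_one_ne_one_of_ringChar hF)

/-- `T_u` is, as a set, the product of `T⁺` and the group of order two. -/
theorem bijective_plusPart :
    Function.Bijective (fun x : p.Tu => (p.plusPart x, x.1.2)) := by
  have hval : (1 : ZMod 2).val = 1 := by decide
  refine ⟨fun x y h => ?_, fun ⟨s, i⟩ => ?_⟩
  · obtain ⟨h1, h2⟩ := Prod.mk.inj h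
    have h3 : x.1.1 * (p.u ^ expo x.1)⁻¹ = y.1.1 * (p.u ^ expo y.1)⁻¹ := congrArg Subtype.val h1
    have h4 : expo x.1 = expo y.1 := by simp only [expo, h2]
    rw [h4] at h3
    exact Subtype.ext (Prod.ext (mul_right_cancel h3) h2)
  · rcases z2_cases i with rfl | rfl
    · refine ⟨p.ι s, Prod.ext (Subtype.ext ?_) rfl⟩
      simp [plusPart, ι, expo]
    · refine ⟨p.t₁ * p.ι s, Prod.ext (Subtype.ext ?_) ?_⟩
      · simp [plusPart, ι, t₁, expo, hval]
      · simp [ι, t₁]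

theorem finite_Tu : Finite p.Tu := by
  have := p.c.finite_Tplus
  exact Finite.of_injective _ p.bijective_plusPart.1

theorem card_Tu : Nat.card p.Tu = 4 * Nat.card p.c.Tbar := by
  rw [Nat.card_eq_of_bijective _ p.bijective_plusPart, Nat.card_prod, p.c.card_Tplus]
  have : Nat.card Z2 = 2 := by simp
  rw [this]
  ring

/-- `β_u` is characterized by its values on `T⁺ × T⁺` and on `t₁ × T⁺`. -/
theorem βu_unique {T : Subgroup (Sharp G)} (β : T →* T →* Fˣ) (hβ : ∀ t, β t t = 1)
    (hT : ∀ x, x ∈ p.Tu ↔ x ∈ T)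
    (h1 : ∀ (s t : p.c.Tplus) hs ht, β ⟨(s, 1), hs⟩ ⟨(t, 1), ht⟩ = p.c.βplus s t)
    (h2 : ∀ (t : p.c.Tplus) hu ht, β ⟨(p.u, odd), hu⟩ ⟨(t, 1), ht⟩ = p.char t) :
    ∀ x y (hx : x ∈ p.Tu) (hy : y ∈ p.Tu) (hx' : x ∈ T) (hy' : y ∈ T),
      p.βu ⟨x, hx⟩ ⟨y, hy⟩ = β ⟨x, hx'⟩ ⟨y, hy'⟩ := by
  obtain rfl : p.Tu = T := Subgroup.ext hT
  have h1' : ∀ s t, β (p.ι s) (p.ι t) = p.βu (p.ι s) (p.ι t) := fun s t => by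
    rw [βu_ι]; exact h1 s t _ _
  have h2' : ∀ t, β p.t₁ (p.ι t) = p.βu p.t₁ (p.ι t) := fun t => by
    rw [βu_t₁_ι]; exact h2 t _ _
  have h3' : ∀ t, β (p.ι t) p.t₁ = p.βu (p.ι t) p.t₁ := fun t => by
    rw [alternating_swap hβ, h2', ← alternating_swap p.βu_self]
  intro x y hx hy _ _
  change p.βu ⟨x, hx⟩ ⟨y, hy⟩ = β ⟨x, hx⟩ ⟨y, hy⟩
  generalize (⟨x, hx⟩ : p.Tu) = x'
  generalize (⟨y, hy⟩ : p.Tu) = y'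
  obtain ⟨s, rfl | rfl⟩ := p.Tu_cases x' <;> obtain ⟨t, rfl | rfl⟩ := p.Tu_cases y' <;>
  simp only [map_mul, MonoidHom.mul_apply, h1', h2', h3', hβ, p.βu_self]

end OddParams

end Parameters

/-! ### Translation between `(T, β)` and the parameters `(t₀, T̄, β̄, u)` -/

section Recovery

variable {F : Type u} [Field F] {G : Type v} [CommGroup G]

/-- The sign character `(g, i) ↦ (-1)^i`. -/
def signChar (F : Type u) [Field F] (G : Type v) [CommGroup G] : Sharp G →* Fˣ :=
  MonoidHom.mk' (fun x => if x.2 = 1 then 1 else -1) (by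
    rintro ⟨g, i⟩ ⟨h, j⟩
    rcases z2_cases i with rfl | rfl <;> rcases z2_cases j with rfl | rfl <;>
    simp [odd_mul_odd])

theorem signChar_even (g : G) : signChar F G (g, 1) = 1 :=
  (if_pos rfl : (if (1 : Z2) = 1 then (1 : Fˣ) else -1) = 1)

theorem signChar_odd (g : G) : signChar F G (g, odd) = -1 :=
  (if_neg odd_ne_one : (if (odd : Z2) = 1 then (1 : Fˣ) else -1) = -1)

theorem odd_sq : (odd : Z2) ^ 2 = 1 := by decide

/-- Every finite subgroup of `G × ℤ₂` with odd elements and a nondegenerate alternating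
bicharacter arises from parameters. -/
theorem exists_params (hF : ringChar F ≠ 2) (χ : CharFamily F G)
    (hχ : ∀ (t₀ : G) (Tbar : Subgroup (G ⧸ zpowers t₀)),
      orderOf t₀ = 2 → Finite Tbar → ∀ t : tPlus t₀ Tbar, (t : G) = t₀ → χ t₀ Tbar t = -1)
    {T : Subgroup (Sharp G)} [Finite T] (β : T →* T →* Fˣ) (hβ : ∀ t, β t t = 1)
    (hnd : ∀ s, (∀ t, β s t = 1) → s = 1) (hodd : ∃ g : G, (g, odd) ∈ T) :
    ∃ (c : EvenData F G) (r : G)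
      (hr : ∃ a : c.Tplus, c.IsDistinguished (χ c.t₀ c.Tbar) a ∧ r ^ 2 = a),
      ∀ (n k : ℕ) (γ : Fin k → G) (hs : k ^ 2 * Nat.card c.Tbar = n ^ 2),
        (∀ x, x ∈ (⟨c, r, hr, k, γ, hs⟩ : OddParams χ n).Tu ↔ x ∈ T) ∧
        ∀ x y hx hy hx' hy', (⟨c, r, hr, k, γ, hs⟩ : OddParams χ n).βu ⟨x, hx⟩ ⟨y, hy⟩ =
          β ⟨x, hx'⟩ ⟨y, hy'⟩ := by
  have hne := neg_one_ne_one_of_ringChar hF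
  have hsw := alternating_swap hβ
  have hbij := bijective_of_nondegenerate β hnd
  obtain ⟨g₁, hg₁⟩ := hodd
  -- Nondegeneracy represents the sign character by an element `z`. If `z` were odd, then `β(z, z)`
  -- would be `-1`; so `z` is even, and its first coordinate is `t₀`.
  obtain ⟨⟨⟨t₀, i⟩, hz⟩, hzs⟩ := hbij.2 ((signChar F G).comp T.subtype)
  have hzv : ∀ y : T, β ⟨(t₀, i), hz⟩ y = signChar F G y := fun y => by rw [hzs]; rfl
  obtain rfl : i = 1 := by
    rcases z2_cases i with h | rfl
    · exact h
    · have h1 := hzv ⟨(t₀, odd), hz⟩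
      rw [hβ] at h1
      rw [signChar_odd] at h1
      exact absurd h1.symm hne
  set z : T := ⟨(t₀, 1), hz⟩ with hzdef
  have hz1 : z ≠ 1 := by
    intro h
    have h1 := hzv ⟨(g₁, odd), hg₁⟩
    rw [h, map_one, signChar_odd] at h1
    exact hne h1.symm
  have hz2 : z ^ 2 = 1 := hnd _ fun y => by
    rw [map_pow, MonoidHom.pow_apply, hzv]
    obtain ⟨⟨y, j⟩, hy⟩ := y
    rcases z2_cases j with rfl | rfl
    · rw [signChar_even, one_pow]
    · rw [signChar_odd, neg_one_sq]
  have hoz : orderOf z = 2 := orderOf_eq_prime_iff.2 ⟨hz2, hz1⟩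
  have ht₀ : orderOf t₀ = 2 := by
    refine orderOf_eq_prime_iff.2 ⟨?_, fun h => hz1 (Subtype.ext (Prod.ext h rfl))⟩
    exact congrArg (fun x : T => x.1.1) hz2
  let S : Subgroup G := T.comap (MonoidHom.inl G Z2)
  have hS : ∀ s, s ∈ S ↔ (s, (1 : Z2)) ∈ T := fun s => Iff.rfl
  let Tbar : Subgroup (G ⧸ zpowers t₀) := S.map (QuotientGroup.mk' (zpowers t₀))
  let N := tPlus t₀ Tbar
  have hN : ∀ s, s ∈ N ↔ (s, (1 : Z2)) ∈ T := by
    intro s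
    rw [← hS]
    change s ∈ (S.map (QuotientGroup.mk' (zpowers t₀))).comap (QuotientGroup.mk' (zpowers t₀)) ↔ _
    rw [Subgroup.comap_map_eq, QuotientGroup.ker_mk', sup_eq_left.2]
    rw [zpowers_le, hS]
    exact hz
  let ι : N →* T := MonoidHom.mk' (fun s => ⟨(s, 1), (hN s).1 s.2⟩) fun s t => rfl
  have hιinj : Function.Injective ι := fun s t h =>
    Subtype.ext (congrArg (fun x : T => x.1.1) h)
  have hιz : ∀ s : N, β z (ι s) = 1 := fun s => by rw [hzv]; exact signChar_even _
  have hfinN : Finite N := Finite.of_injective ι hιinj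
  let pr : N →* Tbar := (QuotientGroup.mk' (zpowers t₀)).subgroupComap Tbar
  have hpr : Function.Surjective pr :=
    MonoidHom.subgroupComap_surjective_of_surjective _ _ (QuotientGroup.mk'_surjective _)
  have hfinT : Finite Tbar := Finite.of_surjective pr hpr
  have hpr1 : ∀ s : N, pr s = 1 ↔ ι s = 1 ∨ ι s = z := by
    intro s
    have h1 : pr s = 1 ↔ (s : G) ∈ zpowers t₀ := by
      rw [← QuotientGroup.eq_one_iff]
      exact Subtype.ext_iff
    rw [h1, mem_zpowers_of_orderOf_eq_two ht₀]
    constructor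
    · rintro (h | h)
      · exact Or.inl (Subtype.ext (Prod.ext h rfl))
      · exact Or.inr (Subtype.ext (Prod.ext h rfl))
    · rintro (h | h)
      · exact Or.inl (congrArg (fun x : T => x.1.1) h)
      · exact Or.inr (congrArg (fun x : T => x.1.1) h)
  let t₁ : T := ⟨(g₁, odd), hg₁⟩
  have hTcases : ∀ (w : G) (hw : (w, odd) ∈ T) (y : T),
      ∃ s : N, y = ι s ∨ y = ⟨(w, odd), hw⟩ * ι s := by
    rintro w hw ⟨⟨y, j⟩, hy⟩
    rcases z2_cases j with rfl | rfl
    · exact ⟨⟨y, (hN y).2 hy⟩, Or.inl rfl⟩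
    · have h1 : (w⁻¹ * y, (1 : Z2)) ∈ T := by
        have := mul_mem (inv_mem hw) hy
        simpa [Prod.mk_mul_mk] using this
      refine ⟨⟨w⁻¹ * y, (hN _).2 h1⟩, Or.inr (Subtype.ext (Prod.ext ?_ ?_))⟩
      · exact (mul_inv_cancel_left w y).symm
      · exact (mul_one odd).symm
  -- the radical of the restriction to the even part
  have hrad : ∀ x : T, (∀ s, β x (ι s) = 1) → x = 1 ∨ x = z := by
    intro x hx
    -- Since `t₁²` is even, `β(x, t₁)` is a sign, and this sign decides between `x = 1` and `x = z`.
    have hsq : β x t₁ ^ 2 = 1 := by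
      have : t₁ ^ 2 = ι ⟨g₁ ^ 2, (hN _).2 (by
          have := pow_mem hg₁ 2
          rwa [Prod.pow_mk, odd_sq] at this)⟩ :=
        Subtype.ext (Prod.ext rfl odd_sq)
      rw [← map_pow, this, hx]
    rcases units_sq_eq_one hsq with h | h
    · left
      refine hnd x fun y => ?_
      obtain ⟨s, rfl | rfl⟩ := hTcases g₁ hg₁ y
      · exact hx s
      · rw [map_mul, hx, mul_one]; exact h
    · right
      rw [← mul_inv_eq_one]
      refine hnd _ fun y => ?_
      rw [map_mul, map_inv, MonoidHom.mul_apply, MonoidHom.inv_apply, mul_inv_eq_one]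
      obtain ⟨s, rfl | rfl⟩ := hTcases g₁ hg₁ y
      · rw [hx, hιz]
      · rw [map_mul, map_mul, hx, hιz, mul_one, mul_one, hzv]
        exact h.trans (signChar_odd g₁).symm
  have hιrad : ∀ s : N, pr s = 1 → ∀ t, β (ι s) (ι t) = 1 := by
    intro s hs t
    rcases (hpr1 s).1 hs with h | h
    · rw [h, map_one]; rfl
    · rw [h, hιz]
  let b : N →* N →* Fˣ :=
    MonoidHom.mk' (fun s => (β (ι s)).comp ι) fun s s' => by
      refine MonoidHom.ext fun t => ?_
      simp
  have hb : ∀ s t, b s t = β (ι s) (ι t) := fun _ _ => rfl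
  obtain ⟨βbar, hβbar⟩ := exists_descend₂ hpr b hιrad fun t ht s => by
    rw [hb, hsw, hιrad t ht, inv_one]
  let c : EvenData F G :=
    { t₀ := t₀
      order_t₀ := ht₀
      Tbar := Tbar
      finite_Tbar := hfinT
      βbar := βbar
      alternating := fun q => by
        obtain ⟨s, rfl⟩ := hpr q
        rw [hβbar, hb, hβ]
      nondegenerate := fun q hq => by
        obtain ⟨s, rfl⟩ := hpr q
        rw [hpr1]
        refine hrad _ fun t => ?_
        rw [← hb, ← hβbar, hq] }
  -- an odd element inducing the prescribed character
  let ρ : T →* (N →* Fˣ) := MonoidHom.mk' (fun x => (β x).comp ι) fun x x' => by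
    refine MonoidHom.ext fun t => ?_
    simp
  have hρ : ρ.range = ⊤ := by
    have := finite_character (F := F) (T := N)
    -- Restriction to the even part has kernel `{1, z}`, and `|T| ≥ 2|N|`, so the image has at least
    -- `|N|` elements. There are no more characters than that.
    refine Subgroup.eq_top_of_le_card _ ((card_character_le (F := F) (T := N)).trans ?_)
    have h1 := Subgroup.card_mul_index ρ.ker
    rw [Subgroup.index_ker] at h1
    have h2 : ρ.ker = zpowers z := by
      ext x
      rw [MonoidHom.mem_ker, mem_zpowers_of_orderOf_eq_two hoz]
      constructor
      · exact fun h => hrad x fun s => DFunLike.congr_fun h s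
      · rintro (rfl | rfl)
        · exact map_one _
        · exact MonoidHom.ext hιz
    rw [h2, Nat.card_zpowers, hoz] at h1
    have h3 : Nat.card T ≥ 2 * Nat.card N := by
      have hinj : Function.Injective (fun x : Bool × N => if x.1 then ι x.2 else t₁ * ι x.2) := by
        rintro ⟨i, s⟩ ⟨j, t⟩ h
        cases i <;> cases j
        · simp only [Bool.false_eq_true, if_false] at h
          rw [hιinj (mul_left_cancel h)]
        · simp only [Bool.false_eq_true, if_false, if_true] at h
          exact absurd (congrArg (fun x : T => x.1.2) h) (by simp [t₁, ι])
        · simp only [Bool.false_eq_true, if_false, if_true] at h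
          exact absurd (congrArg (fun x : T => x.1.2) h).symm (by simp [t₁, ι])
        · simp only [if_true] at h
          rw [hιinj h]
      have := Nat.card_le_card_of_injective _ hinj
      rwa [Nat.card_prod, Nat.card_eq_fintype_card, Fintype.card_bool] at this
    omega
  let χ₀ : N →* Fˣ := χ t₀ Tbar
  obtain ⟨⟨⟨r, j⟩, hrT⟩, hrχ⟩ : χ₀ ∈ ρ.range := hρ ▸ Subgroup.mem_top _
  have hrv : ∀ s : N, β ⟨(r, j), hrT⟩ (ι s) = χ₀ s := fun s => by rw [← hrχ]; rfl
  -- An even element pairs trivially with `z`, whereas `χ(t₀) = -1`.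
  obtain rfl : j = odd := by
    rcases z2_cases j with rfl | h
    · exfalso
      have h1 := hrv ⟨t₀, (hN _).2 hz⟩
      rw [show χ₀ ⟨t₀, (hN _).2 hz⟩ = -1 from hχ t₀ Tbar ht₀ hfinT _ rfl, hsw,
        show ι ⟨t₀, (hN _).2 hz⟩ = z from rfl, hzv, signChar_even, inv_one] at h1
      exact hne h1.symm
    · exact h
  have hr2 : (r ^ 2, (1 : Z2)) ∈ T := by
    have := pow_mem hrT 2
    rwa [Prod.pow_mk, odd_sq] at this
  let a : c.Tplus := ⟨r ^ 2, (hN _).2 hr2⟩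
  have hιa : ι a = ⟨(r, odd), hrT⟩ ^ 2 := Subtype.ext (Prod.ext rfl odd_sq.symm)
  have ha : c.IsDistinguished (χ c.t₀ c.Tbar) a := by
    constructor
    · change χ₀ a = 1
      rw [← hrv, hιa, map_pow, hβ, one_pow]
    · intro t
      change χ₀ t ^ 2 = βbar (pr a) (pr t)
      rw [hβbar, hb, ← hrv, hιa, map_pow]
      rfl
  -- Neither `T_u` nor `β_u` involves `n`, `k` or `γ`, so these remain free.
  refine ⟨c, r, ⟨a, ha, rfl⟩, fun n k γ hs => ?_⟩
  have hTu : ∀ x, x ∈ (⟨c, r, ⟨a, ha, rfl⟩, k, γ, hs⟩ : OddParams χ n).Tu ↔ x ∈ T := by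
    intro x
    constructor
    · rintro ⟨s, hs, rfl | rfl⟩
      · exact (hN s).1 hs
      · exact mul_mem hrT ((hN s).1 hs)
    · intro hx
      obtain ⟨s, h | h⟩ := hTcases r hrT ⟨x, hx⟩
      · exact ⟨s, s.2, Or.inl (congrArg Subtype.val h)⟩
      · exact ⟨s, s.2, Or.inr (congrArg Subtype.val h)⟩
  refine ⟨hTu, OddParams.βu_unique _ β hβ hTu ?_ ?_⟩
  · intro s t _ _
    exact (hβbar s t).symm
  · intro t _ _
    exact hrv t

variable {χ : CharFamily F G} {n : ℕ}

/-- The element `t₀` is the nontrivial element of the radical; once it is known, `T̄` and `β̄` are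
recovered along the surjection `T⁺ → T̄`. -/
theorem eq_of_βplus_eq {c c' : EvenData F G} (hT : ∀ s, s ∈ c.Tplus ↔ s ∈ c'.Tplus)
    (hβ : ∀ (s t : G) (hs : s ∈ c.Tplus) (ht : t ∈ c.Tplus) (hs' : s ∈ c'.Tplus)
      (ht' : t ∈ c'.Tplus), c.βplus ⟨s, hs⟩ ⟨t, ht⟩ = c'.βplus ⟨s, hs'⟩ ⟨t, ht'⟩) : c = c' := by
  have h₀ : c.t₀ = c'.t₀ := by
    have h1 : (⟨c.t₀, (hT _).1 c.τ.2⟩ : c'.Tplus) = 1 ∨ (⟨c.t₀, (hT _).1 c.τ.2⟩ : c'.Tplus) = c'.τ := by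
      refine c'.βplus_radical.1 fun t => ?_
      rw [← hβ c.t₀ t c.τ.2 ((hT _).2 t.2) ((hT _).1 c.τ.2) t.2]
      exact c.βplus_radical.2 (Or.inr rfl) _
    rcases h1 with h1 | h1
    · exfalso
      have h2 : c.t₀ = 1 := congrArg Subtype.val h1
      exact c.τ_ne_one (Subtype.ext h2)
    · exact congrArg Subtype.val h1
  obtain ⟨t₀, h2, Tbar, hfin, b, halt, hnd⟩ := c
  obtain ⟨t₀', h2', Tbar', hfin', b', halt', hnd'⟩ := c'
  obtain rfl : t₀ = t₀' := h₀
  obtain rfl : Tbar = Tbar' :=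
    Subgroup.comap_injective (QuotientGroup.mk'_surjective (zpowers t₀)) (Subgroup.ext hT)
  obtain rfl : b = b' := by
    let c : EvenData F G := ⟨t₀, h2, Tbar, hfin, b, halt, hnd⟩
    refine MonoidHom.ext fun q => MonoidHom.ext fun q' => ?_
    obtain ⟨s, rfl⟩ := c.proj_surjective q
    obtain ⟨t, rfl⟩ := c.proj_surjective q'
    exact hβ s t s.2 t.2 s.2 t.2
  rfl

/-- The parameters are determined by `T_u` and `β_u`. -/
theorem params_eq (p p' : OddParams χ n) (hT : ∀ x, x ∈ p.Tu ↔ x ∈ p'.Tu)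
    (hβ : ∀ x y hx hy hx' hy', p.βu ⟨x, hx⟩ ⟨y, hy⟩ = p'.βu ⟨x, hx'⟩ ⟨y, hy'⟩) :
    p.c = p'.c ∧ p.u⁻¹ * p'.u ∈ zpowers p.c.t₀ := by
  have hTp : ∀ s, s ∈ p.c.Tplus ↔ s ∈ p'.c.Tplus := fun s => by
    rw [← p.mem_Tu_even, hT, p'.mem_Tu_even]
  have hc : p.c = p'.c := eq_of_βplus_eq hTp fun s t hs ht hs' ht' => by
    rw [← p.βu_ι, ← p'.βu_ι]
    exact hβ _ _ _ _ _ _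
  refine ⟨hc, ?_⟩
  have ht₁ : (p'.u, odd) ∈ p.Tu := (hT _).2 p'.t₁.2
  have hmem : p.u⁻¹ * p'.u ∈ p.c.Tplus := by
    rw [← p.mem_Tu_even]
    have := mul_mem (inv_mem p.t₁.2) ht₁
    have he : (p.t₁ : Sharp G)⁻¹ * (p'.u, odd) = (p.u⁻¹ * p'.u, 1) :=
      Prod.ext rfl (by change odd⁻¹ * odd = 1; exact inv_mul_cancel _)
    rwa [he] at this
  have hchar : ∀ t : p.c.Tplus, p.char t = p'.char ⟨t, (hTp t).1 t.2⟩ := by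
    intro t
    obtain ⟨c, u, r, k, γ, hs⟩ := p
    obtain ⟨c', u', r', k', γ', hs'⟩ := p'
    obtain rfl : c = c' := hc
    rfl
  have hι : p.ι ⟨p.u⁻¹ * p'.u, hmem⟩ = p.t₁⁻¹ * ⟨(p'.u, odd), ht₁⟩ :=
    Subtype.ext (Prod.ext rfl (inv_mul_cancel (odd : Z2)).symm)
  -- The odd elements `t₁` of both parameter sets induce the same `χ`, so their quotient lies in the
  -- radical of `T⁺`.
  have hrad : ∀ t, p.c.βplus ⟨p.u⁻¹ * p'.u, hmem⟩ t = 1 := by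
    intro t
    rw [← p.βu_ι, hι, map_mul, map_inv, MonoidHom.mul_apply, MonoidHom.inv_apply, p.βu_t₁_ι, hchar,
      ← p'.βu_t₁_ι, inv_mul_eq_one]
    exact (hβ _ _ _ _ _ _).symm
  rw [mem_zpowers_of_orderOf_eq_two p.c.order_t₀]
  rcases p.c.βplus_radical.1 hrad with h | h
  · exact Or.inl (congrArg Subtype.val h)
  · exact Or.inr (congrArg Subtype.val h)

/-- Congruent parameters give the same `T_u` and `β_u`. -/
theorem factor_eq_of_params (p p' : OddParams χ n) (hc : p.c = p'.c)
    (hu : p.u⁻¹ * p'.u ∈ zpowers p.c.t₀) :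
    (∀ x, x ∈ p.Tu ↔ x ∈ p'.Tu) ∧
      ∀ x y hx hy hx' hy', p.βu ⟨x, hx⟩ ⟨y, hy⟩ = p'.βu ⟨x, hx'⟩ ⟨y, hy'⟩ := by
  obtain ⟨c, u, r, k, γ, hs⟩ := p
  obtain ⟨c', u', r', k', γ', hs'⟩ := p'
  obtain rfl : c = c' := hc
  change u⁻¹ * u' ∈ zpowers c.t₀ at hu
  set p : OddParams χ n := ⟨c, u, r, k, γ, hs⟩ with hp
  set p' : OddParams χ n := ⟨c, u', r', k', γ', hs'⟩ with hp'
  have hmem : u⁻¹ * u' ∈ c.Tplus := by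
    have hle : zpowers c.t₀ ≤ c.Tplus := (zpowers_le).2 c.τ.2
    exact hle hu
  have hproj : c.proj ⟨u⁻¹ * u', hmem⟩ = 1 := by
    rw [c.proj_eq_one]
    rw [mem_zpowers_of_orderOf_eq_two c.order_t₀] at hu
    exact hu.imp Subtype.ext Subtype.ext
  have hT : ∀ x, x ∈ p.Tu ↔ x ∈ p'.Tu := by
    intro x
    constructor
    · rintro ⟨s, hs, rfl | rfl⟩
      · exact ⟨s, hs, Or.inl rfl⟩
      · refine ⟨(u⁻¹ * u')⁻¹ * s, mul_mem (inv_mem hmem) hs, Or.inr (Prod.ext ?_ rfl)⟩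
        change u * s = u' * ((u⁻¹ * u')⁻¹ * s)
        rw [mul_inv, inv_inv, mul_comm u u'⁻¹, mul_assoc, mul_inv_cancel_left]
    · rintro ⟨s, hs, rfl | rfl⟩
      · exact ⟨s, hs, Or.inl rfl⟩
      · refine ⟨u⁻¹ * u' * s, mul_mem hmem hs, Or.inr (Prod.ext ?_ rfl)⟩
        change u' * s = u * (u⁻¹ * u' * s)
        rw [mul_assoc, mul_inv_cancel_left]
  refine ⟨hT, p.βu_unique p'.βu p'.βu_self hT (fun s t _ _ => p'.βu_ι s t) ?_⟩
  intro t hu₁ ht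
  -- The two choices of `t₁` differ by an element of `⟨t₀⟩`, which pairs trivially with `T⁺`; hence
  -- both induce `χ`.
  have h1 : (⟨(p.u, odd), hu₁⟩ : p'.Tu) = p'.t₁ * (p'.ι ⟨u⁻¹ * u', hmem⟩)⁻¹ := by
    refine Subtype.ext (Prod.ext ?_ (by
      change odd = odd * (1 : Z2)⁻¹
      rw [inv_one, mul_one]))
    change u = u' * (u⁻¹ * u')⁻¹
    rw [mul_inv, inv_inv, mul_comm u u'⁻¹, mul_inv_cancel_left]
  have h2 : (⟨(t, 1), ht⟩ : p'.Tu) = p'.ι t := rfl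
  rw [h1, h2, map_mul, map_inv, MonoidHom.mul_apply, MonoidHom.inv_apply, p'.βu_t₁_ι, p'.βu_ι,
    EvenData.βplus]
  change _ * (c.βbar (c.proj ⟨u⁻¹ * u', hmem⟩) (c.proj t))⁻¹ = _
  rw [hproj, map_one, MonoidHom.one_apply, inv_one, mul_one]

end Recovery

/-! ### Identification with `M(n,n)` -/

section Parity

variable {F : Type u} [Field F]

/-- The sign of an element of `ℤ₂`. -/
def sgn (F : Type u) [Field F] (i : Z2) : F := if i = 1 then 1 else -1

theorem sgn_one : sgn F 1 = 1 := if_pos rfl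

theorem sgn_odd : sgn F odd = -1 := if_neg odd_ne_one

theorem isVectorGrading_mnnParity (n : ℕ) : IsVectorGrading (mnnParity F n) := by
  classical
  let π : Z2 → Mnn F n →ₗ[F] Mnn F n := fun i =>
    { toFun := fun X => Matrix.of fun r c => if basisParity r = i * basisParity c then X r c else 0
      map_add' := fun X Y => by
        ext r c
        by_cases h : basisParity r = i * basisParity c <;> simp [h]
      map_smul' := fun a X => by
        ext r c
        by_cases h : basisParity r = i * basisParity c <;> simp [h] }
  have hπ : ∀ i X r c, π i X r c = if basisParity r = i * basisParity c then X r c else 0 :=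
    fun _ _ _ _ => rfl
  have hmem : ∀ i X, π i X ∈ mnnParity F n i := fun i X r c h => by rw [hπ, if_neg h]
  refine ⟨iSupIndep_of_proj π ?_ ?_, ?_⟩
  · intro i X hX
    ext r c
    rw [hπ]
    split_ifs with h
    · rfl
    · exact (hX r c h).symm
  · intro i j X hX hne
    ext r c
    rw [hπ]
    split_ifs with h
    · refine hX r c fun h' => hne ?_
      rw [h] at h'
      exact (mul_right_cancel h').symm
    · rfl
  · rw [eq_top_iff]
    rintro X -
    have : X = π 1 X + π odd X := by
      ext r c
      rw [Matrix.add_apply, hπ, hπ, one_mul]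
      have h1 : basisParity r = basisParity c ↔ ¬ basisParity r = odd * basisParity c := by
        generalize (basisParity r : Z2) = i
        generalize (basisParity c : Z2) = j
        revert i j
        decide
      by_cases h : basisParity r = odd * basisParity c
      · rw [if_pos h, if_neg (fun h' => h1.1 h' h), zero_add]
      · rw [if_neg h, if_pos (h1.2 h), add_zero]
    rw [this]
    exact add_mem (Submodule.mem_iSup_of_mem 1 (hmem 1 X))
      (Submodule.mem_iSup_of_mem odd (hmem odd X))

/-- An involution that anticommutes with an invertible operator has a diagonal matrix with equally
many entries `1` and `-1`. -/
theorem exists_basis_of_involution (h2 : (2 : F) ≠ 0) {W : Type*} [AddCommGroup W] [Module F W]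
    [FiniteDimensional F W] {n : ℕ} (hW : Module.finrank F W = 2 * n) (s y : Module.End F W)
    (hs : s * s = 1) (hy : IsUnit y) (hsy : s * y = -(y * s)) :
    ∃ b : Module.Basis (Fin n ⊕ Fin n) F W, ∀ r, s (b r) = sgn F (basisParity r) • b r := by
  have hsw : ∀ w, s (s w) = w := fun w => LinearMap.congr_fun hs w
  have hsyw : ∀ w, s (y w) = -y (s w) := fun w => LinearMap.congr_fun hsy w
  have hyinj : Function.Injective y := ((Module.End.isUnit_iff y).1 hy).1
  let Wp : Submodule F W := LinearMap.ker (s - 1)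
  let Wm : Submodule F W := LinearMap.ker (s + 1)
  have hp : ∀ w, w ∈ Wp ↔ s w = w := fun w => by
    rw [LinearMap.mem_ker, LinearMap.sub_apply, sub_eq_zero]; rfl
  have hm : ∀ w, w ∈ Wm ↔ s w = -w := fun w => by
    rw [LinearMap.mem_ker, LinearMap.add_apply, add_eq_zero_iff_eq_neg]; rfl
  have hcompl : IsCompl Wp Wm := by
    constructor
    · rw [Submodule.disjoint_def]
      intro w hw hw'
      have h1 : (2 : F) • w = 0 := by
        rw [two_smul]
        nth_rewrite 1 [← (hp w).1 hw]
        rw [(hm w).1 hw', neg_add_cancel]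
      exact (smul_eq_zero.1 h1).resolve_left h2
    · rw [codisjoint_iff, eq_top_iff]
      rintro w -
      have : w = (2 : F)⁻¹ • (w + s w) + (2 : F)⁻¹ • (w - s w) := by
        rw [← smul_add, add_add_sub_cancel, ← two_smul F w, smul_smul, inv_mul_cancel₀ h2,
          one_smul]
      rw [this]
      refine Submodule.add_mem_sup (Submodule.smul_mem _ _ ?_) (Submodule.smul_mem _ _ ?_)
      · rw [hp, map_add, hsw, add_comm]
      · rw [hm, map_sub, hsw, neg_sub]
  -- Anticommuting with `s`, the injective operator `y` exchanges the two eigenspaces.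
  have hpm : Module.finrank F Wp ≤ Module.finrank F Wm := by
    refine LinearMap.finrank_le_finrank_of_injective
      (f := y.restrict (p := Wp) (q := Wm) fun w hw => ?_) ?_
    · rw [hm, hsyw, (hp w).1 hw]
    · intro a b h
      exact Subtype.ext (hyinj (congrArg Subtype.val h))
  have hmp : Module.finrank F Wm ≤ Module.finrank F Wp := by
    refine LinearMap.finrank_le_finrank_of_injective
      (f := y.restrict (p := Wm) (q := Wp) fun w hw => ?_) ?_
    · rw [hp, hsyw, (hm w).1 hw, map_neg, neg_neg]
    · intro a b h
      exact Subtype.ext (hyinj (congrArg Subtype.val h))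
  have hadd := Submodule.finrank_add_eq_of_isCompl hcompl
  have hfp : Module.finrank F Wp = n := by omega
  have hfm : Module.finrank F Wm = n := by omega
  let b := ((Module.finBasisOfFinrankEq F Wp hfp).prod (Module.finBasisOfFinrankEq F Wm hfm)).map
    (Submodule.prodEquivOfIsCompl Wp Wm hcompl)
  refine ⟨b, fun r => ?_⟩
  rcases r with i | i
  · have h1 : b (Sum.inl i) = (Module.finBasisOfFinrankEq F Wp hfp i : W) := by simp [b]
    rw [h1, (hp _).1 (Submodule.coe_mem _)]
    exact (one_smul F _).symm.trans (by rw [← sgn_one (F := F)]; rfl)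
  · have h1 : b (Sum.inr i) = (Module.finBasisOfFinrankEq F Wm hfm i : W) := by simp [b]
    rw [h1, (hm _).1 (Submodule.coe_mem _)]
    change _ = sgn F odd • _
    rw [sgn_odd, neg_one_smul]

/-- A `ℤ₂`-grading of a matrix algebra that is given by conjugation with an involution with
eigenspaces of equal dimension is the canonical one of `M(n,n)`. -/
theorem exists_algEquiv_mnnParity (h2 : (2 : F) ≠ 0) {R : Type*} [Ring R] [Algebra F R]
    {W : Type*} [AddCommGroup W] [Module F W] [FiniteDimensional F W] {n : ℕ}
    (hW : Module.finrank F W = 2 * n) (e : R ≃ₐ[F] Module.End F W) (s y : R) (hs : s * s = 1)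
    (hy : IsUnit y) (hsy : s * y = -(y * s)) (P : Z2 → Submodule F R) (hP : (⨆ i, P i) = ⊤)
    (hsP : ∀ i, ∀ x ∈ P i, s * x = sgn F i • (x * s)) :
    ∃ φ : R ≃ₐ[F] Mnn F n, ∀ i, (P i).map φ.toLinearMap = mnnParity F n i := by
  obtain ⟨b, hb⟩ := exists_basis_of_involution h2 hW (e s) (e y)
    (by rw [← map_mul, hs, map_one]) (hy.map e) (by rw [← map_mul, hsy, map_neg, map_mul])
  have hrepr : ∀ w r, b.repr (e s w) r = sgn F (basisParity r) * b.repr w r := by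
    intro w r
    have : (Finsupp.lapply r ∘ₗ b.repr.toLinearMap) ∘ₗ e s =
        sgn F (basisParity r) • (Finsupp.lapply r ∘ₗ b.repr.toLinearMap) := by
      refine b.ext fun c => ?_
      by_cases hc : c = r
      · subst hc; simp [hb]
      · simp [hb, hc]
    exact LinearMap.congr_fun this w
  let φ : R ≃ₐ[F] Mnn F n := e.trans (LinearMap.toMatrixAlgEquiv b)
  have hφ : ∀ x r c, φ x r c = b.repr (e x (b c)) r := fun x r c =>
    LinearMap.toMatrixAlgEquiv_apply b (e x) r c
  -- Inclusions suffice: the images span, and the parity components are independent.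
  refine ⟨φ, congrFun (IsVectorGrading.eq_of_le (isVectorGrading_mnnParity n) ?_ ?_)⟩
  · rw [← Submodule.map_iSup, hP, Submodule.map_top]
    exact LinearMap.range_eq_top.2 φ.surjective
  · rintro i _ ⟨x, hx, rfl⟩ r c hrc
    change φ x r c = 0
    have h1 : e s (e x (b c)) = (sgn F i * sgn F (basisParity c)) • e x (b c) := by
      have := LinearMap.congr_fun (congrArg e (hsP i x hx)) (b c)
      rw [map_mul, map_smul, map_mul] at this
      rw [mul_smul, ← map_smul (e x), ← hb]
      exact this
    have h3 := hrepr (e x (b c)) r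
    rw [h1, map_smul, Finsupp.smul_apply, ← hφ, smul_eq_mul] at h3
    have h4 : ∀ i j k : Z2, j ≠ i * k → sgn F j = -(sgn F i * sgn F k) := by
      intro i j k hijk
      rcases z2_cases i with rfl | rfl <;> rcases z2_cases j with rfl | rfl <;>
        rcases z2_cases k with rfl | rfl <;>
        first
        | (exfalso; revert hijk; decide)
        | simp only [sgn_one, sgn_odd]; ring
    rw [h4 _ _ _ hrc, neg_mul, eq_neg_iff_add_eq_zero, ← two_mul, ← mul_assoc] at h3
    refine (mul_eq_zero.1 h3).resolve_left (mul_ne_zero h2 (mul_ne_zero ?_ ?_))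
    · rcases z2_cases i with rfl | rfl
      · rw [sgn_one]; exact one_ne_zero
      · rw [sgn_odd]; exact neg_ne_zero.2 one_ne_zero
    · generalize (basisParity c : Z2) = j
      rcases z2_cases j with rfl | rfl
      · rw [sgn_one]; exact one_ne_zero
      · rw [sgn_odd]; exact neg_ne_zero.2 one_ne_zero

variable {G : Type v} [CommGroup G]

theorem end_ext_single {D : Type*} [Ring D] {k : ℕ} {f g : Module.End Dᵐᵒᵖ (Fin k → D)}
    (h : ∀ j, f (Pi.single j 1) = g (Pi.single j 1)) : f = g := by
  refine LinearMap.ext fun y => ?_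
  rw [end_apply_eq_sum, end_apply_eq_sum g]
  exact Finset.sum_congr rfl fun j _ => by rw [h]

/-- Left multiplication by `d` in every coordinate. -/
def leftMul (F : Type*) [Field F] {D : Type*} [Ring D] [Algebra F D] (k : ℕ) :
    D →ₐ[F] Module.End Dᵐᵒᵖ (Fin k → D) :=
  Algebra.lsmul F Dᵐᵒᵖ (Fin k → D)

theorem leftMul_apply {D : Type*} [Ring D] [Algebra F D] {k : ℕ} (d : D) (x : Fin k → D)
    (i : Fin k) : leftMul F k d x i = d * x i := rfl

variable {D : Type*} [Ring D] [Algebra F D] {T : Subgroup (Sharp G)} {β : T →* T →* Fˣ}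
  {A : Sharp G → Submodule F D} {k : ℕ}

/-- The endomorphism algebra of a module with even shifts over a graded division algebra with odd
components whose parity is given by a commutation factor is `M(n,n)`. -/
theorem exists_algEquiv_of_isTwisted [IsAlgClosed F] (h2 : (2 : F) ≠ 0) (hA : IsTwisted β A)
    {W : Type*} [AddCommGroup W] [Module F W] [FiniteDimensional F W] {n : ℕ}
    (hW : Module.finrank F W = 2 * n) (e : Module.End Dᵐᵒᵖ (Fin k → D) ≃ₐ[F] Module.End F W)
    (γ : Fin k → G) (z : T) (hz2 : z ^ 2 = 1) (hz : ∀ x : T, (β z x : F) = sgn F x.1.2)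
    (t : T) (ht : t.1.2 = odd) :
    ∃ φ : Module.End Dᵐᵒᵖ (Fin k → D) ≃ₐ[F] Mnn F n, ∀ i,
      (coarsening (MonoidHom.snd G Z2)
        (endComponent D (shiftComponent A (fun j => (γ j, (1 : Z2))))) i).map φ.toLinearMap =
        mnnParity F n i := by
  obtain ⟨Z₀, hZ₀, hZ₀0⟩ := hA.exists_ne_zero z
  obtain ⟨y, hy, hy0⟩ := hA.exists_ne_zero t
  have := hA.nontrivial
  obtain ⟨Z, hZ, hZ2⟩ : ∃ Z ∈ A z, Z * Z = 1 := by
    have h1 : Z₀ * Z₀ ∈ A 1 := by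
      have := hA.grading.2 _ _ _ hZ₀ _ hZ₀
      rwa [← Subgroup.coe_mul, ← pow_two, hz2] at this
    obtain ⟨c, hc⟩ := hA.one_dim _ _ hA.grading.one_mem one_ne_zero _ h1
    have hc0 : c ≠ 0 := by
      rintro rfl
      rw [zero_smul] at hc
      exact hA.mul_ne hZ₀ hZ₀0 hZ₀ hZ₀0 hc
    -- A square root is used to rescale `Z₀` to an involution.
    obtain ⟨r, hr⟩ := IsAlgClosed.exists_pow_nat_eq c⁻¹ (n := 2) two_pos
    refine ⟨r • Z₀, Submodule.smul_mem _ _ hZ₀, ?_⟩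
    rw [smul_mul_smul_comm, ← pow_two, hr, hc, smul_smul, inv_mul_cancel₀ hc0, one_smul]
  have hcomm : ∀ h, ∀ d ∈ A h, Z * d = sgn F h.2 • (d * Z) := by
    intro h d hd
    by_cases hd0 : d = 0
    · rw [hd0, mul_zero, zero_mul, smul_zero]
    have hh := hA.mem_support hd hd0
    rw [hA.comm z ⟨h, hh⟩ Z hZ d hd, hz]
  refine exists_algEquiv_mnnParity h2 hW e (leftMul F k Z) (leftMul F k y) ?_ ?_ ?_ _ ?_ ?_
  · rw [← map_mul, hZ2, map_one]
  · exact (hA.isUnit _ _ hy hy0).map (leftMul F k)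
  · rw [← map_mul, hcomm _ y hy, ht, sgn_odd, neg_one_smul, map_neg, map_mul]
  · exact ((isAlgebraGrading_endComponent hA.grading _).coarsening _).1.2
  · intro i f hf
    have hle : coarsening (MonoidHom.snd G Z2)
        (endComponent D (shiftComponent A (fun j => (γ j, (1 : Z2))))) i ≤
        LinearMap.ker (LinearMap.mulLeft F (leftMul F k Z) -
          sgn F i • LinearMap.mulRight F (leftMul F k Z)) := by
      refine iSup_le fun h => iSup_le fun hi => fun f hf => ?_
      rw [LinearMap.mem_ker, LinearMap.sub_apply, sub_eq_zero]
      refine end_ext_single fun j => ?_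
      have h1 : f (Pi.single j 1) ∈ shiftComponent A (fun j => (γ j, (1 : Z2)))
          (h * (γ j, 1)) := by
        refine hf _ _ (single_mem_shiftComponent ?_)
        rw [mul_inv_cancel]
        exact hA.grading.one_mem
      -- On the standard basis vectors left and right multiplication by `Z` agree, and `f` commutes
      -- with the latter.
      have h3 : (leftMul F k Z) (Pi.single j 1) = op Z • Pi.single j 1 := by
        funext l
        by_cases hl : l = j
        · subst hl; simp [leftMul_apply]
        · simp [leftMul_apply, hl]
      change leftMul F k Z (f (Pi.single j 1)) = sgn F i • f (leftMul F k Z (Pi.single j 1))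
      rw [h3, map_smul]
      funext l
      have h4 := hcomm _ _ (mem_shiftComponent.1 h1 l)
      rw [leftMul_apply, h4]
      -- All shifts are even, so the matrix entries of `f` have the parity of `f`.
      have h5 : (h * (γ j, (1 : Z2)) * (γ l, (1 : Z2))⁻¹).2 = i := by
        rw [← hi]
        simp
      rw [h5]
      rfl
    have := hle hf
    rw [LinearMap.mem_ker, LinearMap.sub_apply, sub_eq_zero] at this
    exact this

end Parity

/-! ### The models -/

section Transport

variable {F : Type*} [Field F] {H : Type*} [CommGroup H] {D : Type*} [Ring D] [Algebra F D]
variable {T T' : Subgroup H} {β : T →* T →* Fˣ} {β' : T' →* T' →* Fˣ} {A : H → Submodule F D}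

/-- Supports are compared elementwise, so that factors on different subgroup types need no casts. -/
theorem IsTwisted.congr (hA : IsTwisted β A) (hT : ∀ x, x ∈ T ↔ x ∈ T')
    (hβ : ∀ x y hx hy hx' hy', β ⟨x, hx⟩ ⟨y, hy⟩ = β' ⟨x, hx'⟩ ⟨y, hy'⟩) : IsTwisted β' A where
  grading := hA.grading
  nontrivial := hA.nontrivial
  isUnit := hA.isUnit
  ne_bot h := (hA.ne_bot h).trans (hT h)
  comm s t x hx y hy := by
    rw [hA.comm ⟨s, (hT _).2 s.2⟩ ⟨t, (hT _).2 t.2⟩ x hx y hy, hβ]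
  one_dim := hA.one_dim

theorem IsTwisted.isGradedDivision_map (hA : IsTwisted β A) {D' : Type*} [Ring D'] [Algebra F D']
    (θ : D ≃ₐ[F] D') : IsGradedDivision (fun h => (A h).map θ.toLinearMap) := by
  refine ⟨hA.grading.map θ, θ.symm.toEquiv.nontrivial_congr.2 hA.nontrivial, ?_⟩
  rintro h _ ⟨d, hd, rfl⟩ h0
  exact (hA.isUnit h d hd (by rintro rfl; exact h0 (map_zero θ))).map θ

end Transport

/-! ### Passing between superalgebra gradings and gradings by `G × ℤ₂` -/

section SuperGradings

variable {F : Type u} [Field F] {G : Type v} [CommGroup G] {n : ℕ}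

theorem isVectorGrading_sharpGrading {Γ : G → Submodule F (Mnn F n)} (hΓ : IsSuperGrading Γ) :
    (∀ g, coarsening (MonoidHom.fst G Z2) (sharpGrading Γ) g = Γ g) ∧
      ∀ i, coarsening (MonoidHom.snd G Z2) (sharpGrading Γ) i = mnnParity F n i := by
  have h1 : ∀ g, coarsening (MonoidHom.fst G Z2) (sharpGrading Γ) g = Γ g := fun g => by
    rw [coarsening_fst_apply]
    exact (hΓ.2 g).symm
  refine ⟨h1, congrFun ((isVectorGrading_mnnParity n).eq_of_le ?_ fun i => ?_)⟩
  · rw [eq_top_iff, ← hΓ.1.1.2]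
    refine iSup_le fun g => ?_
    rw [← h1]
    exact iSup_le fun x => iSup_le fun _ =>
      le_iSup_of_le x.2 (le_coarsening (MonoidHom.snd G Z2) (sharpGrading Γ) x)
  · rw [coarsening_snd_apply]
    exact iSup_le fun g => inf_le_right

variable {R : Type*} [Ring R] [Algebra F R] {W : Sharp G → Submodule F R}

/-- A `G × ℤ₂`-grading whose parity is that of `M(n,n)` yields a grading on the superalgebra
`M(n,n)`. -/
theorem exists_isSuperGrading (hW : IsAlgebraGrading W) (φ : R ≃ₐ[F] Mnn F n)
    (hφ : ∀ i, (coarsening (MonoidHom.snd G Z2) W i).map φ.toLinearMap = mnnParity F n i) :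
    ∃ Γ : G → Submodule F (Mnn F n), IsSuperGrading Γ ∧ GradedIso (sharpGrading Γ) W ∧
      SuperIso (mnnParity F n) Γ (coarsening (MonoidHom.snd G Z2) W)
        (coarsening (MonoidHom.fst G Z2) W) := by
  have hsharp : ∀ g i, (coarsening (MonoidHom.fst G Z2) W g).map φ.toLinearMap ⊓ mnnParity F n i =
      (W (g, i)).map φ.toLinearMap := fun g i => by
    rw [← hφ, ← hW.1.coarsening_fst_inf_snd]
    exact (Submodule.map_inf _ φ.injective).symm
  refine ⟨fun g => (coarsening (MonoidHom.fst G Z2) W g).map φ.toLinearMap,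
    ⟨(hW.coarsening _).map φ, fun g => ?_⟩, ?_, ?_⟩
  · simp only [hsharp]
    rw [coarsening_fst_apply, Submodule.map_iSup]
  · exact GradedIso.symm ⟨φ, fun x => (hsharp x.1 x.2).symm⟩
  · exact SuperIso.symm ⟨φ, hφ, fun g => rfl⟩

theorem isOddGrading_of_gradedIso {Γ : G → Submodule F (Mnn F n)} (hΓ : IsSuperGrading Γ)
    {D : Type*} [Ring D] [Algebra F D] {T : Subgroup (Sharp G)} {β : T →* T →* Fˣ}
    {A : Sharp G → Submodule F D} (hA : IsTwisted β A) (hT : ∃ g : G, (g, odd) ∈ T)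
    {D' : Type u} [Ring D'] [Algebra F D'] [FiniteDimensional F D'] (θ : D ≃ₐ[F] D')
    {k : ℕ} (γ : Fin k → Sharp G)
    (h : GradedIso (sharpGrading Γ) (endComponent D (shiftComponent A γ))) : IsOddGrading Γ := by
  have hA' := hA.isGradedDivision_map θ
  obtain ⟨φ, hφ⟩ := h.trans (gradedIso_endComponent_of_gradedIso ⟨θ, fun h => rfl⟩ γ)
  obtain ⟨g, hg⟩ := hT
  refine ⟨hΓ, D', inferInstance, inferInstance, inferInstance, fun h => (A h).map θ.toLinearMap,
    Fin k → D', inferInstance, inferInstance, inferInstance, inferInstance, inferInstance,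
    shiftComponent _ γ, hA', ⟨g, fun h0 => ?_⟩, isGradedRightModule_shift hA'.1 γ, φ, hφ⟩
  refine (hA.ne_bot _).2 hg ((Submodule.eq_bot_iff _).2 fun x hx => ?_)
  have : θ x ∈ (⊥ : Submodule F D') := h0 ▸ Submodule.mem_map_of_mem hx
  simpa using this

theorem exists_isOddGrading_superIso {D : Type*} [Ring D] [Algebra F D] {T : Subgroup (Sharp G)}
    {β : T →* T →* Fˣ} {A : Sharp G → Submodule F D} (hA : IsTwisted β A)
    (hT : ∃ g : G, (g, odd) ∈ T) {D' : Type u} [Ring D'] [Algebra F D'] [FiniteDimensional F D']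
    (θ : D ≃ₐ[F] D') {k : ℕ} (γ : Fin k → Sharp G)
    (φ : Module.End Dᵐᵒᵖ (Fin k → D) ≃ₐ[F] Mnn F n)
    (hφ : ∀ i, (coarsening (MonoidHom.snd G Z2) (endComponent D (shiftComponent A γ)) i).map
      φ.toLinearMap = mnnParity F n i) :
    ∃ Γ : G → Submodule F (Mnn F n), IsOddGrading Γ ∧
      SuperIso (mnnParity F n) Γ
        (coarsening (MonoidHom.snd G Z2) (endComponent D (shiftComponent A γ)))
        (coarsening (MonoidHom.fst G Z2) (endComponent D (shiftComponent A γ))) := by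
  obtain ⟨Γ, hΓ, hiso, hs⟩ :=
    exists_isSuperGrading (isAlgebraGrading_endComponent hA.grading γ) φ hφ
  exact ⟨Γ, isOddGrading_of_gradedIso hΓ hA hT θ γ hiso, hs⟩

end SuperGradings

/-! ### The models are odd gradings on `M(n,n)` -/

section Models

variable {F : Type u} [Field F] {G : Type v} [CommGroup G] {χ : CharFamily F G} {n : ℕ}

/-- `IsOddGrading` asks for `D` in the universe of `F`, while `StdAlgebra F B` also involves that of
the group; matrices provide a copy in the right place. -/
theorem exists_algEquiv_matrix (F : Type u) [Field F] {H : Type*} [CommGroup H] {T : Subgroup H}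
    [Finite T] (B : Subgroup T) :
    ∃ m : ℕ, Nonempty (StdAlgebra F B ≃ₐ[F] Matrix (Fin m) (Fin m) F) := by
  have b := Module.finBasis F (B →₀ F)
  exact ⟨_, ⟨LinearMap.toMatrixAlgEquiv b⟩⟩

namespace OddParams

variable (p : OddParams χ n) {A B : Subgroup p.Tu}

theorem k_pos (hn : 1 ≤ n) : 0 < p.k := by
  have h := p.size
  rcases Nat.eq_zero_or_pos p.k with h0 | h0
  · rw [h0] at h
    have : 0 < n ^ 2 := by positivity
    omega
  · exact h0

theorem isTwisted (hF : ringChar F ≠ 2) (hχ : p.char p.c.τ = -1)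
    (hd : IsStandardDecomposition p.βu A B) :
    IsTwisted (D := StdAlgebra F B) p.βu (stdComponent p.βu A B) := by
  have := p.finite_Tu
  exact isTwisted_std p.βu_self (p.βu_nondegenerate hF hχ) hd

/-- From `|B|² = dim D = |T_u| = 4|T̄|` one gets `(k|B|)² = (2n)²`; the number `k|B|` is the
dimension of the simple module `(FB)^k`. -/
theorem k_mul_card (hF : ringChar F ≠ 2) (hχ : p.char p.c.τ = -1)
    (hd : IsStandardDecomposition p.βu A B) : p.k * Nat.card B = 2 * n := by
  have := p.finite_Tu
  have h1 := (p.isTwisted hF hχ hd).finrank_eq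
  rw [finrank_stdAlgebra, p.card_Tu] at h1
  have h2 : (p.k * Nat.card B) ^ 2 = (2 * n) ^ 2 := by
    rw [mul_pow, pow_two (Nat.card B), h1, mul_pow, ← p.size]
    ring
  exact Nat.pow_left_injective two_ne_zero h2

theorem βu_τ (hχ : p.char p.c.τ = -1) (x : p.Tu) : (p.βu (p.ι p.c.τ) x : F) = sgn F x.1.2 := by
  have hτ : ∀ s, p.c.βplus p.c.τ s = 1 := p.c.βplus_radical.2 (Or.inr rfl)
  obtain ⟨s, rfl | rfl⟩ := p.Tu_cases x
  · rw [βu_ι, hτ, Units.val_one]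
    exact (sgn_one).symm
  · rw [map_mul, βu_ι, hτ, mul_one, βu_ι_t₁, hχ]
    have h1 : (p.t₁ * p.ι s).1.2 = odd := mul_one odd
    rw [h1, sgn_odd]
    simp

theorem ι_τ_sq : p.ι p.c.τ ^ 2 = 1 := by
  have h1 : p.c.t₀ ^ 2 = 1 := by rw [← p.c.order_t₀]; exact pow_orderOf_eq_one _
  exact Subtype.ext (Prod.ext h1 (one_pow 2))

/-- The model is isomorphic to `M(n,n)` as a superalgebra. -/
theorem exists_algEquiv_model [IsAlgClosed F] (hF : ringChar F ≠ 2) (hχ : p.char p.c.τ = -1)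
    (hd : IsStandardDecomposition p.βu A B) :
    ∃ φ : Module.End (StdAlgebra F B)ᵐᵒᵖ (Fin p.k → StdAlgebra F B) ≃ₐ[F] Mnn F n, ∀ i,
      (coarsening (MonoidHom.snd G Z2) (p.modelComponent A B) i).map φ.toLinearMap =
        mnnParity F n i := by
  have := p.finite_Tu
  have := Fintype.ofFinite B
  have hW : Module.finrank F (Fin p.k → B →₀ F) = 2 * n := by
    rw [Module.finrank_pi_fintype]
    simp only [Module.finrank_finsupp_self, Finset.sum_const, Finset.card_univ, Fintype.card_fin,
      smul_eq_mul]
    rw [← Nat.card_eq_fintype_card]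
    exact p.k_mul_card hF hχ hd
  -- Matrices over `End(FB)` act on `(FB)^k`, which makes the model a full endomorphism algebra over
  -- `F`.
  have e := (endAlgEquivMatrix F (StdAlgebra F B) p.k).trans
    (endVecAlgEquivMatrixEnd (Fin p.k) F F (B →₀ F)).symm
  have h2 : (2 : F) ≠ 0 := Ring.two_ne_zero hF
  exact exists_algEquiv_of_isTwisted (D := StdAlgebra F B) h2 (p.isTwisted hF hχ hd) hW e p.γ
    (p.ι p.c.τ) p.ι_τ_sq (p.βu_τ hχ) p.t₁ rfl

theorem exists_isOddGrading [IsAlgClosed F] (hF : ringChar F ≠ 2) (hχ : p.char p.c.τ = -1) :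
    ∃ Γ : G → Submodule F (Mnn F n), IsOddGrading Γ ∧ p.Describes Γ := by
  have := p.finite_Tu
  obtain ⟨A, B, hd⟩ := exists_isStandardDecomposition p.βu_self (p.βu_nondegenerate hF hχ)
  obtain ⟨φ, hφ⟩ := p.exists_algEquiv_model hF hχ hd
  obtain ⟨m, ⟨θ⟩⟩ := exists_algEquiv_matrix F B
  obtain ⟨Γ, hΓ, hs⟩ := exists_isOddGrading_superIso (D := StdAlgebra F B)
    (p.isTwisted hF hχ hd) ⟨p.u, p.t₁.2⟩ θ _ φ hφ
  exact ⟨Γ, hΓ, A, B, hd, hs⟩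

end OddParams

end Models

/-! ### Odd gradings come from parameters -/

section Center

variable {F : Type*} [Field F] {H : Type*} [CommGroup H] {D : Type*} [Ring D] [Algebra F D]
variable {T : Subgroup H} {β : T →* T →* Fˣ} {A : H → Submodule F D}

theorem isCentral_of_algEquiv {R R' : Type*} [Ring R] [Algebra F R] [Ring R'] [Algebra F R']
    [Algebra.IsCentral F R] (φ : R ≃ₐ[F] R') : Algebra.IsCentral F R' where
  out x hx := by
    have h1 : φ.symm x ∈ Subalgebra.center F R := by
      rw [Subalgebra.mem_center_iff] at hx ⊢
      intro y
      apply φ.injective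
      rw [map_mul, map_mul, AlgEquiv.apply_symm_apply, hx]
    obtain ⟨a, ha⟩ := Algebra.mem_bot.1 (Algebra.IsCentral.out h1)
    exact Algebra.mem_bot.2 ⟨a, by rw [← φ.commutes, ha, AlgEquiv.apply_symm_apply]⟩

/-- If the endomorphism algebra of a free module is central, then so is the graded division
algebra, and its commutation factor is nondegenerate. -/
theorem IsTwisted.nondegenerate_of_isCentral (hA : IsTwisted β A) {k : ℕ} (hk : 0 < k)
    [Algebra.IsCentral F (Module.End Dᵐᵒᵖ (Fin k → D))] (s : T) (hs : ∀ t, β s t = 1) :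
    s = 1 := by
  obtain ⟨X, hX, hX0⟩ := hA.exists_ne_zero s
  have hc : ∀ d, X * d = d * X := by
    refine hA.grading.1.induction (fun h d hd => ?_) (by simp) fun x y hx hy => by
      rw [mul_add, hx, hy, add_mul]
    by_cases hd0 : d = 0
    · rw [hd0, mul_zero, zero_mul]
    · rw [hA.comm s ⟨h, hA.mem_support hd hd0⟩ X hX d hd, hs, Units.val_one, one_smul]
  -- As `X` is central in `D`, its left multiplication coincides with a right action, so it is a
  -- central endomorphism. Centrality makes `X` a scalar, and its degree is then `1`.
  have hop : ∀ y : Fin k → D, leftMul F k X y = op X • y := fun y => funext fun i => hc (y i)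
  have hmem : leftMul F k X ∈ Subalgebra.center F (Module.End Dᵐᵒᵖ (Fin k → D)) := by
    rw [Subalgebra.mem_center_iff]
    intro r
    refine LinearMap.ext fun y => ?_
    change r (leftMul F k X y) = leftMul F k X (r y)
    rw [hop, hop, map_smul]
  obtain ⟨a, ha⟩ := Algebra.mem_bot.1 (Algebra.IsCentral.out hmem)
  have h1 : a • (1 : D) = X := by
    have := congrFun (LinearMap.congr_fun ha (Pi.single ⟨0, hk⟩ 1)) ⟨0, hk⟩
    rw [leftMul_apply, Module.algebraMap_end_apply] at this
    simpa using this
  have h2 : X ∈ A 1 := h1 ▸ Submodule.smul_mem _ _ hA.grading.one_mem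
  exact Subtype.ext (hA.grading.1.eq_of_mem hX0 hX h2)

end Center

section Existence

variable {F : Type u} [Field F] {G : Type v} [CommGroup G]

theorem gradedIso_of_isTwisted [IsAlgClosed F] {H : Type*} [CommGroup H]
    {D D' : Type*} [Ring D] [Algebra F D] [FiniteDimensional F D] [Ring D'] [Algebra F D']
    [FiniteDimensional F D'] {T T' : Subgroup H} {β : T →* T →* Fˣ} {β' : T' →* T' →* Fˣ}
    {A : H → Submodule F D} {A' : H → Submodule F D'} (hA : IsTwisted β A)
    (hA' : IsTwisted β' A') (hT : ∀ x, x ∈ T ↔ x ∈ T')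
    (hβ : ∀ x y hx hy hx' hy', β ⟨x, hx⟩ ⟨y, hy⟩ = β' ⟨x, hx'⟩ ⟨y, hy'⟩)
    {P Q : Subgroup T'} (hd : IsStandardDecomposition β' P Q) {k k' : ℕ} (γ : Fin k → H)
    (γ' : Fin k' → H) (σ : Fin k' ≃ Fin k) (c : H) (hσ : ∀ j, c * (γ' j)⁻¹ * γ (σ j) ∈ T) :
    GradedIso (endComponent D (shiftComponent A γ)) (endComponent D' (shiftComponent A' γ')) :=
  (gradedIso_shift hA γ γ' σ c hσ).trans
    (gradedIso_endComponent_of_gradedIso ((hA.congr hT hβ).gradedIso hA' hd) γ')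

theorem superIso_of_gradedIso [IsAlgClosed F] {n : ℕ} {Γ : G → Submodule F (Mnn F n)}
    (hΓ : IsSuperGrading Γ)
    {D D' : Type*} [Ring D] [Algebra F D] [FiniteDimensional F D] [Ring D'] [Algebra F D']
    [FiniteDimensional F D'] {T T' : Subgroup (Sharp G)} {β : T →* T →* Fˣ} {β' : T' →* T' →* Fˣ}
    {A : Sharp G → Submodule F D} {A' : Sharp G → Submodule F D'} (hA : IsTwisted β A)
    (hA' : IsTwisted β' A') (hT : ∀ x, x ∈ T ↔ x ∈ T')
    (hβ : ∀ x y hx hy hx' hy', β ⟨x, hx⟩ ⟨y, hy⟩ = β' ⟨x, hx'⟩ ⟨y, hy'⟩)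
    {P Q : Subgroup T'} (hd : IsStandardDecomposition β' P Q) {k : ℕ} (γ γ' : Fin k → Sharp G)
    (hγ : ∀ j, (γ' j)⁻¹ * γ j ∈ T)
    (hiso : GradedIso (sharpGrading Γ) (endComponent D (shiftComponent A γ))) :
    SuperIso (mnnParity F n) Γ
      (coarsening (MonoidHom.snd G Z2) (endComponent D' (shiftComponent A' γ')))
      (coarsening (MonoidHom.fst G Z2) (endComponent D' (shiftComponent A' γ'))) := by
  have h := (hiso.trans (gradedIso_of_isTwisted hA hA' hT hβ hd γ γ' (Equiv.refl _) 1
    fun j => by rw [one_mul]; exact hγ j)).superIso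
  rwa [funext (isVectorGrading_sharpGrading hΓ).1, funext (isVectorGrading_sharpGrading hΓ).2] at h

theorem exists_describes_of_gradedIso [IsAlgClosed F] (hF : ringChar F ≠ 2) {n : ℕ} (hn : 1 ≤ n)
    (χ : CharFamily F G)
    (hχ : ∀ (t₀ : G) (Tbar : Subgroup (G ⧸ zpowers t₀)),
      orderOf t₀ = 2 → Finite Tbar → ∀ t : tPlus t₀ Tbar, (t : G) = t₀ → χ t₀ Tbar t = -1)
    {Γ : G → Submodule F (Mnn F n)} (hΓ : IsSuperGrading Γ)
    {D : Type*} [Ring D] [Algebra F D] [FiniteDimensional F D] {T : Subgroup (Sharp G)}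
    {β : T →* T →* Fˣ} {A : Sharp G → Submodule F D} (hA : IsTwisted β A) (hβ : ∀ t, β t t = 1)
    (hodd : ∃ g : G, (g, odd) ∈ T) {k : ℕ} (g : Fin k → Sharp G)
    (hiso : GradedIso (sharpGrading Γ) (endComponent D (shiftComponent A g))) :
    ∃ p : OddParams χ n, p.Describes Γ := by
  have := hA.finite_support
  have : Nonempty (Fin n) := ⟨⟨0, hn⟩⟩
  obtain ⟨φ, -⟩ := id hiso
  have hk : 0 < k := by
    rcases Nat.eq_zero_or_pos k with rfl | h
    · have := φ.toEquiv.symm.nontrivial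
      exact absurd (Subsingleton.elim (0 : Module.End Dᵐᵒᵖ (Fin 0 → D)) 1) zero_ne_one
    · exact h
  have := isCentral_of_algEquiv φ
  have hnd := hA.nondegenerate_of_isCentral hk
  obtain ⟨c, r, hr, H⟩ := exists_params hF χ hχ β hβ hnd hodd
  have hcard : Nat.card T = 4 * Nat.card c.Tbar := by
    -- `T_u` does not depend on the size data, so the dummy values `n = k = 0` suffice to compute
    -- its order.
    have h0 : 0 ^ 2 * Nat.card c.Tbar = 0 ^ 2 := by simp
    rw [← Subgroup.ext (H 0 0 Fin.elim0 h0).1]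
    exact OddParams.card_Tu _
  have hs : k ^ 2 * Nat.card c.Tbar = n ^ 2 := by
    have h1 := φ.toLinearEquiv.finrank_eq
    rw [finrank_end, hA.finrank_eq, hcard, Module.finrank_matrix] at h1
    simp only [Fintype.card_sum, Fintype.card_fin, Module.finrank_self] at h1
    nlinarith
  -- Multiplying an odd shift by the inverse of an odd element of `T` makes it even without changing
  -- its coset.
  have hγ : ∀ i, ∃ x : G, (x, (1 : Z2))⁻¹ * g i ∈ T := by
    intro i
    obtain ⟨g₀, hg₀⟩ := hodd
    rcases z2_cases (g i).2 with h | h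
    · refine ⟨(g i).1, ?_⟩
      have : ((g i).1, (1 : Z2)) = g i := Prod.ext rfl h.symm
      rw [this, inv_mul_cancel]
      exact one_mem _
    · refine ⟨g₀⁻¹ * (g i).1, ?_⟩
      have : (g₀⁻¹ * (g i).1, (1 : Z2))⁻¹ * g i = (g₀, odd) := by
        refine Prod.ext ?_ ?_
        · change (g₀⁻¹ * (g i).1)⁻¹ * (g i).1 = g₀
          rw [mul_inv_rev, inv_inv, mul_assoc, mul_comm g₀, inv_mul_cancel_left]
        · change (1 : Z2)⁻¹ * (g i).2 = odd
          rw [h, inv_one, one_mul]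
      rw [this]
      exact hg₀
  choose γ hγ using hγ
  let p : OddParams χ n := ⟨c, r, hr, k, γ, hs⟩
  have hχp : p.char p.c.τ = -1 := hχ _ _ c.order_t₀ c.finite_Tbar _ rfl
  obtain ⟨h1, h2⟩ := H n k γ hs
  have := p.finite_Tu
  obtain ⟨P, Q, hd⟩ := exists_isStandardDecomposition p.βu_self (p.βu_nondegenerate hF hχp)
  exact ⟨p, P, Q, hd, superIso_of_gradedIso (D' := StdAlgebra F Q) hΓ hA
    (p.isTwisted hF hχp hd) (fun x => (h1 x).symm)
    (fun x y hx hy hx' hy' => (h2 x y hx' hy' hx hy).symm) hd g (fun i => (γ i, (1 : Z2)))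
    (fun j => hγ j) hiso⟩

theorem IsOddGrading.exists_describes [IsAlgClosed F] (hF : ringChar F ≠ 2) {n : ℕ} (hn : 1 ≤ n)
    (χ : CharFamily F G)
    (hχ : ∀ (t₀ : G) (Tbar : Subgroup (G ⧸ zpowers t₀)),
      orderOf t₀ = 2 → Finite Tbar → ∀ t : tPlus t₀ Tbar, (t : G) = t₀ → χ t₀ Tbar t = -1)
    {Γ : G → Submodule F (Mnn F n)} (hΓ : IsOddGrading Γ) :
    ∃ p : OddParams χ n, p.Describes Γ := by
  obtain ⟨hΓ, D, _, _, _, A, U, _, _, _, _, _, V, hA, ⟨g₀, hg₀⟩, hV, φ, hφ⟩ := hΓ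
  obtain ⟨T, β, hT, hβ⟩ := hA.exists_isTwisted
  have := hA.2.1
  obtain ⟨k, g, f, hf, hfV⟩ := hV.exists_basis hA.1 hA.2.2
  have h1 : GradedIso (endComponent D (shiftComponent A g)) (endComponent D V) :=
    gradedIso_endComponent f (fun d => ⟨d, hf d⟩) (fun d => ⟨d, hf d⟩) 1 fun h x => by
      rw [mul_one]; exact hfV h x
  exact exists_describes_of_gradedIso hF hn χ hχ hΓ hT hβ ⟨g₀, (hT.ne_bot _).1 hg₀⟩ g
    (GradedIso.trans ⟨φ, hφ⟩ h1.symm)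

end Existence

/-! ### The isomorphism problem -/

section Cosets

variable {G : Type v} [CommGroup G] (N : Subgroup G) {k k' : ℕ} {γ : Fin k → G} {γ' : Fin k' → G}

open Classical in
theorem count_Xi (x : G) :
    (Xi N γ).count (x : G ⧸ N) = (Finset.univ.filter fun i => x * (γ i)⁻¹ ∈ N).card := by
  rw [Xi, Multiset.count_map, Finset.card_def, Finset.filter_val]
  congr 2
  funext i
  rw [QuotientGroup.eq_iff_div_mem, div_eq_mul_inv]

open Classical in
theorem map_smul_Xi_eq {g : G} (h : ∀ x : G, (Finset.univ.filter fun i => x * (γ i)⁻¹ ∈ N).card =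
    (Finset.univ.filter fun j => x * g * (γ' j)⁻¹ ∈ N).card) :
    (Xi N γ).map (fun x => g • x) = Xi N γ' := by
  refine Multiset.ext.2 fun q => ?_
  obtain ⟨y, rfl⟩ := QuotientGroup.mk_surjective q
  have h1 : (y : G ⧸ N) = g • ((g⁻¹ * y : G) : G ⧸ N) := by
    rw [MulAction.Quotient.smul_coe, smul_eq_mul, mul_inv_cancel_left]
  have h2 := h (g⁻¹ * y)
  rw [← count_Xi, mul_comm (g⁻¹ * y), mul_inv_cancel_left, ← count_Xi] at h2
  rw [← h2, h1]
  exact Multiset.count_map_eq_count' _ _ (MulAction.injective g) _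

theorem exists_equiv_of_map_smul_Xi_eq {g : G}
    (h : (Xi N γ).map (fun x => g • x) = Xi N γ') :
    ∃ σ : Fin k' ≃ Fin k, ∀ j, g * (γ' j)⁻¹ * γ (σ j) ∈ N := by
  classical
  rw [Xi, Xi, Multiset.map_map] at h
  let f : Fin k → G ⧸ N := fun i => ((g * γ i : G) : G ⧸ N)
  let f' : Fin k' → G ⧸ N := fun j => (γ' j : G ⧸ N)
  -- Equal multisets have fibres of equal size, and bijections between the fibres assemble to a
  -- permutation of the indices.
  have hc : ∀ q, Fintype.card {j // f' j = q} = Fintype.card {i // f i = q} := by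
    intro q
    have := congrArg (Multiset.count q) h
    rw [Multiset.count_map, Multiset.count_map] at this
    rw [Fintype.card_subtype, Fintype.card_subtype, Finset.card_def, Finset.card_def,
      Finset.filter_val, Finset.filter_val]
    simp only [eq_comm (b := q)]
    exact this.symm
  let σ := Equiv.ofFiberEquiv fun q => Fintype.equivOfCardEq (hc q)
  refine ⟨σ, fun j => ?_⟩
  have h1 : f (σ j) = f' j := Equiv.ofFiberEquiv_map _ _
  have h2 := QuotientGroup.eq_iff_div_mem.1 h1
  rwa [div_eq_mul_inv, mul_right_comm] at h2

end Cosets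

section Classification

variable {F : Type u} [Field F] {G : Type v} [CommGroup G]

theorem superIso_iff_gradedIso {n : ℕ} {Γ Γ' : G → Submodule F (Mnn F n)}
    {R R' : Type*} [Ring R] [Algebra F R] [Ring R'] [Algebra F R']
    {W : Sharp G → Submodule F R} {W' : Sharp G → Submodule F R'}
    (hW : IsVectorGrading W) (hW' : IsVectorGrading W')
    (h : SuperIso (mnnParity F n) Γ (coarsening (MonoidHom.snd G Z2) W)
      (coarsening (MonoidHom.fst G Z2) W))
    (h' : SuperIso (mnnParity F n) Γ' (coarsening (MonoidHom.snd G Z2) W')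
      (coarsening (MonoidHom.fst G Z2) W')) :
    SuperIso (mnnParity F n) Γ (mnnParity F n) Γ' ↔ GradedIso W W' :=
  ⟨fun hs => (h.symm.trans (hs.trans h')).gradedIso hW hW',
    fun hg => h.trans (hg.superIso.trans h'.symm)⟩

namespace OddParams

variable {χ : CharFamily F G} {n : ℕ} (p p' : OddParams χ n)

/-- The shift `c` matters only modulo `T_u`, which has odd elements, so it may be replaced by an
even shift `(g, 1)`. Since `T⁺` is the even part of `T_u`, the counts then concern cosets of `T⁺` in
`G`. -/
theorem exists_map_smul_Xi_eq (hc : p.c = p'.c) {c : Sharp G} (h : open Classical in ∀ h : Sharp G,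
      (Finset.univ.filter fun i => h * (p.γ i, (1 : Z2))⁻¹ ∈ p.Tu).card =
      (Finset.univ.filter fun j => h * c * (p'.γ j, (1 : Z2))⁻¹ ∈ p'.Tu).card) :
    ∃ g : G, (Xi p.c.Tplus p.γ).map (fun x => g • x) = Xi p.c.Tplus p'.γ := by
  classical
  obtain ⟨g, hg⟩ : ∃ g : G, c⁻¹ * (g, 1) ∈ p'.Tu := by
    obtain ⟨c₁, c₂⟩ := c
    rcases z2_cases c₂ with rfl | rfl
    · exact ⟨c₁, by rw [inv_mul_cancel]; exact one_mem _⟩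
    · refine ⟨c₁ * p'.u, ?_⟩
      have : (c₁, odd)⁻¹ * (c₁ * p'.u, (1 : Z2)) = (p'.u, odd) := by
        refine Prod.ext (inv_mul_cancel_left c₁ p'.u) ?_
        change odd⁻¹ * (1 : Z2) = odd
        decide
      rw [this]
      exact p'.t₁.2
  refine ⟨g, map_smul_Xi_eq _ fun x => ?_⟩
  have h1 := h (x, 1)
  have h2 : ∀ y : G, (x, 1) * c * (y, (1 : Z2))⁻¹ ∈ p'.Tu ↔ x * g * y⁻¹ ∈ p.c.Tplus := by
    intro y
    have he : (x, 1) * c * (y, (1 : Z2))⁻¹ * (c⁻¹ * (g, 1)) = (x * g * y⁻¹, 1) := by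
      rw [show (x, 1) * c * (y, (1 : Z2))⁻¹ * (c⁻¹ * (g, 1)) =
        (x, 1) * (g, 1) * (y, (1 : Z2))⁻¹ * (c * c⁻¹) by ac_rfl, mul_inv_cancel, mul_one]
      exact Prod.ext rfl (by simp)
    rw [← mul_mem_cancel_right hg, he, mem_Tu_even, hc]
  have h3 : ∀ y : G, (x, 1) * (y, (1 : Z2))⁻¹ ∈ p.Tu ↔ x * y⁻¹ ∈ p.c.Tplus := by
    intro y
    rw [← p.mem_Tu_even]
    have he : (x, 1) * (y, (1 : Z2))⁻¹ = (x * y⁻¹, 1) := Prod.ext rfl (by simp)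
    rw [he]
  simpa only [h2, h3] using h1

/-- Only support and commutation factor of `D` and `D'` are used, so the decompositions `T_u = A ×
B` chosen for the two models are irrelevant. -/
theorem gradedIso_model_iff [IsAlgClosed F] (hF : ringChar F ≠ 2) (hn : 1 ≤ n)
    (hχ' : p'.char p'.c.τ = -1) {D D' : Type*} [Ring D] [Algebra F D]
    [FiniteDimensional F D] [Ring D'] [Algebra F D'] [FiniteDimensional F D']
    {A : Sharp G → Submodule F D} {A' : Sharp G → Submodule F D'}
    (hA : IsTwisted p.βu A) (hA' : IsTwisted p'.βu A') :
    GradedIso (endComponent D (shiftComponent A fun i => (p.γ i, (1 : Z2))))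
        (endComponent D' (shiftComponent A' fun i => (p'.γ i, (1 : Z2)))) ↔
      p.c = p'.c ∧ p.u⁻¹ * p'.u ∈ zpowers p.c.t₀ ∧
        ∃ g : G, (Xi p.c.Tplus p.γ).map (fun x => g • x) = Xi p.c.Tplus p'.γ := by
  constructor
  · intro h
    obtain ⟨hT, hβ, c, hcount⟩ :=
      invariants_of_gradedIso hA hA' (p.k_pos hn) (p'.k_pos hn) _ _ h
    obtain ⟨hc, hu⟩ := params_eq p p' hT hβ
    exact ⟨hc, hu, exists_map_smul_Xi_eq p p' hc hcount⟩
  · rintro ⟨hc, hu, g, hg⟩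
    obtain ⟨hT, hβ⟩ := factor_eq_of_params p p' hc hu
    obtain ⟨σ, hσ⟩ := exists_equiv_of_map_smul_Xi_eq _ hg
    have := p'.finite_Tu
    obtain ⟨P, Q, hd⟩ := exists_isStandardDecomposition p'.βu_self (p'.βu_nondegenerate hF hχ')
    refine gradedIso_of_isTwisted hA hA' hT hβ hd _ _ σ (g, 1) fun j => ?_
    have he : (g, 1) * (p'.γ j, (1 : Z2))⁻¹ * (p.γ (σ j), 1) = (g * (p'.γ j)⁻¹ * p.γ (σ j), 1) :=
      Prod.ext rfl (by simp)
    rw [he, mem_Tu_even]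
    exact hσ j

theorem superIso_model_iff [IsAlgClosed F] (hF : ringChar F ≠ 2) (hn : 1 ≤ n)
    (hχ' : p'.char p'.c.τ = -1) {D D' : Type*} [Ring D] [Algebra F D]
    [FiniteDimensional F D] [Ring D'] [Algebra F D'] [FiniteDimensional F D']
    {A : Sharp G → Submodule F D} {A' : Sharp G → Submodule F D'}
    (hA : IsTwisted p.βu A) (hA' : IsTwisted p'.βu A') {Γ Γ' : G → Submodule F (Mnn F n)}
    (h : SuperIso (mnnParity F n) Γ
      (coarsening (MonoidHom.snd G Z2)
        (endComponent D (shiftComponent A fun i => (p.γ i, (1 : Z2)))))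
      (coarsening (MonoidHom.fst G Z2)
        (endComponent D (shiftComponent A fun i => (p.γ i, (1 : Z2))))))
    (h' : SuperIso (mnnParity F n) Γ'
      (coarsening (MonoidHom.snd G Z2)
        (endComponent D' (shiftComponent A' fun i => (p'.γ i, (1 : Z2)))))
      (coarsening (MonoidHom.fst G Z2)
        (endComponent D' (shiftComponent A' fun i => (p'.γ i, (1 : Z2)))))) :
    SuperIso (mnnParity F n) Γ (mnnParity F n) Γ' ↔
      p.c = p'.c ∧ p.u⁻¹ * p'.u ∈ zpowers p.c.t₀ ∧
        ∃ g : G, (Xi p.c.Tplus p.γ).map (fun x => g • x) = Xi p.c.Tplus p'.γ := by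
  rw [superIso_iff_gradedIso (isAlgebraGrading_endComponent hA.grading _).1
    (isAlgebraGrading_endComponent hA'.grading _).1 h h']
  exact gradedIso_model_iff p p' hF hn hχ' hA hA'

theorem superIso_iff [IsAlgClosed F] (hF : ringChar F ≠ 2) (hn : 1 ≤ n)
    (hχ : p.char p.c.τ = -1) (hχ' : p'.char p'.c.τ = -1) {Γ Γ' : G → Submodule F (Mnn F n)}
    (h : p.Describes Γ) (h' : p'.Describes Γ') :
    SuperIso (mnnParity F n) Γ (mnnParity F n) Γ' ↔
      p.c = p'.c ∧ p.u⁻¹ * p'.u ∈ zpowers p.c.t₀ ∧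
        ∃ g : G, (Xi p.c.Tplus p.γ).map (fun x => g • x) = Xi p.c.Tplus p'.γ := by
  obtain ⟨A, B, hd, hs⟩ := h
  obtain ⟨A', B', hd', hs'⟩ := h'
  have := p.finite_Tu
  have := p'.finite_Tu
  exact superIso_model_iff (D := StdAlgebra F B) (D' := StdAlgebra F B') p p' hF hn hχ'
    (p.isTwisted hF hχ hd) (p'.isTwisted hF hχ' hd') hs hs'

end OddParams

end Classification

end OddGradings

end

theorem mainTheorem5 {F : Type*} [Field F] [IsAlgClosed F] (hF : ringChar F ≠ 2)
    {G : Type*} [CommGroup G] (n : ℕ) (hn : 1 ≤ n)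
    (χ : OddGradings.CharFamily F G)
    (hχ : ∀ (t₀ : G) (Tbar : Subgroup (G ⧸ Subgroup.zpowers t₀)),
      orderOf t₀ = 2 → Finite Tbar →
        ∀ t : OddGradings.tPlus t₀ Tbar, (t : G) = t₀ → χ t₀ Tbar t = -1) :
    -- the element `a` is well defined
    (∀ c : OddGradings.EvenData F G, ∃! a : c.Tplus, c.IsDistinguished (χ c.t₀ c.Tbar) a) ∧
    -- every choice of parameters yields an odd grading on `M(n,n)`
    (∀ p : OddGradings.OddParams χ n, ∃ Γ : G → Submodule F (OddGradings.Mnn F n),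
      OddGradings.IsOddGrading Γ ∧ p.Describes Γ) ∧
    -- every odd grading is isomorphic to one of these
    (∀ Γ : G → Submodule F (OddGradings.Mnn F n), OddGradings.IsOddGrading Γ →
      ∃ p : OddGradings.OddParams χ n, p.Describes Γ) ∧
    -- the isomorphism problem
    (∀ (p p' : OddGradings.OddParams χ n) (Γ Γ' : G → Submodule F (OddGradings.Mnn F n)),
      p.Describes Γ → p'.Describes Γ' →
      (OddGradings.SuperIso (OddGradings.mnnParity F n) Γ (OddGradings.mnnParity F n) Γ' ↔
        p.c = p'.c ∧ p.u⁻¹ * p'.u ∈ Subgroup.zpowers p.c.t₀ ∧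
        ∃ g : G, (OddGradings.Xi p.c.Tplus p.γ).map (fun x => g • x) =
          OddGradings.Xi p.c.Tplus p'.γ)) := by
  have hτ : ∀ c : OddGradings.EvenData F G, χ c.t₀ c.Tbar c.τ = -1 := fun c =>
    hχ _ _ c.order_t₀ c.finite_Tbar _ rfl
  exact ⟨fun c => c.existsUnique_isDistinguished hF _ (hτ c),
    fun p => p.exists_isOddGrading hF (hτ p.c),
    fun Γ hΓ => hΓ.exists_describes hF hn χ hχ,
    fun p p' Γ Γ' h h' => p.superIso_iff p' hF hn (hτ p.c) (hτ p'.c) h h'⟩
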